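/- Let $0\le k\le\infty$, $0\le\alpha<1$, $m\ge 0$, let $g$ be a Riemannian metric of class $C^{k,\alpha}$ on $\mathbb R^m$ (a $C^k$ tensor field whose $k$-th derivatives are, when $k<\infty$, locally Hölder continuous of exponent $\alpha$), and let $\widetilde T\le O(m)$ be a finite extension of a torus, i.e. a subgroup that has a normal subgroup of finite index isomorphic as a topological group to $(S^1)^r$ for some $r\ge 0$. Assume that $\widetilde T$, acting linearly on $\mathbb R^m$, acts by isometries of $g$. Let $X=(\mathbb R^m,g)/\widetilde T$ be the space of orbits with the quotient distance $d(\widetilde Tx,\widetilde Ty)=\inf\{d_g(x',y'):x'\in\widetilde Tx,\ y'\in\widetilde Ty\}$, where $d_g$ is the Riemannian distance of $g$. Call a metric space a Riemannian orbifold with a $C^{k,\alpha}$ metric if there is an $n$ such that every point has a ball that, with the restricted distance, is isometric to an open subset of a quotient $(\mathbb R^n,h)/\Gamma$, with $\Gamma\le O(n)$ a finite group and $h$ a $\Gamma$-invariant Riemannian metric of class $C^{k,\alpha}$ on $\mathbb R^n$. Call $p\in X$ a $C^{k,\alpha}$-orbifold point if for some $\varepsilon>0$ the ball $(B_\varepsilon(p),d)$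 is a Riemannian orbifold with a $C^{k,\alpha}$ metric, and let $B\subseteq X$ be the set of points that are not $C^{k,\alpha}$-orbifold points. Then $$\dim_{\mathrm{Haus}} B\ \le\ \min\{\,m-4,\ \dim_{\mathrm{Haus}} X-3\,\},$$ with the convention $\dim_{\mathrm{Haus}}\emptyset=-\infty$; in particular $B=\emptyset$ if the right-hand side is negative. -/

import Mathlib

open Set Filter Topology MeasureTheory Manifold
open scoped ENNReal NNReal ContDiff

noncomputable section

namespace TorusQuotient

/-- Euclidean space `ℝ^m`. -/
abbrev Eucl (m : ℕ) : Type := EuclideanSpace ℝ (Fin m)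

/-- The orthogonal group `O(m)`, realized as the group of the continuous linear operators `A` on
`ℝ^m` with `A* A = A A* = 1`, with the topology of the operator norm. -/
abbrev Orth (m : ℕ) : Type := unitary (Eucl m →L[ℝ] Eucl m)

theorem inv_apply_apply {m : ℕ} (A : Orth m) (x : Eucl m) :
    ((A⁻¹ : Orth m) : Eucl m →L[ℝ] Eucl m) ((A : Eucl m →L[ℝ] Eucl m) x) = x := by
  have h : (((A⁻¹ * A : Orth m)) : Eucl m →L[ℝ] Eucl m) x = x := by
    rw [inv_mul_cancel]; rfl
  exact h

/-- Two points of `ℝ^m` are equivalent if they lie in the same orbit of `T ≤ O(m)`. -/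
def orbitSetoid {m : ℕ} (T : Subgroup (Orth m)) : Setoid (Eucl m) where
  r x y := ∃ A ∈ T, (A : Eucl m →L[ℝ] Eucl m) x = y
  iseqv :=
    { refl := fun x => ⟨1, T.one_mem, rfl⟩
      symm := by
        rintro x y ⟨A, hA, rfl⟩
        exact ⟨A⁻¹, T.inv_mem hA, inv_apply_apply A x⟩
      trans := by
        rintro x y z ⟨A, hA, rfl⟩ ⟨B, hB, rfl⟩
        exact ⟨B * A, T.mul_mem hB hA, rfl⟩ }

/-- `f` is of class `C^{k,α}` in the local sense: it is `C^k` and, if `k` is finite, its `k`-th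
derivative is Hölder continuous of exponent `α` near every point.
(For `α = 0` the second condition is automatic: `C^{k,0} = C^k`; also `C^{∞,α} = C^∞`.) -/
def IsCkHolder {F G : Type*} [NormedAddCommGroup F] [NormedSpace ℝ F] [NormedAddCommGroup G]
    [NormedSpace ℝ G] (k : ℕ∞) (α : ℝ≥0) (f : F → G) : Prop :=
  ContDiff ℝ k f ∧ ∀ j : ℕ, (j : ℕ∞) = k → ∀ x : F, ∃ C : ℝ≥0, ∃ U ∈ 𝓝 x,
    HolderOnWith C α (iteratedFDeriv ℝ j f) U

/-- A Riemannian metric of class `C^{k,α}` on `ℝ^m`; `g x v w` is the inner product at `x` of the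
tangent vectors `v, w ∈ T_x ℝ^m = ℝ^m`. -/
structure CkMetric (k : ℕ∞) (α : ℝ≥0) (m : ℕ) where
  toFun : Eucl m → Eucl m →L[ℝ] Eucl m →L[ℝ] ℝ
  symm : ∀ x v w, toFun x v w = toFun x w v
  pos : ∀ x v, v ≠ 0 → 0 < toFun x v v
  regular : IsCkHolder k α toFun

instance (k : ℕ∞) (α : ℝ≥0) (m : ℕ) :
    CoeFun (CkMetric k α m) (fun _ => Eucl m → Eucl m →L[ℝ] Eucl m →L[ℝ] ℝ) := ⟨CkMetric.toFun⟩

namespace CkMetric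

variable {k : ℕ∞} {α : ℝ≥0} {m : ℕ}

/-- The length `√(g_x(v,v))` of a tangent vector. -/
@[reducible] def tangentENorm (g : CkMetric k α m) (x : Eucl m) :
    ENorm (TangentSpace 𝓘(ℝ, Eucl m) x) :=
  ⟨fun v => ENNReal.ofReal (√(g x v v))⟩

/-- The Riemannian distance of `g`: the infimum of the `g`-lengths of the `C^1` curves between two
points. -/
def riemDist (g : CkMetric k α m) (x y : Eucl m) : ℝ≥0∞ :=
  letI := g.tangentENorm
  riemannianEDist 𝓘(ℝ, Eucl m) x y

/-- The group `T ≤ O(m)` acts isometrically on `(ℝ^m, g)`, that is, the linear maps `A ∈ T`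
satisfy `A^* g = g`. -/
def IsInvariant (g : CkMetric k α m) (T : Subgroup (Orth m)) : Prop :=
  ∀ A ∈ T, ∀ x v w : Eucl m,
    g ((A : Eucl m →L[ℝ] Eucl m) x) ((A : Eucl m →L[ℝ] Eucl m) v) ((A : Eucl m →L[ℝ] Eucl m) w)
      = g x v w

theorem nonneg (g : CkMetric k α m) (x v : Eucl m) : 0 ≤ g x v v := by
  by_cases h : v = 0
  · simp [h]
  · exact (g.pos x v h).le

theorem continuous (g : CkMetric k α m) : Continuous g.toFun := g.regular.1.continuous

theorem enormSMul (g : CkMetric k α m) (x : Eucl m) :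
    letI := g.tangentENorm
    ENormSMulClass ℝ (TangentSpace 𝓘(ℝ, Eucl m) x) := by
  let := g.tangentENorm
  refine ⟨fun r v => ?_⟩
  have h : ∀ w : Eucl m, ENNReal.ofReal (√(g x (r • w) (r • w))) =
      ‖r‖ₑ * ENNReal.ofReal (√(g x w w)) := by
    intro w
    have h1 : g x (r • w) (r • w) = ‖r‖ ^ 2 * g x w w := by
      simp only [map_smul, FunLike.coe_smul, Pi.smul_apply, smul_eq_mul, Real.norm_eq_abs, sq_abs]
      ring
    rw [← ofReal_norm, ← ENNReal.ofReal_mul (norm_nonneg r), h1, Real.sqrt_mul (sq_nonneg _),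
      Real.sqrt_sq (norm_nonneg r)]
  exact h v

theorem riemDist_self (g : CkMetric k α m) (x : Eucl m) : g.riemDist x x = 0 := by
  let := g.tangentENorm
  have := g.enormSMul
  exact riemannianEDist_self

theorem riemDist_comm (g : CkMetric k α m) (x y : Eucl m) : g.riemDist x y = g.riemDist y x := by
  let := g.tangentENorm
  have := g.enormSMul
  exact riemannianEDist_comm

theorem riemDist_triangle (g : CkMetric k α m) (x y z : Eucl m) :
    g.riemDist x z ≤ g.riemDist x y + g.riemDist y z := by
  let := g.tangentENorm
  have := g.enormSMul
  exact riemannianEDist_triangle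

/-- The distance as an infimum of lengths `∫_0^1 √(g(c', c')) dt`. -/
theorem riemDist_lt_iff (g : CkMetric k α m) (x y : Eucl m) (r : ℝ≥0∞) :
    g.riemDist x y < r ↔ ∃ c : ℝ → Eucl m, c 0 = x ∧ c 1 = y ∧ ContDiffOn ℝ 1 c (Icc 0 1) ∧
      ∫⁻ t in Icc (0 : ℝ) 1, ENNReal.ofReal
        (√(g (c t) (derivWithin c (Icc 0 1) t) (derivWithin c (Icc 0 1) t))) < r := by
  let := g.tangentENorm
  have := g.enormSMul
  have key : ∀ c : ℝ → Eucl m, pathELength 𝓘(ℝ, Eucl m) c 0 1 =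
      ∫⁻ t in Icc (0 : ℝ) 1, ENNReal.ofReal
        (√(g (c t) (derivWithin c (Icc 0 1) t) (derivWithin c (Icc 0 1) t))) := by
    intro c
    rw [pathELength_eq_lintegral_mfderivWithin_Icc]
    simp only [mfderivWithin_eq_fderivWithin]
    rfl
  constructor
  · intro h
    obtain ⟨c, h0, h1, hc, hl⟩ := exists_lt_of_riemannianEDist_lt h
    exact ⟨c, h0, h1, contMDiffOn_iff_contDiffOn.1 hc, by rwa [← key]⟩
  · rintro ⟨c, h0, h1, hc, hl⟩
    rw [← key] at hl
    exact (riemannianEDist_le_pathELength (contMDiffOn_iff_contDiffOn.2 hc) h0 h1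
      zero_le_one).trans_lt hl

theorem riemDist_apply (g : CkMetric k α m) {T : Subgroup (Orth m)} (hg : g.IsInvariant T)
    {A : Orth m} (hA : A ∈ T) (x y : Eucl m) :
    g.riemDist ((A : Eucl m →L[ℝ] Eucl m) x) ((A : Eucl m →L[ℝ] Eucl m) y) = g.riemDist x y := by
  have main : ∀ A ∈ T, ∀ x y : Eucl m,
      g.riemDist ((A : Eucl m →L[ℝ] Eucl m) x) ((A : Eucl m →L[ℝ] Eucl m) y)
        ≤ g.riemDist x y := by
    intro A hA x y
    refine le_of_forall_gt fun r hr => ?_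
    obtain ⟨c, h0, h1, hc, hl⟩ := (g.riemDist_lt_iff x y r).1 hr
    refine (g.riemDist_lt_iff _ _ r).2
      ⟨fun t => (A : Eucl m →L[ℝ] Eucl m) (c t), by simp [h0], by simp [h1], ?_, ?_⟩
    · exact (A : Eucl m →L[ℝ] Eucl m).contDiff.comp_contDiffOn hc
    · refine lt_of_eq_of_lt ?_ hl
      refine setLIntegral_congr_fun measurableSet_Icc fun t ht => ?_
      have hd : HasDerivWithinAt c (derivWithin c (Icc 0 1) t) (Icc 0 1) t :=
        (hc.differentiableOn one_ne_zero t ht).hasDerivWithinAt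
      have hd' : derivWithin (fun t => (A : Eucl m →L[ℝ] Eucl m) (c t)) (Icc 0 1) t =
          (A : Eucl m →L[ℝ] Eucl m) (derivWithin c (Icc 0 1) t) :=
        (((A : Eucl m →L[ℝ] Eucl m).hasFDerivAt).comp_hasDerivWithinAt t hd).derivWithin
          (uniqueDiffOn_Icc zero_lt_one t ht)
      simp only [hd', hg A hA]
  refine le_antisymm (main A hA x y) ?_
  have h := main A⁻¹ (T.inv_mem hA) ((A : Eucl m →L[ℝ] Eucl m) x) ((A : Eucl m →L[ℝ] Eucl m) y)
  rwa [inv_apply_apply, inv_apply_apply] at h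

/-- On a compact set `g` dominates a multiple of the Euclidean metric. -/
theorem exists_lower_bound (g : CkMetric k α m) {K : Set (Eucl m)} (hK : IsCompact K) :
    ∃ a : ℝ, 0 < a ∧ ∀ y ∈ K, ∀ v, a * ‖v‖ ≤ √(g y v v) := by
  have hcont : Continuous fun p : Eucl m × Eucl m => √(g p.1 p.2 p.2) := by
    have h1 : Continuous fun p : Eucl m × Eucl m => g p.1 := g.continuous.comp continuous_fst
    exact ((h1.clm_apply continuous_snd).clm_apply continuous_snd).sqrt
  have hS : IsCompact (K ×ˢ Metric.sphere (0 : Eucl m) 1) := hK.prod (isCompact_sphere 0 1)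
  obtain ⟨a, ha, hb⟩ : ∃ a : ℝ, 0 < a ∧
      ∀ p ∈ K ×ˢ Metric.sphere (0 : Eucl m) 1, a ≤ √(g p.1 p.2 p.2) := by
    rcases (K ×ˢ Metric.sphere (0 : Eucl m) 1).eq_empty_or_nonempty with he | hne
    · exact ⟨1, one_pos, by simp [he]⟩
    · obtain ⟨p, hp, hmin⟩ := hS.exists_isMinOn hne hcont.continuousOn
      refine ⟨_, Real.sqrt_pos.2 (g.pos p.1 p.2 ?_), fun q hq => hmin hq⟩
      intro h0
      have := hp.2
      simp [h0] at this
  refine ⟨a, ha, fun y hy v => ?_⟩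
  rcases eq_or_ne v 0 with rfl | hv
  · simp
  have hn : 0 < ‖v‖ := norm_pos_iff.2 hv
  have h := hb (y, ‖v‖⁻¹ • v) ⟨hy, by simp [norm_smul, hn.ne']⟩
  have h2 : g y (‖v‖⁻¹ • v) (‖v‖⁻¹ • v) = ‖v‖⁻¹ ^ 2 * g y v v := by
    simp only [map_smul, FunLike.coe_smul, Pi.smul_apply, smul_eq_mul]
    ring
  simp only [h2] at h
  rw [Real.sqrt_mul (sq_nonneg _), Real.sqrt_sq (by positivity)] at h
  rwa [inv_mul_eq_div, le_div_iff₀ hn] at h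

/-- Small balls of the Riemannian distance are contained in a given neighbourhood. -/
theorem exists_riemDist_lt_subset (g : CkMetric k α m) (x : Eucl m) {s : Set (Eucl m)}
    (hs : s ∈ 𝓝 x) : ∃ c : ℝ≥0∞, 0 < c ∧ ∀ y, g.riemDist x y < c → y ∈ s := by
  obtain ⟨δ, hδ, hδs⟩ := Metric.nhds_basis_closedBall.mem_iff.1 hs
  obtain ⟨a, ha, hb⟩ := g.exists_lower_bound (isCompact_closedBall x δ)
  refine ⟨ENNReal.ofReal (a * δ), by positivity, fun y hy => hδs ?_⟩
  by_contra hyn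
  obtain ⟨c, h0, h1, hc, hl⟩ := (g.riemDist_lt_iff x y _).1 hy
  have hdist : ContinuousOn (fun t => dist (c t) x) (Icc 0 1) :=
    (continuous_id.dist continuous_const).comp_continuousOn hc.continuousOn
  -- the first time at which the curve reaches the sphere of radius `δ`
  obtain ⟨t₁, ht₁, hmin⟩ : ∃ t ∈ {t ∈ Icc (0 : ℝ) 1 | δ ≤ dist (c t) x},
      ∀ u ∈ {t ∈ Icc (0 : ℝ) 1 | δ ≤ dist (c t) x}, t ≤ u := by
    have hclosed : IsClosed {t ∈ Icc (0 : ℝ) 1 | δ ≤ dist (c t) x} :=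
      hdist.preimage_isClosed_of_isClosed isClosed_Icc isClosed_Ici
    have hcomp : IsCompact {t ∈ Icc (0 : ℝ) 1 | δ ≤ dist (c t) x} :=
      isCompact_Icc.of_isClosed_subset hclosed fun t ht => ht.1
    refine (hcomp.exists_isLeast ⟨1, ⟨by simp, ?_⟩⟩).imp fun t ht => ⟨ht.1, fun u hu => ht.2 hu⟩
    rw [h1]
    rw [Metric.mem_closedBall, not_le] at hyn
    exact hyn.le
  have ht₁0 : 0 < t₁ := by
    rcases ht₁.1.1.eq_or_lt with h | h
    · have := ht₁.2
      rw [← h, h0, dist_self] at this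
      linarith
    · exact h
  have hsub : Icc 0 t₁ ⊆ Icc (0 : ℝ) 1 := Icc_subset_Icc_right ht₁.1.2
  have hlt : ∀ t ∈ Ico 0 t₁, dist (c t) x < δ := by
    intro t ht
    by_contra h
    exact absurd (hmin t ⟨⟨ht.1, ht.2.le.trans ht₁.1.2⟩, not_lt.1 h⟩) (not_le.2 ht.2)
  have hball : ∀ t ∈ Ico 0 t₁, c t ∈ Metric.closedBall x δ := fun t ht => (hlt t ht).le
  refine absurd hl (not_lt.2 ?_)
  calc ENNReal.ofReal (a * δ) = ENNReal.ofReal a * ENNReal.ofReal δ := ENNReal.ofReal_mul ha.le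
    _ ≤ ENNReal.ofReal a * ‖c t₁ - c 0‖ₑ := by
        gcongr
        rw [h0, ← ofReal_norm, ← dist_eq_norm]
        exact ENNReal.ofReal_le_ofReal ht₁.2
    _ ≤ ENNReal.ofReal a * ∫⁻ t in Icc 0 t₁, ‖derivWithin c (Icc 0 t₁) t‖ₑ := by
        gcongr
        exact enorm_sub_le_lintegral_derivWithin_Icc_of_contDiffOn_Icc (hc.mono hsub) ht₁0.le
    _ = ∫⁻ t in Ico 0 t₁, ENNReal.ofReal a * ‖derivWithin c (Icc 0 t₁) t‖ₑ := by
        rw [restrict_Ico_eq_restrict_Icc, lintegral_const_mul' _ _ ENNReal.ofReal_ne_top]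
    _ ≤ ∫⁻ t in Ico 0 t₁, ENNReal.ofReal
        (√(g (c t) (derivWithin c (Icc 0 1) t) (derivWithin c (Icc 0 1) t))) := by
        refine setLIntegral_mono' measurableSet_Ico fun t ht => ?_
        have ht' : t ∈ Icc 0 t₁ := Ico_subset_Icc_self ht
        rw [derivWithin_subset hsub (uniqueDiffOn_Icc ht₁0 t ht')
          (hc.differentiableOn one_ne_zero t (hsub ht')), ← ofReal_norm, ← ENNReal.ofReal_mul ha.le]
        exact ENNReal.ofReal_le_ofReal (hb _ (hball t ht) _)
    _ ≤ _ := lintegral_mono_set (Ico_subset_Icc_self.trans hsub)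

end CkMetric

/-- The orbit space `(ℝ^m, g)/T` of a compact group `T ≤ O(m)` of isometries of `g`. -/
def OrbitSpace {k : ℕ∞} {α : ℝ≥0} {m : ℕ} (g : CkMetric k α m) (T : Subgroup (Orth m))
    (_hT : IsCompact (T : Set (Orth m))) (_hg : g.IsInvariant T) : Type :=
  Quotient (orbitSetoid T)

namespace OrbitSpace

variable {k : ℕ∞} {α : ℝ≥0} {m : ℕ} {g : CkMetric k α m} {T : Subgroup (Orth m)}
  {hT : IsCompact (T : Set (Orth m))} {hg : g.IsInvariant T}

/-- The projection `ℝ^m → (ℝ^m, g)/T`. -/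
def proj (x : Eucl m) : OrbitSpace g T hT hg := Quotient.mk (orbitSetoid T) x

theorem proj_surjective : Function.Surjective (proj : Eucl m → OrbitSpace g T hT hg) :=
  Quotient.mk_surjective

theorem proj_eq_iff {x y : Eucl m} :
    (proj x : OrbitSpace g T hT hg) = proj y ↔ ∃ A ∈ T, (A : Eucl m →L[ℝ] Eucl m) x = y :=
  Quotient.eq (r := orbitSetoid T)

/-- The distance of two orbits: the infimum of the `g`-distances of their points. -/
instance : EDist (OrbitSpace g T hT hg) :=
  ⟨fun p q => ⨅ (x : Eucl m) (_ : proj x = p) (y : Eucl m) (_ : proj y = q), g.riemDist x y⟩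

theorem edist_lt_iff (p q : OrbitSpace g T hT hg) (r : ℝ≥0∞) :
    edist p q < r ↔ ∃ x y : Eucl m, proj x = p ∧ proj y = q ∧ g.riemDist x y < r := by
  change (⨅ (x : Eucl m) (_ : proj x = p) (y : Eucl m) (_ : proj y = q), g.riemDist x y) < r ↔ _
  simp only [iInf_lt_iff, exists_prop]
  constructor
  · rintro ⟨x, hx, y, hy, h⟩
    exact ⟨x, y, hx, hy, h⟩
  · rintro ⟨x, y, hx, hy, h⟩
    exact ⟨x, hx, y, hy, h⟩

/-- The distance from `T x` to an orbit can be measured from the representative `x`. -/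
theorem edist_proj_lt_iff (x : Eucl m) (q : OrbitSpace g T hT hg) (r : ℝ≥0∞) :
    edist (proj x) q < r ↔ ∃ y : Eucl m, proj y = q ∧ g.riemDist x y < r := by
  rw [edist_lt_iff]
  constructor
  · rintro ⟨x', y, hx', rfl, h⟩
    obtain ⟨A, hA, rfl⟩ := proj_eq_iff.1 hx'
    exact ⟨(A : Eucl m →L[ℝ] Eucl m) y, (proj_eq_iff.2 ⟨A, hA, rfl⟩).symm,
      by rwa [g.riemDist_apply hg hA]⟩
  · rintro ⟨y, hy, h⟩
    exact ⟨x, y, rfl, hy, h⟩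

theorem isClosed_orbit (x : Eucl m) : IsClosed {y | (proj y : OrbitSpace g T hT hg) = proj x} := by
  have h : {y | (proj y : OrbitSpace g T hT hg) = proj x} =
      (fun A : Orth m => (A : Eucl m →L[ℝ] Eucl m) x) '' T := by
    ext y
    exact eq_comm.trans proj_eq_iff
  rw [h]
  refine (hT.image ?_).isClosed
  exact continuous_subtype_val.clm_apply continuous_const

/-- The orbit space is a metric space (with possibly infinite distances, a priori). -/
instance : EMetricSpace (OrbitSpace g T hT hg) where
  edist_self p := by
    obtain ⟨x, rfl⟩ := proj_surjective p
    refine le_antisymm (le_of_forall_gt fun r hr => ?_) zero_le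
    exact (edist_proj_lt_iff x _ r).2 ⟨x, rfl, by rwa [g.riemDist_self]⟩
  edist_comm := by
    have main : ∀ p q : OrbitSpace g T hT hg, edist p q ≤ edist q p := by
      intro p q
      refine le_of_forall_gt fun r hr => ?_
      obtain ⟨x, y, hx, hy, h⟩ := (edist_lt_iff q p r).1 hr
      exact (edist_lt_iff p q r).2 ⟨y, x, hy, hx, by rwa [g.riemDist_comm]⟩
    exact fun p q => le_antisymm (main p q) (main q p)
  edist_triangle p q r := by
    obtain ⟨x, rfl⟩ := proj_surjective p
    refine ENNReal.le_of_forall_pos_le_add fun ε hε hfin => ?_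
    obtain ⟨h1, h2⟩ := ENNReal.add_lt_top.1 hfin
    have hε2 : (ε / 2 : ℝ≥0∞) ≠ 0 := by simp [hε.ne']
    obtain ⟨y, rfl, hy⟩ := (edist_proj_lt_iff x q _).1 (ENNReal.lt_add_right h1.ne hε2)
    obtain ⟨z, hz, hyz⟩ := (edist_proj_lt_iff y r _).1 (ENNReal.lt_add_right h2.ne hε2)
    refine ((edist_proj_lt_iff x r _).2 ⟨z, hz, ?_⟩).le
    calc g.riemDist x z ≤ g.riemDist x y + g.riemDist y z := g.riemDist_triangle x y z
      _ < (edist (proj x) (proj y : OrbitSpace g T hT hg) + ε / 2) +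
          (edist (proj y) r + ε / 2) := ENNReal.add_lt_add hy hyz
      _ = edist (proj x) (proj y) + edist (proj y) r + ε := by
          rw [add_add_add_comm, ENNReal.add_halves]
  eq_of_edist_eq_zero {p q} h := by
    obtain ⟨x, rfl⟩ := proj_surjective p
    obtain ⟨y, rfl⟩ := proj_surjective q
    by_contra hne
    obtain ⟨c, hc, hs⟩ := g.exists_riemDist_lt_subset x
      ((isClosed_orbit (g := g) (hT := hT) (hg := hg) y).isOpen_compl.mem_nhds hne)
    obtain ⟨z, hz, hxz⟩ := (edist_proj_lt_iff x (proj y) c).1 (h.trans_lt hc)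
    exact hs z hxz hz

end OrbitSpace

theorem isCompact_of_finite {m : ℕ} (Γ : Subgroup (Orth m)) [Finite Γ] :
    IsCompact (Γ : Set (Orth m)) :=
  (Set.toFinite (Γ : Set (Orth m))).isCompact

/-- A metric space is an `n`-dimensional Riemannian orbifold with a `C^{k,α}` metric, for some `n`,
if every point has a ball that is isometric to an open subset of some `(ℝ^n, h)/Γ`, where
`Γ ≤ O(n)` is a finite group and `h` is a `Γ`-invariant Riemannian metric of class `C^{k,α}`. -/
def IsRiemannianOrbifold (k : ℕ∞) (α : ℝ≥0) (Y : Type*) [EMetricSpace Y] : Prop :=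
  ∃ n : ℕ, ∀ y : Y, ∃ r : ℝ≥0∞, 0 < r ∧
    ∃ (Γ : Subgroup (Orth n)) (_ : Finite Γ) (h : CkMetric k α n) (hΓ : h.IsInvariant Γ)
      (φ : Metric.eball y r → OrbitSpace h Γ (isCompact_of_finite Γ) hΓ),
      Isometry φ ∧ IsOpen (range φ)

/-- `p` is a `C^{k,α}`-orbifold point of the metric space `X` if some ball about `p`, with the
distance of `X`, is a Riemannian orbifold with a `C^{k,α}` metric. -/
def IsOrbifoldPoint (k : ℕ∞) (α : ℝ≥0) {X : Type*} [EMetricSpace X] (p : X) : Prop :=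
  ∃ ε : ℝ≥0∞, 0 < ε ∧ IsRiemannianOrbifold k α (Metric.eball p ε)

open Classical in
/-- Hausdorff dimension, with the convention that the empty set has dimension `-∞`. -/
def hausdorffDim {X : Type*} [EMetricSpace X] (s : Set X) : EReal :=
  if s = ∅ then ⊥ else (dimH s : EReal)

/-- `T ≤ O(m)` is a torus: it is isomorphic, as a topological group, to some `(S^1)^r`, `r ≥ 0`. -/
def IsTorus {m : ℕ} (T : Subgroup (Orth m)) : Prop :=
  ∃ r : ℕ, Nonempty ((Fin r → Circle) ≃ₜ* T)

/-- `G ≤ O(m)` is a finite extension of a torus: it has a normal subgroup of finite index that is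
a torus. -/
def IsFiniteExtensionOfTorus {m : ℕ} (G : Subgroup (Orth m)) : Prop :=
  ∃ T : Subgroup (Orth m), T ≤ G ∧ IsTorus T ∧ (T.subgroupOf G).Normal ∧
    (T.subgroupOf G).FiniteIndex

theorem IsTorus.isCompact {m : ℕ} {T : Subgroup (Orth m)} (hT : IsTorus T) :
    IsCompact (T : Set (Orth m)) := by
  obtain ⟨r, ⟨e⟩⟩ := hT
  have : CompactSpace T := e.toHomeomorph.compactSpace
  exact isCompact_iff_compactSpace.2 this

theorem IsFiniteExtensionOfTorus.isCompact {m : ℕ} {G : Subgroup (Orth m)}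
    (hG : IsFiniteExtensionOfTorus G) : IsCompact (G : Set (Orth m)) := by
  obtain ⟨T, hTG, hT, -, hfin⟩ := hG
  have hcov : (G : Set (Orth m)) = ⋃ q : G ⧸ T.subgroupOf G,
      (fun A : Orth m => (q.out : Orth m) * A) '' T := by
    ext B
    simp only [SetLike.mem_coe, mem_iUnion, mem_image]
    constructor
    · intro hB
      refine ⟨QuotientGroup.mk ⟨B, hB⟩, _, ?_, mul_inv_cancel_left _ B⟩
      have h := QuotientGroup.eq.1
        (QuotientGroup.out_eq' (QuotientGroup.mk (s := T.subgroupOf G) ⟨B, hB⟩))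
      exact Subgroup.mem_subgroupOf.1 h
    · rintro ⟨q, A, hA, rfl⟩
      exact G.mul_mem q.out.2 (hTG hA)
  rw [hcov]
  refine isCompact_iUnion fun q => hT.isCompact.image ?_
  exact Continuous.subtype_mk (continuous_const.mul continuous_subtype_val) _

end TorusQuotient

end

open Set Filter Topology MeasureTheory Manifold
open scoped ENNReal NNReal ContDiff

noncomputable section

set_option linter.unusedSectionVars false

namespace TorusQuotient

/-! ### Maps of class `C^{k,α}` -/

section Regularity

/-! Near an orbit the quotient is governed by the stabilizer algebra `𝔥` of a point `x` in the Lie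
algebra `𝔱` of the group. Since `𝔱` consists of commuting skew operators, `ℝ^m` splits orthogonally
into planes, which `𝔱` rotates with speeds given by weights, and a part killed by `𝔱`. Call `x` good
(`IsGoodPoint`) if `𝔥` is spanned by the single rotations of some of these planes, with orthonormal
bases `a j, b j`.

At a good point the quotient is an orbifold. A plane modulo its circle is a ray, which is also a
line modulo `±1`; so instead of the whole normal space of the orbit one uses the section `S` normal
to the orbit and to all `b j` (`sliceSpace`). Every orbit meets `x + S`, and near `x` two points of
`x + S` on one orbit differ by the finite group induced on `S` by the elements that fix `x` and
preserve `S`. The orbits drop dimension along `S`, but their tangent spaces enlarged by the `b j` do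
not. The metric on `S` gives `v` the `g`-length of the vector of its class modulo this enlarged
space that is `g`-orthogonal to that space; it depends smoothly on the point and the value of `g`,
so it is again of class `C^{k,α}` (`SliceData.exists_sliceForm`). It is the true quotient metric:
where `b j` is not tangent to the orbit, the rotation of its plane fixes the point, and its
invariance makes `b j` `g`-orthogonal to its Euclidean complement, so the extra directions do not
contribute (`SliceData.exists_eq_add_of_orthogonal`). Comparing speeds of curves in both directions
yields a local isometry (`SliceChart.exists_isometry`).

At a bad point, let `K` be the set of planes moved by `𝔥`. The weights of `K` embed `𝔥` into `ℝ^K`,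
and equality of dimensions would produce the single rotations; hence `|K| ≥ dim 𝔥 + 1 ≥ 2`. The
fixed space of `𝔥` has dimension at most `m - 2|K|`, the orbit has dimension `dim 𝔱 - dim 𝔥`, and so
the part of the fixed space normal to the orbit has dimension at most `m - 4` and at most `m - dim 𝔱
- 3` (`finrank_slice_of_not_isGoodPoint`). Only finitely many algebras `𝔥` occur, and every orbit
through a fixed space meets its normal part, so the bad orbits lie in the Lipschitz images of
finitely many such subspaces. Finally `dim X ≥ m - dim 𝔱`, from the chart at a point with trivial
stabilizer algebra (`le_dimH_univ`). -/

/-- Local Hölder continuity of exponent `α`. -/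
def LocHolder {X Y : Type*} [PseudoEMetricSpace X] [PseudoEMetricSpace Y] (α : ℝ≥0) (f : X → Y) :
    Prop := ∀ x, ∃ C : ℝ≥0, ∃ U ∈ 𝓝 x, HolderOnWith C α f U

theorem LocHolder.comp_left {X Y Z : Type*} [PseudoEMetricSpace X] [PseudoEMetricSpace Y]
    [PseudoEMetricSpace Z] {α : ℝ≥0} {f : X → Y} {g : Y → Z} (hf : LocHolder α f)
    (hc : Continuous f) (hg : ∀ x, ∃ C : ℝ≥0, ∃ U ∈ 𝓝 (f x), LipschitzOnWith C g U) :
    LocHolder α (g ∘ f) := by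
  intro x
  obtain ⟨C, U, hU, h⟩ := hf x
  obtain ⟨D, W, hW, h'⟩ := hg x
  refine ⟨D * C ^ (1 : ℝ), U ∩ f ⁻¹' W, inter_mem hU (hc.continuousAt hW), ?_⟩
  have := h'.holderOnWith.comp (h.mono (inter_subset_left (t := f ⁻¹' W))) (fun y hy => hy.2)
  rwa [one_mul] at this

theorem LocHolder.comp_right {X Y Z : Type*} [PseudoEMetricSpace X] [PseudoEMetricSpace Y]
    [PseudoEMetricSpace Z] {α : ℝ≥0} {f : X → Y} {g : Y → Z} (hg : LocHolder α g)
    (hc : Continuous f) (hf : ∀ x, ∃ C : ℝ≥0, ∃ U ∈ 𝓝 x, LipschitzOnWith C f U) :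
    LocHolder α (g ∘ f) := by
  intro x
  obtain ⟨C, U, hU, h⟩ := hg (f x)
  obtain ⟨D, W, hW, h'⟩ := hf x
  refine ⟨C * D ^ (α : ℝ), W ∩ f ⁻¹' U, inter_mem hW (hc.continuousAt hU), ?_⟩
  have := h.comp (h'.mono (inter_subset_left (t := f ⁻¹' U))).holderOnWith (fun y hy => hy.2)
  rwa [mul_one] at this

theorem LocHolder.prodMk {X Y Z : Type*} [PseudoEMetricSpace X] [PseudoEMetricSpace Y]
    [PseudoEMetricSpace Z] {α : ℝ≥0} {f : X → Y} {g : X → Z} (hf : LocHolder α f)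
    (hg : LocHolder α g) : LocHolder α (fun x => (f x, g x)) := by
  intro x
  obtain ⟨C, U, hU, h⟩ := hf x
  obtain ⟨D, W, hW, h'⟩ := hg x
  refine ⟨max C D, U ∩ W, inter_mem hU hW, fun y hy z hz => ?_⟩
  rw [Prod.edist_eq]
  refine max_le ((h y hy.1 z hz.1).trans ?_) ((h' y hy.2 z hz.2).trans ?_)
  · gcongr; exact_mod_cast le_max_left C D
  · gcongr; exact_mod_cast le_max_right C D

theorem locHolder_of_contDiff {F G : Type*} [NormedAddCommGroup F] [NormedSpace ℝ F]
    [NormedAddCommGroup G] [NormedSpace ℝ G] {α : ℝ≥0} (hα : α ≤ 1) {f : F → G}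
    (hf : ContDiff ℝ 1 f) : LocHolder α f := by
  intro x
  obtain ⟨K, U, hU, h⟩ := hf.contDiffAt.exists_lipschitzOnWith (x := x)
  -- Lowering the exponent from `1` to `α` needs a bounded set; a unit ball has diameter at most
  -- `2`.
  refine ⟨_, U ∩ Metric.ball x 1, inter_mem hU (Metric.ball_mem_nhds x one_pos),
    HolderOnWith.of_le (D := 2) (r := 1) ?_ (h.mono inter_subset_left).holderOnWith hα⟩
  intro y hy z hz
  rw [edist_dist]
  have h1 : dist y z ≤ dist y x + dist z x := dist_triangle_right _ _ _
  have h2 := Metric.mem_ball.1 hy.2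
  have h3 := Metric.mem_ball.1 hz.2
  refine ENNReal.ofReal_le_of_le_toReal ?_
  simp
  linarith

variable {F G G' : Type} [NormedAddCommGroup F] [NormedSpace ℝ F]
  [NormedAddCommGroup G] [NormedSpace ℝ G] [NormedAddCommGroup G']
  [NormedSpace ℝ G'] {α : ℝ≥0}

theorem isCkHolder_top_iff {f : F → G} : IsCkHolder ⊤ α f ↔ ContDiff ℝ ∞ f :=
  ⟨fun h => h.1, fun h => ⟨h, fun j hj => absurd hj (ENat.natCast_ne_top j)⟩⟩

theorem isCkHolder_nat_iff {f : F → G} {n : ℕ} :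
    IsCkHolder n α f ↔ ContDiff ℝ n f ∧ LocHolder α (iteratedFDeriv ℝ n f) := by
  constructor
  · exact fun h => ⟨h.1, h.2 n rfl⟩
  · refine fun h => ⟨h.1, fun j hj => ?_⟩
    obtain rfl : j = n := by exact_mod_cast hj
    exact h.2

theorem isCkHolder_zero_iff {f : F → G} :
    IsCkHolder 0 α f ↔ Continuous f ∧ LocHolder α f := by
  have := isCkHolder_nat_iff (f := f) (n := 0) (α := α)
  rw [Nat.cast_zero] at this
  rw [this, Nat.cast_zero, contDiff_zero]
  refine and_congr_right fun hc => ?_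
  rw [iteratedFDeriv_zero_eq_comp]
  constructor
  · intro h
    have := h.comp_left ((LinearIsometryEquiv.continuous _).comp hc)
      (g := (continuousMultilinearCurryFin0 ℝ F G))
      (fun x => ⟨1, univ, univ_mem, (LinearIsometryEquiv.lipschitz _).lipschitzOnWith⟩)
    convert this using 1
    ext x
    simp
  · intro h
    exact h.comp_left hc
      (fun x => ⟨1, univ, univ_mem, (LinearIsometryEquiv.lipschitz _).lipschitzOnWith⟩)

/-- Currying is an isometry between the top derivative of `f` and that of `fderiv ℝ f`. This makes
the class accessible to induction on the order. -/
theorem isCkHolder_succ_iff {f : F → G} {n : ℕ} :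
    IsCkHolder (n + 1 : ℕ) α f ↔ Differentiable ℝ f ∧ IsCkHolder n α (fderiv ℝ f) := by
  rw [isCkHolder_nat_iff, isCkHolder_nat_iff]
  have h1 : ContDiff ℝ (n + 1 : ℕ) f ↔ Differentiable ℝ f ∧ ContDiff ℝ n (fderiv ℝ f) := by
    have := contDiff_succ_iff_fderiv (𝕜 := ℝ) (f := f) (n := n)
    push_cast
    rw [this]
    simp
  rw [h1, and_assoc]
  refine and_congr_right fun hd => and_congr_right fun hc => ?_
  have h2 : iteratedFDeriv ℝ (n + 1) f =
      (continuousMultilinearCurryRightEquiv' ℝ n F G).symm ∘ iteratedFDeriv ℝ n (fderiv ℝ f) := by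
    ext1 x
    exact iteratedFDeriv_succ_eq_comp_right
  have hc' : Continuous (iteratedFDeriv ℝ n (fderiv ℝ f)) := hc.continuous_iteratedFDeriv le_rfl
  rw [h2]
  constructor
  · intro h
    have := h.comp_left ((LinearIsometryEquiv.continuous _).comp hc')
      (g := (continuousMultilinearCurryRightEquiv' ℝ n F G))
      (fun x => ⟨1, univ, univ_mem, (LinearIsometryEquiv.lipschitz _).lipschitzOnWith⟩)
    convert this using 1
    ext x
    simp
  · intro h
    exact h.comp_left hc'
      (fun x => ⟨1, univ, univ_mem, (LinearIsometryEquiv.lipschitz _).lipschitzOnWith⟩)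

theorem IsCkHolder.of_succ (hα : α ≤ 1) {f : F → G} {n : ℕ} (h : IsCkHolder (n + 1 : ℕ) α f) :
    IsCkHolder n α f := by
  rw [isCkHolder_nat_iff] at h ⊢
  refine ⟨h.1.of_le (by exact_mod_cast n.le_succ), locHolder_of_contDiff hα ?_⟩
  exact h.1.iteratedFDeriv_right (by push_cast; rw [add_comm])

theorem isCkHolder_of_contDiff (hα : α ≤ 1) {f : F → G} (hf : ContDiff ℝ ∞ f) (k : ℕ∞) :
    IsCkHolder k α f := by
  refine ⟨hf.of_le (by exact_mod_cast le_top), fun j _ => ?_⟩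
  exact locHolder_of_contDiff hα (hf.iteratedFDeriv_right (by exact_mod_cast le_top))

theorem IsCkHolder.prodMk_nat {n : ℕ} {f : F → G} {g : F → G'} (hf : IsCkHolder n α f)
    (hg : IsCkHolder n α g) : IsCkHolder n α (fun x => (f x, g x)) := by
  rw [isCkHolder_nat_iff] at hf hg ⊢
  refine ⟨hf.1.prodMk hg.1, ?_⟩
  have : iteratedFDeriv ℝ n (fun x => (f x, g x)) =
      (fun p : (F [×n]→L[ℝ] G) × (F [×n]→L[ℝ] G') => p.1.prod p.2) ∘
        fun x => (iteratedFDeriv ℝ n f x, iteratedFDeriv ℝ n g x) := by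
    ext1 x
    exact iteratedFDeriv_prodMk (hf.1.contDiffAt (x := x)) hg.1.contDiffAt le_rfl
  rw [this]
  refine (hf.2.prodMk hg.2).comp_left ((hf.1.continuous_iteratedFDeriv le_rfl).prodMk
    (hg.1.continuous_iteratedFDeriv le_rfl)) fun x => ⟨1, univ, univ_mem, ?_⟩
  have : Isometry fun p : (F [×n]→L[ℝ] G) × (F [×n]→L[ℝ] G') => p.1.prod p.2 :=
    (ContinuousMultilinearMap.prodL ℝ (fun _ : Fin n => F) G G').isometry
  exact this.lipschitz.lipschitzOnWith

/-- By the chain rule the derivative of `Φ ∘ f` is a smooth function of the pair `(f, fderiv ℝ f)`,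
which is of one class less. The target spaces change in the induction, so they are quantified inside
the statement. -/
theorem IsCkHolder.comp_nat (hα : α ≤ 1) (n : ℕ) : ∀ {G G' : Type} [NormedAddCommGroup G]
    [NormedSpace ℝ G] [NormedAddCommGroup G'] [NormedSpace ℝ G'] {f : F → G} {Φ : G → G'}
    {Ω : Set G}, IsOpen Ω → ContDiffOn ℝ ∞ Φ Ω → (∀ x, f x ∈ Ω) → IsCkHolder n α f →
      IsCkHolder n α (Φ ∘ f) := by
  induction n with
  | zero =>
    intro G G' _ _ _ _ f Φ Ω hΩ hΦ hf h
    rw [Nat.cast_zero, isCkHolder_zero_iff] at h ⊢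
    have hat : ∀ x, ContDiffAt ℝ ∞ Φ (f x) := fun x => hΦ.contDiffAt (hΩ.mem_nhds (hf x))
    refine ⟨continuous_iff_continuousAt.2 fun x => (hat x).continuousAt.comp h.1.continuousAt,
      h.2.comp_left h.1 fun x => ?_⟩
    exact ((hat x).of_le (by exact_mod_cast le_top)).exists_lipschitzOnWith
  | succ n ih =>
    intro G G' _ _ _ _ f Φ Ω hΩ hΦ hf h
    have h0 := h.of_succ hα
    rw [isCkHolder_succ_iff] at h ⊢
    have hd : ∀ y ∈ Ω, DifferentiableAt ℝ Φ y := fun y hy =>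
      (hΦ.contDiffAt (hΩ.mem_nhds hy)).differentiableAt (by simp)
    refine ⟨fun x => (hd _ (hf x)).comp x (h.1 x), ?_⟩
    have heq : fderiv ℝ (Φ ∘ f) =
        (fun p : G × (F →L[ℝ] G) => (fderiv ℝ Φ p.1).comp p.2) ∘ fun x => (f x, fderiv ℝ f x) := by
      ext1 x
      exact fderiv_comp x (hd _ (hf x)) (h.1 x)
    rw [heq]
    refine ih (Ω := Ω ×ˢ univ) (hΩ.prod isOpen_univ) ?_ (fun x => ⟨hf x, mem_univ _⟩)
      (h0.prodMk_nat h.2)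
    refine ContDiffOn.clm_comp ?_ contDiff_snd.contDiffOn
    exact (hΦ.fderiv_of_isOpen hΩ (by simp)).comp contDiff_fst.contDiffOn fun p hp => hp.1

theorem IsCkHolder.comp (hα : α ≤ 1) {k : ℕ∞} {f : F → G} {Φ : G → G'}
    {Ω : Set G} (hΩ : IsOpen Ω) (hΦ : ContDiffOn ℝ ∞ Φ Ω) (hf : ∀ x, f x ∈ Ω)
    (h : IsCkHolder k α f) : IsCkHolder k α (Φ ∘ f) := by
  induction k using ENat.recTopCoe with
  | top =>
    rw [isCkHolder_top_iff] at h ⊢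
    exact contDiffOn_univ.1 (hΦ.comp h.contDiffOn fun x _ => hf x)
  | coe n => exact IsCkHolder.comp_nat hα n hΩ hΦ hf h

theorem IsCkHolder.prodMk {k : ℕ∞} {f : F → G} {g : F → G'} (hf : IsCkHolder k α f)
    (hg : IsCkHolder k α g) : IsCkHolder k α (fun x => (f x, g x)) := by
  induction k using ENat.recTopCoe with
  | top =>
    rw [isCkHolder_top_iff] at hf hg ⊢
    exact hf.prodMk hg
  | coe n => exact hf.prodMk_nat hg

theorem IsCkHolder.comp_contDiff (hα : α ≤ 1) {k : ℕ∞} {g : G → G'} {θ : F → G}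
    (hg : IsCkHolder k α g) (hθ : ContDiff ℝ ∞ θ) : IsCkHolder k α (g ∘ θ) := by
  induction k using ENat.recTopCoe with
  | top =>
    rw [isCkHolder_top_iff] at hg ⊢
    exact hg.comp hθ
  | coe n =>
    induction n generalizing G' with
    | zero =>
      rw [Nat.cast_zero, isCkHolder_zero_iff] at hg ⊢
      exact ⟨hg.1.comp hθ.continuous, hg.2.comp_right hθ.continuous fun x =>
        ((hθ.of_le (by exact_mod_cast le_top)).contDiffAt).exists_lipschitzOnWith⟩
    | succ n ih =>
      rw [isCkHolder_succ_iff] at hg ⊢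
      refine ⟨hg.1.comp (hθ.differentiable (by simp)), ?_⟩
      have heq : fderiv ℝ (g ∘ θ) =
          (fun p : (G →L[ℝ] G') × (F →L[ℝ] G) => p.1.comp p.2) ∘
            fun x => ((fderiv ℝ g ∘ θ) x, fderiv ℝ θ x) := by
        ext1 x
        exact fderiv_comp x (hg.1 _) (hθ.differentiable (by simp) x)
      rw [heq]
      refine IsCkHolder.comp hα isOpen_univ
        (ContDiff.clm_comp contDiff_fst contDiff_snd).contDiffOn (fun _ => mem_univ _) ?_
      exact (ih hg.2).prodMk (isCkHolder_of_contDiff hα (hθ.fderiv_right (by simp)) n)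

end Regularity

/-! ### The exponential in a Banach algebra and one-parameter groups -/

section Exponential

variable {R : Type*} [NormedRing R] [NormedAlgebra ℝ R] [CompleteSpace R]

theorem exp_add_smul (ξ : R) (s t : ℝ) :
    NormedSpace.exp ((s + t) • ξ) = NormedSpace.exp (s • ξ) * NormedSpace.exp (t • ξ) := by
  let := NormedAlgebra.restrictScalars ℚ ℝ R
  rw [add_smul]
  exact NormedSpace.exp_add_of_commute (((Commute.refl ξ).smul_left s).smul_right t)

theorem exp_neg_smul_mul_exp_smul (ξ : R) (t : ℝ) :
    NormedSpace.exp (-t • ξ) * NormedSpace.exp (t • ξ) = 1 := by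
  rw [← exp_add_smul, neg_add_cancel, zero_smul, NormedSpace.exp_zero]

/-- Averaging shows that a continuous one-parameter group is differentiable: `c t * ∫₀^h c =
∫_t^{t+h} c`, and for small `h` the integral on the left is invertible. Then `c' = c * ξ`, and `c t
* exp (-t ξ)` is constant. -/
theorem exists_eq_exp_smul {c : ℝ → R} (hc : Continuous c) (h0 : c 0 = 1)
    (hadd : ∀ s t, c (s + t) = c s * c t) : ∃ ξ : R, ∀ t : ℝ, c t = NormedSpace.exp (t • ξ) := by
  set F : ℝ → R := fun t => ∫ s in (0 : ℝ)..t, c s with hF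
  have hFd : ∀ t, HasDerivAt F (c t) t := fun t => hc.integral_hasStrictDerivAt 0 t |>.hasDerivAt
  obtain ⟨h, hpos, hunit⟩ : ∃ h : ℝ, 0 < h ∧ IsUnit (F h) := by
    have h1 : Tendsto (slope F 0) (𝓝[≠] 0) (𝓝 1) := by
      have := (hFd 0).tendsto_slope
      rwa [h0] at this
    have h2 : ∀ᶠ t in 𝓝[>] (0 : ℝ), IsUnit (slope F 0 t) :=
      (h1.mono_left (nhdsWithin_mono _ fun t (ht : 0 < t) => ht.ne')).eventually
        (Units.isOpen.mem_nhds isUnit_one)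
    obtain ⟨t, ht, ht0⟩ := (h2.and self_mem_nhdsWithin).exists
    refine ⟨t, ht0, ?_⟩
    have h3 : F t = algebraMap ℝ R t * slope F 0 t := by
      rw [slope_def_module]
      simp only [hF, intervalIntegral.integral_same, sub_zero]
      rw [← Algebra.smul_def, smul_smul, mul_inv_cancel₀ (ne_of_gt ht0), one_smul]
    rw [h3]
    exact ((IsUnit.mk0 t (ne_of_gt ht0)).map (algebraMap ℝ R)).mul ht
  obtain ⟨u, hu⟩ := hunit
  have hshift : ∀ t, c t * F h = F (t + h) - F t := by
    intro t
    simp only [hF]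
    rw [intervalIntegral.integral_interval_sub_left (hc.intervalIntegrable _ _)
      (hc.intervalIntegrable _ _)]
    have h5 : ∫ s in t..(t + h), c s = ∫ s in (0 : ℝ)..h, c (t + s) := by
      rw [intervalIntegral.integral_comp_add_left]
      simp
    rw [h5]
    simp only [hadd]
    exact (((ContinuousLinearMap.mul ℝ R (c t)).intervalIntegral_comp_comm
      (hc.intervalIntegrable 0 h))).symm
  have hc' : ∀ t, c t = (F (t + h) - F t) * (↑u⁻¹ : R) := by
    intro t
    rw [← hshift, ← hu, mul_assoc, Units.mul_inv, mul_one]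
  set ξ : R := (c h - 1) * (↑u⁻¹ : R) with hξ
  have hcd : ∀ t, HasDerivAt c (c t * ξ) t := by
    intro t
    have h6 : HasDerivAt (fun t => (F (t + h) - F t) * (↑u⁻¹ : R)) ((c (t + h) - c t) * ↑u⁻¹) t :=
      (((hFd (t + h)).comp_add_const t h).sub (hFd t)).mul_const _
    rw [show c = fun t => (F (t + h) - F t) * (↑u⁻¹ : R) from funext hc']
    convert h6 using 1
    simp only [← hc']
    rw [hξ, hadd, ← mul_assoc, mul_sub, mul_one]
  refine ⟨ξ, fun t => ?_⟩
  have hconst : ∀ t, c t * NormedSpace.exp (-t • ξ) = 1 := by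
    have hd : ∀ t, HasDerivAt (fun t => c t * NormedSpace.exp (-t • ξ)) 0 t := by
      intro t
      have h7 : HasDerivAt (fun t : ℝ => NormedSpace.exp (-t • ξ))
          (-(ξ * NormedSpace.exp (-t • ξ))) t := by
        have := (hasDerivAt_exp_smul_const' (𝕂 := ℝ) ξ (-t)).scomp t (hasDerivAt_neg t)
        simpa [Function.comp_def] using this
      have h8 := (hcd t).mul h7
      have h9 : c t * ξ * NormedSpace.exp (-t • ξ) + c t * -(ξ * NormedSpace.exp (-t • ξ)) = 0 := by
        rw [mul_neg, mul_assoc, add_neg_cancel]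
      rwa [h9] at h8
    intro t
    have := is_const_of_deriv_eq_zero (fun t => (hd t).differentiableAt) (fun t => (hd t).deriv) t 0
    simpa [h0, NormedSpace.exp_zero] using this
  calc c t = c t * (NormedSpace.exp (-t • ξ) * NormedSpace.exp (t • ξ)) := by
        rw [exp_neg_smul_mul_exp_smul, mul_one]
    _ = NormedSpace.exp (t • ξ) := by rw [← mul_assoc, hconst, one_mul]

theorem exp_smul_injective {ξ η : R}
    (h : ∀ t : ℝ, NormedSpace.exp (t • ξ) = NormedSpace.exp (t • η)) : ξ = η := by
  have h1 := hasDerivAt_exp_smul_const (𝕂 := ℝ) ξ 0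
  have h2 := hasDerivAt_exp_smul_const (𝕂 := ℝ) η 0
  rw [show (fun t : ℝ => NormedSpace.exp (t • ξ)) = fun t => NormedSpace.exp (t • η) from
    funext h] at h1
  simpa [NormedSpace.exp_zero] using h1.unique h2

theorem commute_of_commute_exp_smul {ξ η : R}
    (h : ∀ t : ℝ, Commute (NormedSpace.exp (t • ξ)) η) : Commute ξ η := by
  have h1 := (hasDerivAt_exp_smul_const (𝕂 := ℝ) ξ 0).mul_const η
  have h2 := (hasDerivAt_exp_smul_const (𝕂 := ℝ) ξ 0).const_mul η
  rw [show (fun t : ℝ => NormedSpace.exp (t • ξ) * η) = fun t => η * NormedSpace.exp (t • ξ) from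
    funext h] at h1
  have := h1.unique h2
  simp only [zero_smul, NormedSpace.exp_zero, one_mul] at this
  exact this

theorem exists_exp_injOn : ∃ η : ℝ, 0 < η ∧ InjOn (NormedSpace.exp : R → R) (Metric.ball 0 η) := by
  have h := hasStrictFDerivAt_exp_zero (𝕂 := ℝ) (𝔸 := R)
  have h' : HasStrictFDerivAt (NormedSpace.exp : R → R)
    ((ContinuousLinearEquiv.refl ℝ R : R ≃L[ℝ] R) : R →L[ℝ] R) 0 := h
  have := h'.mem_toOpenPartialHomeomorph_source
  obtain ⟨η, hη, hs⟩ := Metric.isOpen_iff.1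
    (h'.toOpenPartialHomeomorph NormedSpace.exp).open_source 0 this
  refine ⟨η, hη, fun x hx y hy hxy => ?_⟩
  exact (h'.toOpenPartialHomeomorph NormedSpace.exp).injOn (hs hx) (hs hy) hxy

end Exponential

/-! ### Orthogonal operators and the Lie algebra of a finite extension of a torus -/

variable {V : Type*} [NormedAddCommGroup V] [InnerProductSpace ℝ V] [CompleteSpace V]

/-- The exponential of an operator of `V`. -/
def expE (ξ : V →L[ℝ] V) : V →L[ℝ] V := NormedSpace.exp (𝔸 := V →L[ℝ] V) ξ

theorem expE_zero : expE (0 : V →L[ℝ] V) = 1 := NormedSpace.exp_zero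

theorem expE_add {ξ η : V →L[ℝ] V} (h : Commute ξ η) : expE (ξ + η) = expE ξ * expE η := by
  let : NormedAlgebra ℚ (V →L[ℝ] V) := NormedAlgebra.restrictScalars ℚ ℝ (V →L[ℝ] V)
  exact NormedSpace.exp_add_of_commute (𝔸 := V →L[ℝ] V) h

theorem commute_smul_smul {ξ η : V →L[ℝ] V} (h : Commute ξ η) (s t : ℝ) :
    Commute (s • ξ) (t • η) := by
  exact (h.smul_left s).smul_right t

theorem hasDerivAt_expE_smul (ξ : V →L[ℝ] V) (t : ℝ) :
    HasDerivAt (fun s : ℝ => expE (s • ξ)) (expE (t • ξ) * ξ) t :=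
  hasDerivAt_exp_smul_const (𝕂 := ℝ) (𝔸 := V →L[ℝ] V) ξ t

theorem hasDerivAt_expE_smul_apply (ξ : V →L[ℝ] V) (t : ℝ) (y : V) :
    HasDerivAt (fun s : ℝ => expE (s • ξ) y) (expE (t • ξ) (ξ y)) t := by
  have := (hasDerivAt_expE_smul ξ t).clm_apply (hasDerivAt_const t y)
  simpa using this

theorem hasDerivAt_expE_smul_apply_zero (ξ : V →L[ℝ] V) (y : V) :
    HasDerivAt (fun s : ℝ => expE (s • ξ) y) (ξ y) 0 := by
  have := hasDerivAt_expE_smul_apply ξ 0 y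
  rwa [zero_smul, expE_zero] at this

theorem continuousAt_expE_zero : ContinuousAt (fun ξ : V →L[ℝ] V => expE ξ) 0 :=
  (hasStrictFDerivAt_exp_zero (𝕂 := ℝ) (𝔸 := V →L[ℝ] V)).continuousAt

instance : IsTopologicalGroup (unitary (V →L[ℝ] V)) where
  continuous_inv := by
    refine Continuous.subtype_mk ?_ _
    exact (LinearIsometryEquiv.continuous (ContinuousLinearMap.adjoint (𝕜 := ℝ) (E := V) (F := V))).comp
      continuous_subtype_val

/-- The derivative of `exp (t ξ) y - t ξ y` is `(exp (t ξ) - 1) (ξ y)`. The error is thus small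
relative to `‖ξ y‖` and not only to `‖ξ‖ ‖y‖`; this is what allows one to conclude `ξ y = 0` when
`exp ξ` fixes `y`. -/
theorem exists_norm_exp_apply_sub_le {ε : ℝ} (hε : 0 < ε) : ∃ η : ℝ, 0 < η ∧
    ∀ ξ : V →L[ℝ] V, ‖ξ‖ < η → ‖expE ξ - 1‖ ≤ ε ∧
      ∀ y, ‖expE ξ y - y - ξ y‖ ≤ ε * ‖ξ y‖ := by
  obtain ⟨η, hη, hb⟩ := Metric.continuousAt_iff.1 (continuousAt_expE_zero (V := V)) ε hε
  refine ⟨η, hη, fun ξ hξ => ?_⟩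
  have hb' : ∀ t ∈ Icc (0 : ℝ) 1, ‖expE (t • ξ) - 1‖ ≤ ε := by
    intro t ht
    have : dist (t • ξ) 0 < η := by
      rw [dist_zero_right, norm_smul, Real.norm_eq_abs, abs_of_nonneg ht.1]
      exact (mul_le_of_le_one_left (norm_nonneg _) ht.2).trans_lt hξ
    have := hb this
    rw [expE_zero, dist_eq_norm] at this
    exact this.le
  refine ⟨by simpa using hb' 1 (by simp), fun y => ?_⟩
  have hd : ∀ t : ℝ, HasDerivAt (fun t : ℝ => expE (t • ξ) y - t • ξ y)
      (expE (t • ξ) (ξ y) - ξ y) t := by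
    intro t
    have h2 := (hasDerivAt_id t).smul_const (ξ y)
    rw [one_smul] at h2
    exact (hasDerivAt_expE_smul_apply ξ t y).sub h2
  have := norm_image_sub_le_of_norm_deriv_le_segment_01' (C := ε * ‖ξ y‖)
    (fun t _ => (hd t).hasDerivWithinAt) (fun t ht => ?_)
  · simp only [one_smul, zero_smul, expE_zero, sub_zero] at this
    rw [show expE ξ y - y - ξ y = expE ξ y - ξ y - (1 : V →L[ℝ] V) y by
      rw [one_apply_eq_self]; abel]
    exact this
  · have h3 : expE (t • ξ) (ξ y) - ξ y = (expE (t • ξ) - 1) (ξ y) := by simp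
    rw [h3]
    exact (ContinuousLinearMap.le_opNorm _ _).trans
      (mul_le_mul_of_nonneg_right (hb' t (Ico_subset_Icc_self ht)) (norm_nonneg _))

theorem inner_unitary_apply (A : unitary (V →L[ℝ] V)) (v w : V) :
    inner ℝ ((A : V →L[ℝ] V) v) ((A : V →L[ℝ] V) w) = inner ℝ v w := by
  have h : star (A : V →L[ℝ] V) * (A : V →L[ℝ] V) = 1 := Unitary.coe_star_mul_self A
  rw [← ContinuousLinearMap.adjoint_inner_right, ← ContinuousLinearMap.star_eq_adjoint]
  change inner ℝ v ((star (A : V →L[ℝ] V) * (A : V →L[ℝ] V)) w) = _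
  rw [h]
  rfl

theorem norm_unitary_apply (A : unitary (V →L[ℝ] V)) (v : V) : ‖(A : V →L[ℝ] V) v‖ = ‖v‖ := by
  have := inner_unitary_apply A v v
  rw [real_inner_self_eq_norm_sq, real_inner_self_eq_norm_sq] at this
  exact (pow_left_inj₀ (norm_nonneg _) (norm_nonneg _) two_ne_zero).1 this

theorem unitary_inv_apply_apply (A : unitary (V →L[ℝ] V)) (x : V) :
    ((A⁻¹ : unitary (V →L[ℝ] V)) : V →L[ℝ] V) ((A : V →L[ℝ] V) x) = x := by
  have h : (((A⁻¹ * A : unitary (V →L[ℝ] V))) : V →L[ℝ] V) x = x := by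
    rw [inv_mul_cancel]; rfl
  exact h

theorem unitary_apply_inv_apply (A : unitary (V →L[ℝ] V)) (x : V) :
    (A : V →L[ℝ] V) (((A⁻¹ : unitary (V →L[ℝ] V)) : V →L[ℝ] V) x) = x := by
  have := unitary_inv_apply_apply A⁻¹ x
  rwa [inv_inv] at this

theorem skew_of_exp_unitary {ξ : V →L[ℝ] V}
    (h : ∀ t : ℝ, ∃ A : unitary (V →L[ℝ] V), (A : V →L[ℝ] V) = expE (t • ξ)) (v w : V) :
    inner ℝ (ξ v) w = - inner ℝ v (ξ w) := by
  have h1 : ∀ v, HasDerivAt (fun t : ℝ => expE (t • ξ) v) (ξ v) 0 :=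
    hasDerivAt_expE_smul_apply_zero ξ
  have h2 := (h1 v).inner ℝ (h1 w)
  have h3 : (fun t : ℝ => inner ℝ (expE (t • ξ) v) (expE (t • ξ) w)) =
      fun _ => inner ℝ v w := by
    funext t
    obtain ⟨A, hA⟩ := h t
    rw [← hA, inner_unitary_apply]
  rw [h3] at h2
  have := h2.unique (hasDerivAt_const _ _)
  rw [zero_smul, expE_zero, one_apply_eq_self, one_apply_eq_self] at this
  linarith

/-- `𝔱` is an abelian Lie algebra of `G ≤ O(V)`: it consists of commuting skew operators whose
exponentials lie in `G`, and exhaust a neighbourhood of `1` in `G`. -/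
structure IsAbelianLieAlgebra (G : Subgroup (unitary (V →L[ℝ] V))) (𝔱 : Submodule ℝ (V →L[ℝ] V)) : Prop where
  comm : ∀ ξ ∈ 𝔱, ∀ η ∈ 𝔱, ξ * η = η * ξ
  skew : ∀ ξ ∈ 𝔱, ∀ v w : V, inner ℝ (ξ v) w = - inner ℝ v (ξ w)
  exp_mem : ∀ ξ ∈ 𝔱, ∃ A ∈ G, (A : V →L[ℝ] V) = expE ξ
  near_one : ∀ η : ℝ, 0 < η → ∀ᶠ A : unitary (V →L[ℝ] V) in 𝓝[(G : Set (unitary (V →L[ℝ] V)))] 1,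
    ∃ ξ ∈ 𝔱, ‖ξ‖ < η ∧ ((A : unitary (V →L[ℝ] V)) : V →L[ℝ] V) = expE ξ

/-- Each line of the universal cover `ℝ^r` gives a one-parameter group of operators. Generators are
unique and commute, so they depend linearly on the line; `𝔱` is the image of this linear map. It
exhausts a neighbourhood of `1` because the covering `ℝ^r → (S^1)^r` is open. -/
theorem exists_abelianLieAlgebra_of_torus {T : Subgroup (unitary (V →L[ℝ] V))} {r : ℕ}
    (e : (Fin r → Circle) ≃ₜ* T) :
    ∃ 𝔱 : Submodule ℝ (V →L[ℝ] V), IsAbelianLieAlgebra T 𝔱 := by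
  set E : (Fin r → ℝ) → (Fin r → Circle) := Pi.map fun _ => Circle.exp with hE
  have hEc : Continuous E := by
    rw [hE]
    exact continuous_pi fun i => Circle.exp.continuous.comp (continuous_apply i)
  have hEadd : ∀ a b, E (a + b) = E a * E b := fun a b => by
    ext i; simp [hE, Circle.exp_add]
  have hE0 : E 0 = 1 := by ext i; simp [hE]
  set ρ : (Fin r → ℝ) → unitary (V →L[ℝ] V) := fun a => (e (E a) : unitary (V →L[ℝ] V)) with hρ
  have hρT : ∀ a, ρ a ∈ T := fun a => (e (E a)).2
  have hρc : Continuous ρ := continuous_subtype_val.comp (e.continuous.comp hEc)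
  have hρadd : ∀ a b, ρ (a + b) = ρ a * ρ b := fun a b => by
    simp only [hρ]
    rw [hEadd, map_mul e]
    rfl
  have hρ0 : ρ 0 = 1 := by
    simp only [hρ]
    rw [hE0, map_one e]
    rfl
  have hex : ∀ a, ∃ ξ : V →L[ℝ] V, ∀ t : ℝ, (ρ (t • a) : V →L[ℝ] V) = expE (t • ξ) := by
    intro a
    refine exists_eq_exp_smul (R := V →L[ℝ] V) (c := fun t : ℝ => (ρ (t • a) : V →L[ℝ] V)) ?_ ?_ ?_
    · exact continuous_subtype_val.comp (hρc.comp (continuous_id.smul continuous_const))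
    · simp [hρ0]
    · intro s t
      rw [add_smul, hρadd]
      rfl
  choose Λ hΛ using hex
  have hcomm' : ∀ a b, Commute (ρ a : V →L[ℝ] V) (ρ b : V →L[ℝ] V) := by
    intro a b
    have : ρ a * ρ b = ρ b * ρ a := by rw [← hρadd, ← hρadd, add_comm]
    exact congrArg Subtype.val this
  have hcomm : ∀ a b, Commute (Λ a) (Λ b) := by
    intro a b
    refine commute_of_commute_exp_smul (R := V →L[ℝ] V) fun t => ?_
    refine (commute_of_commute_exp_smul (R := V →L[ℝ] V) fun s => ?_).symm
    have h1 := hcomm' (s • b) (t • a)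
    rw [hΛ, hΛ] at h1
    exact h1
  have hadd : ∀ a b, Λ (a + b) = Λ a + Λ b := by
    intro a b
    refine exp_smul_injective (R := V →L[ℝ] V) fun t => ?_
    change expE _ = expE _
    rw [← hΛ, smul_add, smul_add, hρadd, expE_add (commute_smul_smul (hcomm a b) t t), ← hΛ, ← hΛ]
    rfl
  have hsmul : ∀ (c : ℝ) a, Λ (c • a) = c • Λ a := by
    intro c a
    refine exp_smul_injective (R := V →L[ℝ] V) fun t => ?_
    change expE _ = expE _
    rw [← hΛ, smul_smul, smul_smul, hΛ]
  let L : (Fin r → ℝ) →ₗ[ℝ] V →L[ℝ] V := ⟨⟨Λ, hadd⟩, hsmul⟩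
  have hL : ∀ a, (ρ a : V →L[ℝ] V) = expE (L a) := fun a => by
    have := hΛ a 1
    rwa [one_smul, one_smul] at this
  refine ⟨LinearMap.range L, ⟨?_, ?_, ?_, ?_⟩⟩
  · rintro _ ⟨a, rfl⟩ _ ⟨b, rfl⟩
    exact hcomm a b
  · rintro _ ⟨a, rfl⟩
    exact skew_of_exp_unitary fun t => ⟨ρ (t • a), hΛ a t⟩
  · rintro _ ⟨a, rfl⟩
    exact ⟨ρ a, hρT a, hL a⟩
  · intro η hη
    have hLc : Continuous L := L.continuous_of_finiteDimensional
    have hN : IsOpen {a | ‖L a‖ < η} := isOpen_lt hLc.norm continuous_const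
    have hopen : IsOpenMap E := by
      refine IsOpenMap.piMap (fun _ => isLocalHomeomorph_circleExp.isOpenMap) ?_
      exact Eventually.of_forall fun _ => Circle.exp_surjective
    have h1 : IsOpen (e '' (E '' {a | ‖L a‖ < η})) :=
      e.toHomeomorph.isOpenMap _ (hopen _ hN)
    obtain ⟨O, hO, hOe⟩ := isOpen_induced_iff.1 h1
    have h1O : (1 : unitary (V →L[ℝ] V)) ∈ O := by
      have : (1 : T) ∈ Subtype.val ⁻¹' O := by
        rw [hOe]
        exact ⟨1, ⟨0, by simpa using hη, hE0⟩, map_one e⟩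
      exact this
    filter_upwards [self_mem_nhdsWithin, mem_nhdsWithin_of_mem_nhds (hO.mem_nhds h1O)] with A hA hAO
    have : (⟨A, hA⟩ : T) ∈ Subtype.val ⁻¹' O := hAO
    rw [hOe] at this
    obtain ⟨_, ⟨a, ha, rfl⟩, haA⟩ := this
    refine ⟨L a, ⟨a, rfl⟩, ha, ?_⟩
    rw [← hL]
    exact congrArg (fun B : T => ((B : unitary (V →L[ℝ] V)) : V →L[ℝ] V)) haA.symm

/-- A closed subgroup of finite index is open, so near `1` the group `G` agrees with `T`. -/
theorem IsAbelianLieAlgebra.of_finiteIndex {G T : Subgroup (unitary (V →L[ℝ] V))}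
    {𝔱 : Submodule ℝ (V →L[ℝ] V)} (h𝔱 : IsAbelianLieAlgebra T 𝔱) (hTG : T ≤ G)
    (hT : IsCompact (T : Set (unitary (V →L[ℝ] V)))) [(T.subgroupOf G).FiniteIndex] :
    IsAbelianLieAlgebra G 𝔱 := by
  refine ⟨h𝔱.comm, h𝔱.skew, fun ξ hξ => ?_, fun η hη => ?_⟩
  · obtain ⟨A, hA, h⟩ := h𝔱.exp_mem ξ hξ
    exact ⟨A, hTG hA, h⟩
  · have hclosed : IsClosed (T.subgroupOf G : Set G) :=
      hT.isClosed.preimage continuous_subtype_val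
    have hopen : IsOpen (T.subgroupOf G : Set G) :=
      Subgroup.isOpen_of_isClosed_of_finiteIndex _ hclosed
    obtain ⟨O, hO, hOe⟩ := isOpen_induced_iff.1 hopen
    have h1O : (1 : unitary (V →L[ℝ] V)) ∈ O := by
      have : (1 : G) ∈ Subtype.val ⁻¹' O := by
        rw [hOe]
        exact one_mem (T.subgroupOf G)
      exact this
    have hsub : (G : Set (unitary (V →L[ℝ] V))) ∩ O ⊆ T := by
      rintro A ⟨hA, hAO⟩
      have : (⟨A, hA⟩ : G) ∈ Subtype.val ⁻¹' O := hAO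
      rw [hOe] at this
      exact this
    have hle : 𝓝[(G : Set (unitary (V →L[ℝ] V)))] (1 : unitary (V →L[ℝ] V)) ≤ 𝓝[(T : Set (unitary (V →L[ℝ] V)))] 1 := by
      refine nhdsWithin_le_iff.2 (mem_of_superset ?_ hsub)
      exact inter_mem self_mem_nhdsWithin (mem_nhdsWithin_of_mem_nhds (hO.mem_nhds h1O))
    exact hle (h𝔱.near_one η hη)

namespace IsAbelianLieAlgebra

variable {G : Subgroup (unitary (V →L[ℝ] V))} {𝔱 : Submodule ℝ (V →L[ℝ] V)}

/-- The Lie algebra is normalized by the group. -/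
theorem conj_mem (h : IsAbelianLieAlgebra G 𝔱) {A : unitary (V →L[ℝ] V)} (hA : A ∈ G) {ξ : V →L[ℝ] V}
    (hξ : ξ ∈ 𝔱) : (A : V →L[ℝ] V) * ξ * ((A⁻¹ : unitary (V →L[ℝ] V)) : V →L[ℝ] V) ∈ 𝔱 := by
  obtain ⟨η, hη, hinj⟩ := exists_exp_injOn (R := V →L[ℝ] V)
  set ζ : V →L[ℝ] V := (A : V →L[ℝ] V) * ξ * ((A⁻¹ : unitary (V →L[ℝ] V)) : V →L[ℝ] V) with hζ
  have hAA : ((A⁻¹ : unitary (V →L[ℝ] V)) : V →L[ℝ] V) * (A : V →L[ℝ] V) = 1 :=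
    congrArg Subtype.val (inv_mul_cancel A)
  have hAA' : (A : V →L[ℝ] V) * ((A⁻¹ : unitary (V →L[ℝ] V)) : V →L[ℝ] V) = 1 :=
    congrArg Subtype.val (mul_inv_cancel A)
  have hexp : ∀ t : ℝ, expE (t • ζ) =
      (A : V →L[ℝ] V) * expE (t • ξ) * ((A⁻¹ : unitary (V →L[ℝ] V)) : V →L[ℝ] V) := by
    intro t
    let : NormedAlgebra ℚ (V →L[ℝ] V) := NormedAlgebra.restrictScalars ℚ ℝ (V →L[ℝ] V)
    have : expE _ = (A : V →L[ℝ] V) * expE (t • ξ) * ((A⁻¹ : unitary (V →L[ℝ] V)) : V →L[ℝ] V) :=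
      NormedSpace.exp_units_conj (𝔸 := V →L[ℝ] V)
        (⟨A, ((A⁻¹ : unitary (V →L[ℝ] V)) : V →L[ℝ] V), hAA', hAA⟩ : (V →L[ℝ] V)ˣ) (t • ξ)
    rw [← this, hζ]
    refine congrArg expE ?_
    change _ = (A : V →L[ℝ] V) * (t • ξ) * ((A⁻¹ : unitary (V →L[ℝ] V)) : V →L[ℝ] V)
    rw [mul_smul_comm, smul_mul_assoc]
  have hmem : ∀ t : ℝ, ∃ B ∈ G, (B : V →L[ℝ] V) = expE (t • ζ) := by
    intro t
    obtain ⟨B, hB, hBe⟩ := h.exp_mem (t • ξ) (𝔱.smul_mem t hξ)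
    refine ⟨A * B * A⁻¹, G.mul_mem (G.mul_mem hA hB) (G.inv_mem hA), ?_⟩
    rw [hexp, ← hBe]
    rfl
  choose B hBG hB using hmem
  have hBc : Tendsto B (𝓝 0) (𝓝[(G : Set (unitary (V →L[ℝ] V)))] 1) := by
    refine tendsto_nhdsWithin_iff.2 ⟨?_, Eventually.of_forall hBG⟩
    refine tendsto_subtype_rng.2 ?_
    simp only [hB]
    have := (hasDerivAt_expE_smul ζ 0).continuousAt
    simpa [ContinuousAt, expE_zero] using this
  have h1 := hBc.eventually (h.near_one η hη)
  have h2 : ∀ᶠ t : ℝ in 𝓝 0, ‖t • ζ‖ < η := by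
    have : Continuous fun t : ℝ => ‖t • ζ‖ := by fun_prop
    exact this.continuousAt.eventually (gt_mem_nhds (by simpa using hη))
  -- For a small `t ≠ 0`, `exp (t ζ)` also equals `exp ξ'` with a small `ξ' ∈ 𝔱`; injectivity of the
  -- exponential near `0` gives `t ζ = ξ'`.
  obtain ⟨t, ⟨⟨ξ', hξ', hn, he⟩, ht⟩, ht0⟩ :=
    ((h1.and h2).filter_mono (nhdsWithin_le_nhds (s := {0}ᶜ))|>.and self_mem_nhdsWithin).exists
  have h3 : t • ζ = ξ' := hinj (by simpa using ht) (by simpa using hn) ((hB t).symm.trans he)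
  have h4 : ζ = t⁻¹ • ξ' := by
    rw [← h3, smul_smul, inv_mul_cancel₀ ht0, one_smul]
  rw [h4]
  exact 𝔱.smul_mem _ hξ'

end IsAbelianLieAlgebra

/-! ### Normal form of a commuting family of skew operators -/

section NormalForm

variable {V : Type*} [NormedAddCommGroup V] [InnerProductSpace ℝ V]

/-- The infinitesimal rotation in the plane of the orthonormal vectors `a`, `b`. -/
def rot (a b : V) : V →L[ℝ] V :=
  (innerSL ℝ a).smulRight b - (innerSL ℝ b).smulRight a

theorem rot_apply (a b w : V) : rot a b w = inner ℝ a w • b - inner ℝ b w • a := by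
  simp [rot]

/-- The families `a`, `b` together are orthonormal. -/
structure OrthoPlanes {ι : Type*} (a b : ι → V) : Prop where
  left : Orthonormal ℝ a
  right : Orthonormal ℝ b
  ortho : ∀ i j, inner ℝ (a i) (b j) = 0

namespace OrthoPlanes

variable {ι : Type*} {a b : ι → V}

theorem ortho' (h : OrthoPlanes a b) (i j : ι) : inner ℝ (b i) (a j) = 0 := by
  rw [real_inner_comm]; exact h.ortho j i

theorem inner_left (h : OrthoPlanes a b) (i : ι) : inner ℝ (a i) (a i) = 1 := by
  rw [real_inner_self_eq_norm_sq, h.left.1 i, one_pow]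

theorem inner_right (h : OrthoPlanes a b) (i : ι) : inner ℝ (b i) (b i) = 1 := by
  rw [real_inner_self_eq_norm_sq, h.right.1 i, one_pow]

theorem sumElim (h : OrthoPlanes a b) : Orthonormal ℝ (Sum.elim a b) := by
  classical
  rw [orthonormal_iff_ite]
  rintro (i | i) (j | j)
  · simpa using orthonormal_iff_ite.1 h.left i j
  · simpa using h.ortho i j
  · simpa using h.ortho' i j
  · simpa using orthonormal_iff_ite.1 h.right i j

theorem rot_left (h : OrthoPlanes a b) (i : ι) : rot (a i) (b i) (a i) = b i := by
  rw [rot_apply, h.inner_left, h.ortho', one_smul, zero_smul, sub_zero]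

theorem rot_right (h : OrthoPlanes a b) (i : ι) : rot (a i) (b i) (b i) = - a i := by
  rw [rot_apply, h.inner_right, h.ortho, one_smul, zero_smul, zero_sub]

theorem rot_left_of_ne (h : OrthoPlanes a b) {i j : ι} (hij : i ≠ j) :
    rot (a i) (b i) (a j) = 0 := by
  rw [rot_apply, h.left.2 hij, h.ortho', zero_smul, zero_smul, sub_zero]

theorem comp (h : OrthoPlanes a b) {κ : Type*} {f : κ → ι} (hf : Function.Injective f) :
    OrthoPlanes (a ∘ f) (b ∘ f) :=
  ⟨h.left.comp f hf, h.right.comp f hf, fun _ _ => h.ortho _ _⟩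

end OrthoPlanes

variable [FiniteDimensional ℝ V]

/-- The eigenvectors of a symmetric operator span each invariant subspace, so they cannot all lie in
a `P` that does not contain `U`. -/
theorem exists_eigenvector_notMem {S : V →L[ℝ] V} {U P : Submodule ℝ V}
    (hS : ∀ v w, inner ℝ (S v) w = inner ℝ v (S w)) (hU : ∀ v ∈ U, S v ∈ U) (hP : ¬ U ≤ P) :
    ∃ μ : ℝ, ∃ v ∈ U, v ∉ P ∧ S v = μ • v := by
  by_contra! hcon
  let T : U →ₗ[ℝ] U := (S : V →ₗ[ℝ] V).restrict hU
  have hT : T.IsSymmetric := fun v w => hS v w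
  have h1 : ⨆ μ : ℝ, Module.End.eigenspace T μ = ⊤ := by
    rw [← Submodule.orthogonal_eq_bot_iff]
    exact hT.orthogonalComplement_iSup_eigenspaces_eq_bot
  have h2 : (⊤ : Submodule ℝ U) ≤ P.comap U.subtype := by
    rw [← h1]
    refine iSup_le fun μ v hv => ?_
    rw [Module.End.mem_eigenspace_iff] at hv
    by_contra hvP
    exact hcon μ v v.2 hvP (congrArg Subtype.val hv)
  exact hP fun v hv => h2 (Submodule.mem_top (x := (⟨v, hv⟩ : U)))

variable {𝔱 : Submodule ℝ (V →L[ℝ] V)}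

theorem inner_apply_self_of_skew {ξ : V →L[ℝ] V}
    (h : ∀ v w : V, inner ℝ (ξ v) w = - inner ℝ v (ξ w)) (v : V) : inner ℝ (ξ v) v = 0 := by
  have := h v v
  rw [real_inner_comm (ξ v) v] at this
  linarith

/-- On a minimal invariant subspace on which `𝔱` does not vanish, the symmetric operators `ξ₀ ξ₀`
and `ξ ξ₀` must be scalars. Hence `ξ₀` is a multiple of a complex structure and every `ξ` is a
multiple of `ξ₀`, so the plane of `v` and `ξ₀ v` is invariant. -/
theorem exists_invariant_plane (hcomm : ∀ ξ ∈ 𝔱, ∀ η ∈ 𝔱, ξ * η = η * ξ)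
    (hskew : ∀ ξ ∈ 𝔱, ∀ v w : V, inner ℝ (ξ v) w = - inner ℝ v (ξ w)) (n : ℕ) :
    ∀ U : Submodule ℝ V, Module.finrank ℝ U = n → (∀ ξ ∈ 𝔱, ∀ v ∈ U, ξ v ∈ U) →
    (∃ ξ ∈ 𝔱, ∃ v ∈ U, ξ v ≠ 0) → ∃ a ∈ U, ∃ b ∈ U, ‖a‖ = 1 ∧ ‖b‖ = 1 ∧ inner ℝ a b = 0 ∧
      ∀ ξ ∈ 𝔱, ∃ c : ℝ, ξ a = c • b ∧ ξ b = - c • a := by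
  induction n using Nat.strong_induction_on with
  | _ n ih =>
  intro U hn hinv hne
  by_cases hmin : ∃ U' : Submodule ℝ V, U' < U ∧ (∀ ξ ∈ 𝔱, ∀ v ∈ U', ξ v ∈ U') ∧
      ∃ ξ ∈ 𝔱, ∃ v ∈ U', ξ v ≠ 0
  · obtain ⟨U', hlt, h1, h2⟩ := hmin
    obtain ⟨a, ha, b, hb, h⟩ := ih _ (hn ▸ Submodule.finrank_lt_finrank_of_lt hlt) U' rfl h1 h2
    exact ⟨a, hlt.le ha, b, hlt.le hb, h⟩
  have hcomm' : ∀ ξ ∈ 𝔱, ∀ η ∈ 𝔱, ∀ v, ξ (η v) = η (ξ v) := fun ξ hξ η hη v =>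
    congrArg (fun F : V →L[ℝ] V => F v) (hcomm ξ hξ η hη)
  -- Schur's argument: the `μ`-eigenspace of `S` in `U` is `𝔱`-invariant and `𝔱` acts nontrivially
  -- on it, so by minimality it is all of `U`.
  have key : ∀ S : V →L[ℝ] V, (∀ ξ ∈ 𝔱, ∀ v, ξ (S v) = S (ξ v)) → ∀ μ : ℝ, ∀ v ∈ U,
      S v = μ • v → (∃ ξ ∈ 𝔱, ξ v ≠ 0) → ∀ w ∈ U, S w = μ • w := by
    intro S hS μ v hv hSv hξ w hw
    by_contra hw'
    let U' : Submodule ℝ V := U ⊓ LinearMap.ker ((S : V →ₗ[ℝ] V) - μ • LinearMap.id)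
    have hU' : ∀ z, z ∈ U' ↔ z ∈ U ∧ S z = μ • z := fun z => by
      simp [U', sub_eq_zero]
    obtain ⟨ξ, hξ, hne⟩ := hξ
    refine hmin ⟨U', lt_of_le_of_ne inf_le_left fun h => ?_, fun η hη z hz => ?_, ξ, hξ, v,
      (hU' v).2 ⟨hv, hSv⟩, hne⟩
    · exact hw' ((hU' w).1 (h ▸ hw)).2
    · rw [hU'] at hz ⊢
      refine ⟨hinv η hη z hz.1, ?_⟩
      rw [← hS η hη, hz.2, map_smul]
  obtain ⟨ξ₀, hξ₀, w, hw, hw0⟩ := hne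
  obtain ⟨μ, v₀, hv₀, hv₀', hμ⟩ := exists_eigenvector_notMem (S := ξ₀ * ξ₀) (U := U)
    (P := LinearMap.ker (ξ₀ : V →ₗ[ℝ] V)) (fun v w => by
      change inner ℝ (ξ₀ (ξ₀ v)) w = inner ℝ v (ξ₀ (ξ₀ w))
      rw [hskew _ hξ₀, hskew _ hξ₀, neg_neg])
    (fun v hv => hinv _ hξ₀ _ (hinv _ hξ₀ _ hv)) (fun h => hw0 (h hw))
  have hv₀n : ξ₀ v₀ ≠ 0 := hv₀'
  have hv₀0 : v₀ ≠ 0 := fun h => hv₀n (by rw [h, map_zero])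
  have hsq : ∀ w ∈ U, ξ₀ (ξ₀ w) = μ • w :=
    key (ξ₀ * ξ₀) (fun ξ hξ v => by
      change ξ (ξ₀ (ξ₀ v)) = ξ₀ (ξ₀ (ξ v))
      rw [hcomm' ξ hξ ξ₀ hξ₀, hcomm' ξ hξ ξ₀ hξ₀]) μ v₀ hv₀ hμ ⟨ξ₀, hξ₀, hv₀n⟩
  set a : V := ‖v₀‖⁻¹ • v₀ with ha
  have haU : a ∈ U := U.smul_mem _ hv₀
  have ha1 : ‖a‖ = 1 := by
    rw [ha, norm_smul, norm_inv, norm_norm, inv_mul_cancel₀ (norm_ne_zero_iff.2 hv₀0)]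
  have hξa : ξ₀ a ≠ 0 := by
    rw [ha, map_smul]
    exact smul_ne_zero (inv_ne_zero (norm_ne_zero_iff.2 hv₀0)) hv₀n
  set ν : ℝ := ‖ξ₀ a‖ with hν
  have hν0 : ν ≠ 0 := norm_ne_zero_iff.2 hξa
  set b : V := ν⁻¹ • ξ₀ a with hb
  have hbU : b ∈ U := U.smul_mem _ (hinv _ hξ₀ _ haU)
  have hab : ξ₀ a = ν • b := by rw [hb, smul_smul, mul_inv_cancel₀ hν0, one_smul]
  have hμν : μ = - ν ^ 2 := by
    have h1 : inner ℝ (ξ₀ (ξ₀ a)) a = - ν ^ 2 := by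
      rw [hskew _ hξ₀, real_inner_self_eq_norm_sq]
    rw [hsq a haU, real_inner_smul_left, real_inner_self_eq_norm_sq, ha1] at h1
    linarith
  have hba : ξ₀ b = - ν • a := by
    rw [hb, map_smul, hsq a haU, smul_smul, hμν]
    congr 1
    field_simp
  refine ⟨a, haU, b, hbU, ha1, ?_, ?_, fun ξ hξ => ?_⟩
  · rw [hb, norm_smul, norm_inv, ← hν, Real.norm_eq_abs, abs_of_nonneg (norm_nonneg _),
      inv_mul_cancel₀ hν0]
  · rw [hb, real_inner_smul_right, real_inner_comm, inner_apply_self_of_skew (hskew _ hξ₀),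
      mul_zero]
  · obtain ⟨c, v₁, hv₁, hv₁0, hc⟩ := exists_eigenvector_notMem (S := ξ * ξ₀) (U := U)
      (P := ⊥) (fun v w => by
        change inner ℝ (ξ (ξ₀ v)) w = inner ℝ v (ξ (ξ₀ w))
        rw [hskew _ hξ, hskew _ hξ₀, neg_neg, hcomm' _ hξ _ hξ₀])
      (fun v hv => hinv _ hξ _ (hinv _ hξ₀ _ hv))
      (fun h => hw0 (by rw [(Submodule.mem_bot ℝ).1 (h hw), map_zero]))
    have hv₁0' : v₁ ≠ 0 := hv₁0
    have hall : ∀ w ∈ U, ξ (ξ₀ w) = c • w :=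
      key (ξ * ξ₀) (fun η hη v => by
        change η (ξ (ξ₀ v)) = ξ (ξ₀ (η v))
        rw [hcomm' η hη ξ hξ, hcomm' η hη ξ₀ hξ₀]) c v₁ hv₁ hc
        ⟨ξ₀, hξ₀, fun h0 => by
          have := hsq v₁ hv₁
          rw [h0, map_zero, hμν] at this
          exact smul_ne_zero (neg_ne_zero.2 (pow_ne_zero 2 hν0)) hv₁0' this.symm⟩
    refine ⟨-(ν⁻¹ * c), ?_, ?_⟩
    · have h2 := hall b hbU
      rw [hba, map_smul] at h2
      calc ξ a = (-ν⁻¹) • (-ν • ξ a) := by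
            rw [smul_smul, neg_mul_neg, inv_mul_cancel₀ hν0, one_smul]
        _ = _ := by rw [h2, smul_smul, neg_mul]
    · rw [hb, map_smul, hall a haU, smul_smul, neg_neg]

/-- The planes of the orthonormal pairs `(a i, b i)` are invariant under `𝔱`, which vanishes on
their common orthogonal complement. -/
structure IsNormalForm (𝔱 : Submodule ℝ (V →L[ℝ] V)) {ι : Type*} (a b : ι → V) : Prop where
  planes : OrthoPlanes a b
  apply_eq : ∀ ξ ∈ 𝔱, ∀ i, ∃ c : ℝ, ξ (a i) = c • b i ∧ ξ (b i) = - c • a i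
  apply_eq_zero : ∀ ξ ∈ 𝔱, ∀ v, (∀ i, inner ℝ (a i) v = 0) → (∀ i, inner ℝ (b i) v = 0) → ξ v = 0

/-- As long as `𝔱` does not vanish on the complement of the planes found so far, that complement
contains another invariant plane. If this never stopped, there would be more orthonormal vectors
than the dimension allows. -/
theorem exists_isNormalForm (hcomm : ∀ ξ ∈ 𝔱, ∀ η ∈ 𝔱, ξ * η = η * ξ)
    (hskew : ∀ ξ ∈ 𝔱, ∀ v w : V, inner ℝ (ξ v) w = - inner ℝ v (ξ w)) :
    ∃ (p : ℕ) (a b : Fin p → V), IsNormalForm 𝔱 a b := by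
  by_contra! hcon
  have hall : ∀ p : ℕ, ∃ a b : Fin p → V, OrthoPlanes a b ∧
      ∀ ξ ∈ 𝔱, ∀ i, ∃ c : ℝ, ξ (a i) = c • b i ∧ ξ (b i) = - c • a i := by
    intro p
    induction p with
    | zero =>
      refine ⟨Fin.elim0, Fin.elim0, ⟨?_, ?_, fun i => i.elim0⟩, fun ξ _ i => i.elim0⟩ <;>
      exact ⟨fun i => i.elim0, fun i => i.elim0⟩
    | succ p ih =>
      obtain ⟨a, b, hab, hinv⟩ := ih
      have hfail : ∃ ξ ∈ 𝔱, ∃ v, (∀ i, inner ℝ (a i) v = 0) ∧ (∀ i, inner ℝ (b i) v = 0) ∧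
          ξ v ≠ 0 := by
        by_contra! h
        exact hcon p a b ⟨hab, hinv, h⟩
      let U : Submodule ℝ V := (Submodule.span ℝ (range (Sum.elim a b)))ᗮ
      have hU : ∀ v, v ∈ U ↔ (∀ i, inner ℝ (a i) v = 0) ∧ (∀ i, inner ℝ (b i) v = 0) := by
        intro v
        constructor
        · intro h
          rw [Submodule.mem_orthogonal] at h
          exact ⟨fun i => h _ (Submodule.subset_span ⟨Sum.inl i, rfl⟩),
            fun i => h _ (Submodule.subset_span ⟨Sum.inr i, rfl⟩)⟩
        · rintro ⟨h1, h2⟩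
          have : Submodule.span ℝ (range (Sum.elim a b)) ≤ (Submodule.span ℝ {v})ᗮ := by
            rw [Submodule.span_le]
            rintro _ ⟨i | i, rfl⟩
            · exact Submodule.mem_orthogonal_singleton_iff_inner_left.2 (h1 i)
            · exact Submodule.mem_orthogonal_singleton_iff_inner_left.2 (h2 i)
          rw [Submodule.mem_orthogonal]
          exact fun u hu => Submodule.mem_orthogonal_singleton_iff_inner_left.1 (this hu)
      obtain ⟨ξ, hξ, v, hv1, hv2, hv⟩ := hfail
      obtain ⟨a', ha', b', hb', hna, hnb, hab', hinv'⟩ := exists_invariant_plane hcomm hskew _ U rfl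
        (fun ξ hξ v hv => by
          rw [hU] at hv ⊢
          refine ⟨fun i => ?_, fun i => ?_⟩ <;> obtain ⟨c, h1, h2⟩ := hinv ξ hξ i
          · rw [real_inner_comm, hskew ξ hξ, h1, real_inner_smul_right, real_inner_comm, hv.2 i]
            simp
          · rw [real_inner_comm, hskew ξ hξ, h2, real_inner_smul_right, real_inner_comm, hv.1 i]
            simp) ⟨ξ, hξ, v, (hU v).2 ⟨hv1, hv2⟩, hv⟩
      rw [hU] at ha' hb'
      have orth : ∀ (c : Fin p → V) (c' : V), Orthonormal ℝ c → ‖c'‖ = 1 →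
          (∀ i, inner ℝ (c i) c' = 0) → Orthonormal ℝ (Fin.snoc c c' : Fin (p + 1) → V) := by
        intro c c' hc hc' hcc
        constructor
        · intro i
          induction i using Fin.lastCases with
          | last => simpa using hc'
          | cast i => simpa using hc.1 i
        · intro i j hij
          induction i using Fin.lastCases with
          | last =>
            induction j using Fin.lastCases with
            | last => exact absurd rfl hij
            | cast j => rw [real_inner_comm]; simpa using hcc j
          | cast i =>
            induction j using Fin.lastCases with
            | last => simpa using hcc i
            | cast j =>
              simpa using hc.2 (i := i) (j := j) (fun h => hij (by rw [h]))
      refine ⟨Fin.snoc a a', Fin.snoc b b', ⟨orth a a' hab.left hna ha'.1,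
        orth b b' hab.right hnb hb'.2, fun i j => ?_⟩, fun ξ hξ i => ?_⟩
      · induction i using Fin.lastCases with
        | last =>
          induction j using Fin.lastCases with
          | last => simpa using hab'
          | cast j => rw [real_inner_comm]; simpa using ha'.2 j
        | cast i =>
          induction j using Fin.lastCases with
          | last => simpa using hb'.1 i
          | cast j => simpa using hab.ortho i j
      · induction i using Fin.lastCases with
        | last => simpa using hinv' ξ hξ
        | cast i => simpa using hinv ξ hξ i
  obtain ⟨a, _, hab, -⟩ := hall (Module.finrank ℝ V + 1)
  have := hab.left.linearIndependent.fintype_card_le_finrank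
  simp at this

/-- The stabilizer of `x` in `𝔱` is spanned by infinitesimal rotations in orthogonal planes. -/
def IsGoodPoint (𝔱 : Submodule ℝ (V →L[ℝ] V)) (x : V) : Prop :=
  ∃ (ι : Type) (_ : Fintype ι) (a b : ι → V), OrthoPlanes a b ∧ (∀ j, rot (a j) (b j) ∈ 𝔱) ∧
    (∀ j, rot (a j) (b j) x = 0) ∧
    ∀ ξ ∈ 𝔱, ξ x = 0 → ξ ∈ Submodule.span ℝ (range fun j => rot (a j) (b j))

/-- The evaluation `ξ ↦ ξ x` on `𝔱`. -/
def evalAt (𝔱 : Submodule ℝ (V →L[ℝ] V)) (x : V) : 𝔱 →ₗ[ℝ] V where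
  toFun ξ := (ξ : V →L[ℝ] V) x
  map_add' _ _ := rfl
  map_smul' _ _ := rfl

/-- The tangent space of the orbit of `x`. -/
def orbitTangent (𝔱 : Submodule ℝ (V →L[ℝ] V)) (x : V) : Submodule ℝ V :=
  LinearMap.range (evalAt 𝔱 x)

theorem mem_orbitTangent {x v : V} : v ∈ orbitTangent 𝔱 x ↔ ∃ ξ ∈ 𝔱, ξ x = v := by
  constructor
  · rintro ⟨ξ, rfl⟩
    exact ⟨ξ, ξ.2, rfl⟩
  · rintro ⟨ξ, hξ, rfl⟩
    exact ⟨⟨ξ, hξ⟩, rfl⟩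

/-- The vectors killed by the stabilizer of `x` in `𝔱`. -/
def fixedSpace (𝔱 : Submodule ℝ (V →L[ℝ] V)) (x : V) : Submodule ℝ V where
  carrier := {v | ∀ ξ ∈ 𝔱, ξ x = 0 → ξ v = 0}
  add_mem' hv hw ξ hξ h := by rw [map_add, hv ξ hξ h, hw ξ hξ h, add_zero]
  zero_mem' ξ _ _ := map_zero ξ
  smul_mem' c v hv ξ hξ h := by rw [map_smul, hv ξ hξ h, smul_zero]

theorem orbitTangent_le_fixedSpace (hcomm : ∀ ξ ∈ 𝔱, ∀ η ∈ 𝔱, ξ * η = η * ξ) (x : V) :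
    orbitTangent 𝔱 x ≤ fixedSpace 𝔱 x := by
  intro v hv
  obtain ⟨η, hη, rfl⟩ := mem_orbitTangent.1 hv
  intro ξ hξ h
  have : ξ (η x) = η (ξ x) := congrArg (fun F : V →L[ℝ] V => F x) (hcomm ξ hξ η hη)
  rw [this, h, map_zero]

namespace IsNormalForm

variable {p : ℕ} {a b : Fin p → V}

/-- The weights of the normal form. -/
def weight (b a : Fin p → V) (i : Fin p) (ξ : V →L[ℝ] V) : ℝ := inner ℝ (b i) (ξ (a i))

theorem apply_left (h : IsNormalForm 𝔱 a b) {ξ : V →L[ℝ] V} (hξ : ξ ∈ 𝔱) (i : Fin p) :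
    ξ (a i) = weight b a i ξ • b i := by
  obtain ⟨c, h1, -⟩ := h.apply_eq ξ hξ i
  rw [weight, h1, real_inner_smul_right, h.planes.inner_right, mul_one]

theorem apply_right (h : IsNormalForm 𝔱 a b) {ξ : V →L[ℝ] V} (hξ : ξ ∈ 𝔱) (i : Fin p) :
    ξ (b i) = - weight b a i ξ • a i := by
  obtain ⟨c, h1, h2⟩ := h.apply_eq ξ hξ i
  rw [weight, h1, real_inner_smul_right, h.planes.inner_right, mul_one, h2]

theorem apply_eq_sum (h : IsNormalForm 𝔱 a b) {ξ : V →L[ℝ] V} (hξ : ξ ∈ 𝔱) :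
    ξ = ∑ i, weight b a i ξ • rot (a i) (b i) := by
  classical
  ext1 v
  set v' : V := v - ∑ i, (inner ℝ (a i) v • a i + inner ℝ (b i) v • b i) with hv'
  have h1 : ∀ j, inner ℝ (a j) v' = 0 := by
    intro j
    rw [hv', inner_sub_right, inner_sum, Finset.sum_eq_single j]
    · rw [inner_add_right, real_inner_smul_right, real_inner_smul_right, h.planes.inner_left,
        h.planes.ortho]
      ring
    · intro i _ hij
      rw [inner_add_right, real_inner_smul_right, real_inner_smul_right,
        h.planes.left.2 (Ne.symm hij), h.planes.ortho]
      ring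
    · simp
  have h2 : ∀ j, inner ℝ (b j) v' = 0 := by
    intro j
    rw [hv', inner_sub_right, inner_sum, Finset.sum_eq_single j]
    · rw [inner_add_right, real_inner_smul_right, real_inner_smul_right, h.planes.inner_right,
        h.planes.ortho']
      ring
    · intro i _ hij
      rw [inner_add_right, real_inner_smul_right, real_inner_smul_right,
        h.planes.right.2 (Ne.symm hij), h.planes.ortho']
      ring
    · simp
  have h3 := h.apply_eq_zero ξ hξ v' h1 h2
  rw [hv', map_sub, sub_eq_zero, map_sum] at h3
  rw [h3, sum_apply]
  refine Finset.sum_congr rfl fun i _ => ?_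
  rw [map_add, map_smul, map_smul, h.apply_left hξ, h.apply_right hξ]
  simp only [FunLike.coe_smul, Pi.smul_apply, rot_apply]
  module

/-- On each plane `ξ` is a rotation with speed its weight, which kills only `0` unless the weight
vanishes. -/
theorem apply_eq_zero_iff (h : IsNormalForm 𝔱 a b)
    (hskew : ∀ ξ ∈ 𝔱, ∀ v w : V, inner ℝ (ξ v) w = - inner ℝ v (ξ w))
    {ξ : V →L[ℝ] V} (hξ : ξ ∈ 𝔱) (x : V) :
    ξ x = 0 ↔ ∀ i, (inner ℝ (a i) x ≠ 0 ∨ inner ℝ (b i) x ≠ 0) → weight b a i ξ = 0 := by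
  constructor
  · intro h0 i hi
    have h1 : weight b a i ξ * inner ℝ (b i) x = 0 := by
      rw [← real_inner_smul_left, ← h.apply_left hξ, hskew ξ hξ, h0, inner_zero_right, neg_zero]
    have h2 : - weight b a i ξ * inner ℝ (a i) x = 0 := by
      rw [← real_inner_smul_left, ← h.apply_right hξ, hskew ξ hξ, h0, inner_zero_right, neg_zero]
    rcases hi with hi | hi
    · exact neg_eq_zero.1 ((mul_eq_zero.1 h2).resolve_right hi)
    · exact (mul_eq_zero.1 h1).resolve_right hi
  · intro h0
    rw [h.apply_eq_sum hξ, sum_apply]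
    refine Finset.sum_eq_zero fun i _ => ?_
    by_cases hi : inner ℝ (a i) x ≠ 0 ∨ inner ℝ (b i) x ≠ 0
    · rw [h0 i hi, zero_smul]; rfl
    · push Not at hi
      simp only [FunLike.coe_smul, Pi.smul_apply, rot_apply, hi.1, hi.2]
      simp

end IsNormalForm

/-- The sum of the `a i` has a nonzero component in every plane, so an element that kills it has all
weights zero. -/
theorem exists_trivial_stabilizer (hcomm : ∀ ξ ∈ 𝔱, ∀ η ∈ 𝔱, ξ * η = η * ξ)
    (hskew : ∀ ξ ∈ 𝔱, ∀ v w : V, inner ℝ (ξ v) w = - inner ℝ v (ξ w)) :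
    ∃ x : V, ∀ ξ ∈ 𝔱, ξ x = 0 → ξ = 0 := by
  obtain ⟨p, a, b, h⟩ := exists_isNormalForm hcomm hskew
  refine ⟨∑ i, a i, fun ξ hξ h0 => ?_⟩
  rw [h.apply_eq_zero_iff hskew hξ] at h0
  rw [h.apply_eq_sum hξ]
  refine Finset.sum_eq_zero fun i _ => ?_
  rw [h0 i (Or.inl ?_), zero_smul]
  rw [inner_sum, Finset.sum_eq_single i (fun j _ hj => h.planes.left.2 hj.symm) (by simp),
    h.planes.inner_left]
  exact one_ne_zero

/-- The stabilizer depends only on the set of planes in which the point has a nonzero component.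
This reduces the bad points to finitely many fixed spaces. -/
theorem exists_finite_stabilizer_type (hcomm : ∀ ξ ∈ 𝔱, ∀ η ∈ 𝔱, ξ * η = η * ξ)
    (hskew : ∀ ξ ∈ 𝔱, ∀ v w : V, inner ℝ (ξ v) w = - inner ℝ v (ξ w)) :
    ∃ (κ : Type) (_ : Finite κ) (J : V → κ), ∀ x y, J x = J y → ∀ ξ ∈ 𝔱, ξ x = 0 → ξ y = 0 := by
  classical
  obtain ⟨p, a, b, h⟩ := exists_isNormalForm hcomm hskew
  refine ⟨Finset (Fin p), inferInstance,
    fun x => Finset.univ.filter fun i => inner ℝ (a i) x ≠ 0 ∨ inner ℝ (b i) x ≠ 0,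
    fun x y hxy ξ hξ h0 => ?_⟩
  rw [h.apply_eq_zero_iff hskew hξ] at h0 ⊢
  intro i hi
  have : i ∈ Finset.univ.filter fun i => inner ℝ (a i) y ≠ 0 ∨ inner ℝ (b i) y ≠ 0 := by
    simpa using hi
  have hxy' := (Finset.ext_iff.1 hxy i).2 this
  exact h0 i (by simpa using hxy')

/-- Let `𝔥` be the stabilizer of `x` and `K` the planes that it moves. The fixed space is orthogonal
to the planes of `K`, and the orbit has dimension `dim 𝔱 - dim 𝔥`. Badness enters only as `dim 𝔥 <
|K|`; together with `dim 𝔥 > 0` it gives `|K| ≥ 2` and both bounds. -/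
theorem finrank_slice_of_not_isGoodPoint (hcomm : ∀ ξ ∈ 𝔱, ∀ η ∈ 𝔱, ξ * η = η * ξ)
    (hskew : ∀ ξ ∈ 𝔱, ∀ v w : V, inner ℝ (ξ v) w = - inner ℝ v (ξ w)) {x : V}
    (hx : ¬ IsGoodPoint 𝔱 x) :
    Module.finrank ℝ (fixedSpace 𝔱 x ⊓ (orbitTangent 𝔱 x)ᗮ : Submodule ℝ V) + 4 ≤
        Module.finrank ℝ V ∧
      Module.finrank ℝ (fixedSpace 𝔱 x ⊓ (orbitTangent 𝔱 x)ᗮ : Submodule ℝ V) + 3 +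
        Module.finrank ℝ 𝔱 ≤ Module.finrank ℝ V := by
  classical
  obtain ⟨p, a, b, h⟩ := exists_isNormalForm hcomm hskew
  obtain ⟨𝔥, h𝔥⟩ : ∃ 𝔥 : Submodule ℝ (V →L[ℝ] V), 𝔥 = (LinearMap.ker (evalAt 𝔱 x)).map 𝔱.subtype :=
    ⟨_, rfl⟩
  have hmem : ∀ ξ, ξ ∈ 𝔥 ↔ ξ ∈ 𝔱 ∧ ξ x = 0 := by
    intro ξ
    rw [h𝔥]
    constructor
    · rintro ⟨η, hη, rfl⟩
      exact ⟨η.2, hη⟩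
    · exact fun hξ => ⟨⟨ξ, hξ.1⟩, hξ.2, rfl⟩
  let K : Finset (Fin p) := Finset.univ.filter fun i =>
    ∃ ξ ∈ 𝔱, ξ x = 0 ∧ IsNormalForm.weight b a i ξ ≠ 0
  have hK : ∀ i, i ∈ K ↔ ∃ ξ ∈ 𝔱, ξ x = 0 ∧ IsNormalForm.weight b a i ξ ≠ 0 := fun i => by
    simp [K]
  let X : 𝔥 →ₗ[ℝ] (K → ℝ) :=
    { toFun := fun ξ i => IsNormalForm.weight b a i (ξ : V →L[ℝ] V)
      map_add' := fun ξ η => by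
        ext i
        simp [IsNormalForm.weight, inner_add_right]
      map_smul' := fun c ξ => by
        ext i
        simp [IsNormalForm.weight, real_inner_smul_right] }
  have hsum : ∀ ξ ∈ 𝔱, ξ x = 0 →
      ξ = ∑ i : K, IsNormalForm.weight b a i ξ • rot (a i) (b i) := by
    intro ξ hξ h0
    rw [Finset.sum_coe_sort K (fun i => IsNormalForm.weight b a i ξ • rot (a i) (b i))]
    conv_lhs => rw [h.apply_eq_sum hξ]
    refine (Finset.sum_subset (Finset.subset_univ K) fun i _ hi => ?_).symm
    have : IsNormalForm.weight b a i ξ = 0 := by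
      by_contra hne
      exact hi ((hK i).2 ⟨ξ, hξ, h0, hne⟩)
    rw [this, zero_smul]
  have hXinj : Function.Injective X := by
    refine (injective_iff_map_eq_zero X).2 fun ξ hξ => ?_
    refine Subtype.ext ?_
    change (ξ : V →L[ℝ] V) = 0
    rw [hsum _ ((hmem _).1 ξ.2).1 ((hmem _).1 ξ.2).2]
    refine Finset.sum_eq_zero fun i _ => ?_
    have : IsNormalForm.weight b a i (ξ : V →L[ℝ] V) = 0 := congrFun hξ i
    rw [this, zero_smul]
  have hle : Module.finrank ℝ 𝔥 ≤ K.card := by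
    have := LinearMap.finrank_le_finrank_of_injective hXinj
    simpa using this
  -- With equality the weights of `K` would be coordinates on `𝔥`, and the dual basis would consist
  -- of the rotations of the single planes, making `x` good.
  have hlt : Module.finrank ℝ 𝔥 < K.card := by
    refine lt_of_le_of_ne hle fun heq => hx ?_
    have hsurj : Function.Surjective X := by
      exact (LinearMap.injective_iff_surjective_of_finrank_eq_finrank (V := 𝔥) (V₂ := K → ℝ)
        (f := X) (by simp [heq])).1 hXinj
    have hrot : ∀ j : K, ∃ ξ : 𝔥, (ξ : V →L[ℝ] V) = rot (a j) (b j) := by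
      intro j
      obtain ⟨ξ, hξ⟩ := hsurj (Pi.single j 1)
      refine ⟨ξ, ?_⟩
      rw [hsum _ ((hmem _).1 ξ.2).1 ((hmem _).1 ξ.2).2, Finset.sum_eq_single j]
      · have : IsNormalForm.weight b a j (ξ : V →L[ℝ] V) = 1 := by
          have := congrFun hξ j
          rw [Pi.single_eq_same] at this
          exact this
        rw [this, one_smul]
      · intro i _ hij
        have : IsNormalForm.weight b a i (ξ : V →L[ℝ] V) = 0 := by
          have := congrFun hξ i
          rw [Pi.single_eq_of_ne hij] at this
          exact this
        rw [this, zero_smul]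
      · simp
    refine ⟨K, inferInstance, fun i => a i, fun i => b i, h.planes.comp Subtype.val_injective,
      fun j => ?_, fun j => ?_, fun ξ hξ h0 => ?_⟩
    · obtain ⟨ξ, hξ⟩ := hrot j
      rw [← hξ]
      exact ((hmem _).1 ξ.2).1
    · obtain ⟨ξ, hξ⟩ := hrot j
      rw [← hξ]
      exact ((hmem _).1 ξ.2).2
    · rw [hsum ξ hξ h0]
      exact Submodule.sum_mem _ fun i _ => Submodule.smul_mem _ _ (Submodule.subset_span ⟨i, rfl⟩)
  -- `K` is nonempty because its cardinality exceeds `dim 𝔥`, and a plane belongs to `K` only if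
  -- some element of `𝔥` moves it.
  have hpos : 0 < Module.finrank ℝ 𝔥 := by
    obtain ⟨i, hi⟩ := Finset.card_pos.1 ((Nat.zero_le _).trans_lt hlt)
    obtain ⟨ξ, hξ, h0, hne⟩ := (hK i).1 hi
    have : Nontrivial 𝔥 := by
      refine ⟨⟨⟨ξ, (hmem ξ).2 ⟨hξ, h0⟩⟩, 0, fun heq => hne ?_⟩⟩
      have : ξ = 0 := congrArg Subtype.val heq
      rw [this]
      simp [IsNormalForm.weight]
    exact Module.finrank_pos
  have hF : Module.finrank ℝ (fixedSpace 𝔱 x) + 2 * K.card ≤ Module.finrank ℝ V := by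
    have horth : Orthonormal ℝ (Sum.elim (fun i : K => a i) fun i : K => b i) :=
      (h.planes.comp (f := fun i : K => (i : Fin p)) Subtype.val_injective).sumElim
    set S := Submodule.span ℝ (range (Sum.elim (fun i : K => a i) fun i : K => b i)) with hS
    have hSr : Module.finrank ℝ S = 2 * K.card := by
      rw [hS, finrank_span_eq_card horth.linearIndependent]
      simp [two_mul]
    have hFS : fixedSpace 𝔱 x ≤ Sᗮ := by
      intro v hv
      have hle : S ≤ (Submodule.span ℝ {v})ᗮ := by
        rw [hS, Submodule.span_le]
        rintro _ ⟨i | i, rfl⟩ <;> refine Submodule.mem_orthogonal_singleton_iff_inner_left.2 ?_ <;>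
        obtain ⟨ξ, hξ, h0, hne⟩ := (hK i).1 i.2 <;>
        have hv0 : ξ v = 0 := hv ξ hξ h0
        · have h1 : - IsNormalForm.weight b a i ξ * inner ℝ (a i) v = 0 := by
            rw [← real_inner_smul_left, ← h.apply_right hξ, hskew ξ hξ, hv0, inner_zero_right,
              neg_zero]
          exact (mul_eq_zero.1 h1).resolve_left (neg_ne_zero.2 hne)
        · have h1 : IsNormalForm.weight b a i ξ * inner ℝ (b i) v = 0 := by
            rw [← real_inner_smul_left, ← h.apply_left hξ, hskew ξ hξ, hv0, inner_zero_right,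
              neg_zero]
          exact (mul_eq_zero.1 h1).resolve_left hne
      rw [Submodule.mem_orthogonal]
      exact fun u hu => Submodule.mem_orthogonal_singleton_iff_inner_left.1 (hle hu)
    have h1 := Submodule.finrank_mono hFS
    have h2 := Submodule.finrank_add_finrank_orthogonal S
    omega
  have hrank : Module.finrank ℝ (orbitTangent 𝔱 x) + Module.finrank ℝ 𝔥 = Module.finrank ℝ 𝔱 := by
    rw [h𝔥, Submodule.finrank_map_subtype_eq]
    exact LinearMap.finrank_range_add_finrank_ker (evalAt 𝔱 x)
  have hslice : Module.finrank ℝ (orbitTangent 𝔱 x) +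
      Module.finrank ℝ (fixedSpace 𝔱 x ⊓ (orbitTangent 𝔱 x)ᗮ : Submodule ℝ V) =
        Module.finrank ℝ (fixedSpace 𝔱 x) := by
    have := Submodule.finrank_add_inf_finrank_orthogonal (orbitTangent_le_fixedSpace hcomm x)
    rwa [inf_comm] at this
  omega

end NormalForm

/-! ### Positive semidefinite forms -/

section Forms

variable {V : Type*} [NormedAddCommGroup V] [NormedSpace ℝ V] {b : V →L[ℝ] V →L[ℝ] ℝ}

theorem form_sq_le (hs : ∀ v w, b v w = b w v) (hp : ∀ v, 0 ≤ b v v) (v w : V) :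
    b v w ^ 2 ≤ b v v * b w w := by
  have h : ∀ t : ℝ, 0 ≤ b w w * (t * t) + 2 * b v w * t + b v v := by
    intro t
    have := hp (v + t • w)
    simp only [map_add, map_smul, FunLike.coe_add, FunLike.coe_smul, Pi.add_apply, Pi.smul_apply,
      smul_eq_mul, hs w v] at this
    linarith
  have := discrim_le_zero h
  rw [discrim] at this
  linarith

theorem sqrt_form_add_le (hs : ∀ v w, b v w = b w v) (hp : ∀ v, 0 ≤ b v v) (v w : V) :
    √(b (v + w) (v + w)) ≤ √(b v v) + √(b w w) := by
  have h1 : b v w ≤ √(b v v) * √(b w w) := by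
    rw [← Real.sqrt_mul (hp v)]
    exact Real.le_sqrt_of_sq_le (form_sq_le hs hp v w)
  refine Real.sqrt_le_iff.2 ⟨by positivity, ?_⟩
  have h2 := Real.sq_sqrt (hp v)
  have h3 := Real.sq_sqrt (hp w)
  simp only [map_add, FunLike.coe_add, Pi.add_apply, hs w v]
  nlinarith

theorem sqrt_form_le (v : V) : √(b v v) ≤ √‖b‖ * ‖v‖ := by
  rw [← Real.sqrt_sq (norm_nonneg v), ← Real.sqrt_mul (norm_nonneg b)]
  refine Real.sqrt_le_sqrt ((le_abs_self _).trans ((b.le_opNorm₂ v v).trans_eq ?_))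
  ring

theorem sqrt_form_smul (c : ℝ) (v : V) : √(b (c • v) (c • v)) = |c| * √(b v v) := by
  have : b (c • v) (c • v) = c ^ 2 * b v v := by
    simp only [map_smul, FunLike.coe_smul, Pi.smul_apply, smul_eq_mul]
    ring
  rw [this, Real.sqrt_mul (sq_nonneg c), Real.sqrt_sq_eq_abs]

theorem exists_forall_form_le {b : V → V →L[ℝ] V →L[ℝ] ℝ} (hb : Continuous b) (x : V) {ε : ℝ}
    (hε : 0 < ε) : ∃ δ : ℝ, 0 < δ ∧ ∀ y ∈ Metric.ball x δ, ∀ v,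
      b y v v ≤ b x v v + ε * ‖v‖ ^ 2 := by
  obtain ⟨δ, hδ, h⟩ := (Metric.continuous_iff (f := b)).1 hb x ε hε
  refine ⟨δ, hδ, fun y hy v => ?_⟩
  have h1 : ‖b y - b x‖ ≤ ε := (dist_eq_norm (b y) (b x)).symm.le.trans (h y hy).le
  have h3 : b y v v - b x v v ≤ ‖b y - b x‖ * ‖v‖ * ‖v‖ :=
    (le_abs_self _).trans ((b y - b x).le_opNorm₂ v v)
  have h4 : ‖b y - b x‖ * ‖v‖ * ‖v‖ ≤ ε * ‖v‖ * ‖v‖ := by gcongr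
  nlinarith

theorem form_le (v : V) : b v v ≤ ‖b‖ * ‖v‖ ^ 2 :=
  (le_abs_self _).trans ((b.le_opNorm₂ v v).trans_eq (by ring))

/-- A first-order bound on a distance function `D`, inserted into the first-order expansion of a
curve, bounds the metric speed by the norm of the velocity. No continuity of `D` is used, so suprema
over many choices are admissible. -/
theorem eventually_le_of_hasDerivWithinAt (hs : ∀ v w, b v w = b w v) (hp : ∀ v, 0 ≤ b v v)
    {D : V → ℝ≥0∞} {k : ℝ → V} {I : Set ℝ} {t : ℝ} {v : V} (hk : HasDerivWithinAt k v I t)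
    (hD : ∀ ε : ℝ, 0 < ε → ∀ᶠ z in 𝓝 (k t), D z ≤
      ENNReal.ofReal (√(b (z - k t) (z - k t)) + ε * ‖z - k t‖)) {ε : ℝ} (hε : 0 < ε) :
    ∀ᶠ s in 𝓝[I] t, D (k s) ≤ ENNReal.ofReal ((√(b v v) + ε) * |s - t|) := by
  set M : ℝ := √‖b‖ with hM
  have hM0 : 0 ≤ M := Real.sqrt_nonneg _
  -- Half of `ε` goes to the error in `D`, using that the displacement is at most `(‖v‖ + 1) |s -
  -- t|`; the other half goes to the Taylor remainder, measured with `M`.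
  set ε₁ : ℝ := ε / (2 * (‖v‖ + 1)) with hε₁
  have hε₁0 : 0 < ε₁ := by positivity
  set ε₂ : ℝ := min 1 (ε / (2 * (M + 1))) with hε₂
  have hε₂0 : 0 < ε₂ := by positivity
  have h1 := hk.continuousWithinAt.eventually (hD ε₁ hε₁0)
  have h2 := hk.isLittleO.bound hε₂0
  filter_upwards [h1, h2] with s hs1 hs2
  refine hs1.trans (ENNReal.ofReal_le_ofReal ?_)
  set e : V := k s - k t - (s - t) • v with he
  have hke : k s - k t = (s - t) • v + e := by rw [he]; abel
  rw [Real.norm_eq_abs] at hs2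
  have h3 : √(b (k s - k t) (k s - k t)) ≤ |s - t| * √(b v v) + M * ‖e‖ := by
    rw [hke]
    refine (sqrt_form_add_le hs hp _ _).trans (add_le_add (sqrt_form_smul _ _).le (sqrt_form_le _))
  have h4 : ‖k s - k t‖ ≤ |s - t| * ‖v‖ + ‖e‖ := by
    rw [hke]
    refine (norm_add_le _ _).trans ?_
    rw [norm_smul, Real.norm_eq_abs]
  have h5 : ‖e‖ ≤ |s - t| := hs2.trans (mul_le_of_le_one_left (abs_nonneg _) (min_le_left _ _))
  have h6 : M * ‖e‖ ≤ ε / 2 * |s - t| := by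
    have : M * ε₂ ≤ ε / 2 := by
      calc M * ε₂ ≤ (M + 1) * (ε / (2 * (M + 1))) := by
            gcongr
            · linarith
            · exact min_le_right _ _
        _ = ε / 2 := by field_simp
    calc M * ‖e‖ ≤ M * (ε₂ * |s - t|) := by gcongr
      _ = M * ε₂ * |s - t| := by ring
      _ ≤ _ := by gcongr
  have h7 : ε₁ * ‖k s - k t‖ ≤ ε / 2 * |s - t| := by
    calc ε₁ * ‖k s - k t‖ ≤ ε₁ * (|s - t| * ‖v‖ + |s - t|) := by gcongr; linarith
      _ = ε / 2 * |s - t| := by rw [hε₁]; field_simp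
  calc _ ≤ (|s - t| * √(b v v) + ε / 2 * |s - t|) + ε / 2 * |s - t| := by linarith
    _ = _ := by ring

end Forms

/-! ### Curves of bounded speed -/

/-- A mean value inequality for curves in a metric space, applied to curves of orbits, which have no
derivative. Wherever the estimate against the primitive of `f + ε` holds it persists slightly to the
right, since that primitive grows faster than the curve can move. -/
theorem edist_le_lintegral_of_speed_le {Y : Type*} [PseudoEMetricSpace Y] {γ : ℝ → Y} {f : ℝ → ℝ}
    (hf : ContinuousOn f (Icc 0 1)) (hf0 : ∀ t ∈ Icc (0 : ℝ) 1, 0 ≤ f t)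
    (h : ∀ t ∈ Icc (0 : ℝ) 1, ∀ ε : ℝ, 0 < ε →
      ∀ᶠ s in 𝓝[Icc 0 1] t, edist (γ t) (γ s) ≤ ENNReal.ofReal ((f t + ε) * |s - t|)) :
    edist (γ 0) (γ 1) ≤ ∫⁻ t in Icc (0 : ℝ) 1, ENNReal.ofReal (f t) := by
  have hγ : ContinuousOn γ (Icc 0 1) := by
    intro t ht
    refine tendsto_iff_edist_tendsto_0.2 ?_
    have h1 : Tendsto (fun s : ℝ => ENNReal.ofReal ((f t + 1) * |s - t|)) (𝓝[Icc 0 1] t) (𝓝 0) := by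
      have : Continuous fun s : ℝ => ENNReal.ofReal ((f t + 1) * |s - t|) :=
        ENNReal.continuous_ofReal.comp (by fun_prop)
      have := this.tendsto t
      simp only [sub_self, abs_zero, mul_zero, ENNReal.ofReal_zero] at this
      exact this.mono_left nhdsWithin_le_nhds
    refine tendsto_of_tendsto_of_tendsto_of_le_of_le' tendsto_const_nhds h1
      (Eventually.of_forall fun _ => zero_le) ?_
    filter_upwards [h t ht 1 one_pos] with s hs
    rwa [edist_comm]
  -- Extending the speed bound continuously to `ℝ` makes its primitive differentiable at the end
  -- points as well.
  set F : ℝ → ℝ := IccExtend zero_le_one (fun t : Icc (0 : ℝ) 1 => f t) with hF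
  have hFc : Continuous F := continuous_IccExtend_iff.2 (continuousOn_iff_continuous_domRestrict.1 hf)
  have hFf : ∀ t ∈ Icc (0 : ℝ) 1, F t = f t := fun t ht => IccExtend_of_mem _ _ ht
  have hF0 : ∀ t, 0 ≤ F t := fun t => hf0 _ (projIcc 0 1 zero_le_one t).2
  have main : ∀ ε : ℝ, 0 < ε →
      edist (γ 0) (γ 1) ≤ ENNReal.ofReal (∫ t in (0 : ℝ)..1, (F t + ε)) := by
    intro ε hε
    set Φ : ℝ → ℝ := fun t => ∫ s in (0 : ℝ)..t, (F s + ε) with hΦ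
    have hFε : Continuous fun t => F t + ε := hFc.add continuous_const
    have hΦd : ∀ t, HasDerivAt Φ (F t + ε) t := fun t =>
      (hFε.integral_hasStrictDerivAt 0 t).hasDerivAt
    have hΦc : Continuous Φ := continuous_iff_continuousAt.2 fun t => (hΦd t).continuousAt
    have hΦ0 : ∀ t, 0 ≤ t → 0 ≤ Φ t := fun t ht =>
      intervalIntegral.integral_nonneg ht fun s _ => add_nonneg (hF0 s) hε.le
    have hsub : Icc (0 : ℝ) 1 ⊆ {t | edist (γ 0) (γ t) ≤ ENNReal.ofReal (Φ t)} := by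
      refine IsClosed.Icc_subset_of_forall_exists_gt ?_ ?_ ?_
      · rw [inter_comm]
        refine isClosed_Icc.isClosed_le (f := fun t => edist (γ 0) (γ t)) ?_ ?_
        · exact (continuous_const.edist continuous_id).comp_continuousOn hγ
        · exact (ENNReal.continuous_ofReal.comp hΦc).continuousOn
      · simp
      · rintro t ⟨htS, ht⟩ u (hu : t < u)
        have htI : t ∈ Icc (0 : ℝ) 1 := Ico_subset_Icc_self ht
        have h1 : ∀ᶠ s in 𝓝[>] t, edist (γ t) (γ s) ≤
            ENNReal.ofReal ((f t + ε / 2) * |s - t|) := by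
          have hle : 𝓝[>] t ≤ 𝓝[Icc 0 1] t := by
            rw [← nhdsWithin_Ioo_eq_nhdsGT ht.2]
            exact nhdsWithin_mono _ fun s hs => ⟨ht.1.trans hs.1.le, hs.2.le⟩
          exact hle (h t htI (ε / 2) (by positivity))
        have h2 : ∀ᶠ s in 𝓝[>] t, F t + ε / 2 < slope Φ t s := by
          have := (hΦd t).tendsto_slope.mono_left
            (nhdsWithin_mono t fun s (hs : t < s) => ne_of_gt hs)
          exact this.eventually (lt_mem_nhds (by linarith))
        have h3 : ∀ᶠ s in 𝓝[>] t, s ∈ Ioc t u := Ioc_mem_nhdsGT hu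
        obtain ⟨s, hs1, hs2, hs3⟩ := (h1.and (h2.and h3)).exists
        refine ⟨s, ?_, hs3⟩
        have hst : 0 < s - t := sub_pos.2 hs3.1
        have h4 : (f t + ε / 2) * |s - t| ≤ Φ s - Φ t := by
          rw [slope_def_field, lt_div_iff₀ hst, hFf t htI] at hs2
          rw [abs_of_pos hst]
          exact hs2.le
        change edist (γ 0) (γ s) ≤ _
        calc edist (γ 0) (γ s) ≤ edist (γ 0) (γ t) + edist (γ t) (γ s) := edist_triangle _ _ _
          _ ≤ ENNReal.ofReal (Φ t) + ENNReal.ofReal (Φ s - Φ t) :=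
              add_le_add htS (hs1.trans (ENNReal.ofReal_le_ofReal h4))
          _ = ENNReal.ofReal (Φ s) := by
              rw [← ENNReal.ofReal_add (hΦ0 t ht.1)]
              · congr 1; ring
              · refine le_trans ?_ h4
                have := hf0 t htI
                positivity
    exact hsub (right_mem_Icc.2 zero_le_one)
  have hint : ∫⁻ t in Icc (0 : ℝ) 1, ENNReal.ofReal (f t) =
      ENNReal.ofReal (∫ t in (0 : ℝ)..1, F t) := by
    rw [intervalIntegral.integral_of_le zero_le_one, ← integral_Icc_eq_integral_Ioc,
      ofReal_integral_eq_lintegral_ofReal]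
    · exact setLIntegral_congr_fun measurableSet_Icc fun t ht => by simp only [hFf t ht]
    · exact hFc.continuousOn.integrableOn_compact isCompact_Icc
    · exact Eventually.of_forall hF0
  rw [hint]
  have hlim : Tendsto (fun ε : ℝ => ENNReal.ofReal (∫ t in (0 : ℝ)..1, (F t + ε))) (𝓝[>] 0)
      (𝓝 (ENNReal.ofReal (∫ t in (0 : ℝ)..1, F t))) := by
    have h1 : (fun ε : ℝ => ENNReal.ofReal (∫ t in (0 : ℝ)..1, (F t + ε))) =
        fun ε => ENNReal.ofReal ((∫ t in (0 : ℝ)..1, F t) + ε) := by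
      funext ε
      rw [intervalIntegral.integral_add (hFc.intervalIntegrable _ _)
        (continuous_const.intervalIntegrable _ _)]
      simp
    rw [h1]
    have : Continuous fun ε => ENNReal.ofReal ((∫ t in (0 : ℝ)..1, F t) + ε) :=
      ENNReal.continuous_ofReal.comp (by fun_prop)
    have := this.tendsto 0
    rw [add_zero] at this
    exact this.mono_left nhdsWithin_le_nhds
  exact ge_of_tendsto hlim (by filter_upwards [self_mem_nhdsWithin] with ε hε using main ε hε)

/-! ### Local estimates for the Riemannian distance -/

namespace CkMetric

variable {k : ℕ∞} {α : ℝ≥0} {m : ℕ} (g : CkMetric k α m)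

theorem riemDist_le_of_curve {c : ℝ → Eucl m} (hc : ContDiffOn ℝ 1 c (Icc 0 1)) :
    g.riemDist (c 0) (c 1) ≤ ∫⁻ t in Icc (0 : ℝ) 1, ENNReal.ofReal
        (√(g (c t) (derivWithin c (Icc 0 1) t) (derivWithin c (Icc 0 1) t))) :=
  le_of_forall_gt fun r hr => (g.riemDist_lt_iff _ _ r).2 ⟨c, rfl, rfl, hc, hr⟩

theorem riemDist_curve_le {c : ℝ → Eucl m} (hc : ContDiffOn ℝ 1 c (Icc 0 1)) {t : ℝ}
    (ht : t ∈ Icc (0 : ℝ) 1) :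
    g.riemDist (c 0) (c t) ≤ ∫⁻ t in Icc (0 : ℝ) 1, ENNReal.ofReal
        (√(g (c t) (derivWithin c (Icc 0 1) t) (derivWithin c (Icc 0 1) t))) := by
  let := g.tangentENorm
  have := g.enormSMul
  have key : pathELength 𝓘(ℝ, Eucl m) c 0 1 =
      ∫⁻ t in Icc (0 : ℝ) 1, ENNReal.ofReal
        (√(g (c t) (derivWithin c (Icc 0 1) t) (derivWithin c (Icc 0 1) t))) := by
    rw [pathELength_eq_lintegral_mfderivWithin_Icc]
    simp only [mfderivWithin_eq_fderivWithin]
    rfl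
  rw [← key]
  exact (riemannianEDist_le_pathELength (contMDiffOn_iff_contDiffOn.2
    (hc.mono (Icc_subset_Icc_right ht.2))) rfl rfl ht.1).trans (pathELength_mono le_rfl ht.2)

theorem riemDist_le_of_segment {x y : Eucl m} {B : ℝ}
    (h : ∀ t ∈ Icc (0 : ℝ) 1, √(g (x + t • (y - x)) (y - x) (y - x)) ≤ B) :
    g.riemDist x y ≤ ENNReal.ofReal B := by
  have hd : ∀ t : ℝ, HasDerivAt (fun t : ℝ => x + t • (y - x)) (y - x) t := by
    intro t
    have := ((hasDerivAt_id t).smul_const (y - x)).const_add x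
    rwa [one_smul] at this
  have hc : ContDiff ℝ 1 (fun t : ℝ => x + t • (y - x)) :=
    contDiff_const.add (contDiff_id.smul contDiff_const)
  have := g.riemDist_le_of_curve hc.contDiffOn
  simp only [zero_smul, add_zero, one_smul, add_sub_cancel] at this
  refine this.trans ?_
  calc _ ≤ ∫⁻ t in Icc (0 : ℝ) 1, ENNReal.ofReal B := by
        refine setLIntegral_mono' measurableSet_Icc fun t ht => ?_
        rw [(hd t).hasDerivWithinAt.derivWithin (uniqueDiffOn_Icc zero_lt_one t ht)]
        exact ENNReal.ofReal_le_ofReal (h t ht)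
    _ = _ := by simp

theorem eventually_riemDist_le (y : Eucl m) {ε : ℝ} (hε : 0 < ε) :
    ∀ᶠ z in 𝓝 y, g.riemDist y z ≤ ENNReal.ofReal (√(g y (z - y) (z - y)) + ε * ‖z - y‖) := by
  -- The error is `ε ^ 2` because `√(A + ε² ‖w‖²) ≤ √A + ε ‖w‖`.
  obtain ⟨δ, hδ, hb⟩ := exists_forall_form_le g.continuous y (ε := ε ^ 2) (by positivity)
  filter_upwards [Metric.ball_mem_nhds y hδ] with z hz
  refine g.riemDist_le_of_segment fun t ht => ?_
  have h2 := hb _ ((convex_ball y δ).add_smul_sub_mem (Metric.mem_ball_self hδ) hz ht) (z - y)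
  set w := z - y
  refine Real.sqrt_le_iff.2 ⟨by positivity, h2.trans ?_⟩
  have h5 := Real.sq_sqrt (g.nonneg y w)
  have h6 : 0 ≤ √(g y w w) * (ε * ‖w‖) := by positivity
  nlinarith

theorem exists_riemDist_le_mul (x : Eucl m) : ∃ C : ℝ≥0, ∃ U ∈ 𝓝 x, ∀ y ∈ U, ∀ z ∈ U,
    g.riemDist y z ≤ C * edist y z := by
  obtain ⟨δ, hδ, hb⟩ := exists_forall_form_le g.continuous x one_pos
  refine ⟨(√(‖g x‖ + 1)).toNNReal, Metric.ball x δ, Metric.ball_mem_nhds x hδ,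
    fun y hy z hz => ?_⟩
  have := g.riemDist_le_of_segment (x := y) (y := z) (B := √(‖g x‖ + 1) * dist y z) fun t ht => ?_
  · rwa [ENNReal.ofReal_mul (Real.sqrt_nonneg _), ← edist_dist] at this
  · have h1 := hb _ ((convex_ball x δ).add_smul_sub_mem hy hz ht) (z - y)
    have h2 : g x (z - y) (z - y) ≤ ‖g x‖ * ‖z - y‖ ^ 2 := form_le (b := g x) (z - y)
    rw [dist_comm, dist_eq_norm, ← Real.sqrt_sq (norm_nonneg (z - y)),
      ← Real.sqrt_mul (by positivity)]
    exact Real.sqrt_le_sqrt (by linarith)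

/-- A curve that leaves the closed ball has Riemannian length at least `a * δ` up to its first
arrival at the sphere. -/
theorem dist_le_of_riemDist_lt {x y : Eucl m} {a δ : ℝ} (ha : 0 < a) (hδ : 0 < δ)
    (hb : ∀ y ∈ Metric.closedBall x δ, ∀ v, a * ‖v‖ ≤ √(g y v v))
    (hy : g.riemDist x y < ENNReal.ofReal (a * δ)) : dist y x ≤ δ := by
  by_contra hyn
  obtain ⟨c, h0, h1, hc, hl⟩ := (g.riemDist_lt_iff x y _).1 hy
  have hdist : ContinuousOn (fun t => dist (c t) x) (Icc 0 1) :=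
    (continuous_id.dist continuous_const).comp_continuousOn hc.continuousOn
  obtain ⟨t₁, ht₁, hmin⟩ : ∃ t ∈ {t ∈ Icc (0 : ℝ) 1 | δ ≤ dist (c t) x},
      ∀ u ∈ {t ∈ Icc (0 : ℝ) 1 | δ ≤ dist (c t) x}, t ≤ u := by
    have hclosed : IsClosed {t ∈ Icc (0 : ℝ) 1 | δ ≤ dist (c t) x} :=
      hdist.preimage_isClosed_of_isClosed isClosed_Icc isClosed_Ici
    have hcomp : IsCompact {t ∈ Icc (0 : ℝ) 1 | δ ≤ dist (c t) x} :=
      isCompact_Icc.of_isClosed_subset hclosed fun t ht => ht.1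
    refine (hcomp.exists_isLeast ⟨1, ⟨by simp, ?_⟩⟩).imp fun t ht => ⟨ht.1, fun u hu => ht.2 hu⟩
    rw [h1]
    exact (not_le.1 hyn).le
  have ht₁0 : 0 < t₁ := by
    rcases ht₁.1.1.eq_or_lt with h | h
    · have := ht₁.2
      rw [← h, h0, dist_self] at this
      linarith
    · exact h
  have hsub : Icc 0 t₁ ⊆ Icc (0 : ℝ) 1 := Icc_subset_Icc_right ht₁.1.2
  have hball : ∀ t ∈ Ico 0 t₁, c t ∈ Metric.closedBall x δ := by
    intro t ht
    by_contra h
    exact absurd (hmin t ⟨⟨ht.1, ht.2.le.trans ht₁.1.2⟩, (not_le.1 h).le⟩) (not_le.2 ht.2)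
  refine absurd hl (not_lt.2 ?_)
  calc ENNReal.ofReal (a * δ) = ENNReal.ofReal a * ENNReal.ofReal δ := ENNReal.ofReal_mul ha.le
    _ ≤ ENNReal.ofReal a * ‖c t₁ - c 0‖ₑ := by
        gcongr
        rw [h0, ← ofReal_norm, ← dist_eq_norm]
        exact ENNReal.ofReal_le_ofReal ht₁.2
    _ ≤ ENNReal.ofReal a * ∫⁻ t in Icc 0 t₁, ‖derivWithin c (Icc 0 t₁) t‖ₑ := by
        gcongr
        exact enorm_sub_le_lintegral_derivWithin_Icc_of_contDiffOn_Icc (hc.mono hsub) ht₁0.le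
    _ = ∫⁻ t in Ico 0 t₁, ENNReal.ofReal a * ‖derivWithin c (Icc 0 t₁) t‖ₑ := by
        rw [restrict_Ico_eq_restrict_Icc, lintegral_const_mul' _ _ ENNReal.ofReal_ne_top]
    _ ≤ ∫⁻ t in Ico 0 t₁, ENNReal.ofReal
        (√(g (c t) (derivWithin c (Icc 0 1) t) (derivWithin c (Icc 0 1) t))) := by
        refine setLIntegral_mono' measurableSet_Ico fun t ht => ?_
        have ht' : t ∈ Icc 0 t₁ := Ico_subset_Icc_self ht
        rw [derivWithin_subset hsub (uniqueDiffOn_Icc ht₁0 t ht')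
          (hc.differentiableOn one_ne_zero t (hsub ht')), ← ofReal_norm, ← ENNReal.ofReal_mul ha.le]
        exact ENNReal.ofReal_le_ofReal (hb _ (hball t ht) _)
    _ ≤ _ := lintegral_mono_set (Ico_subset_Icc_self.trans hsub)

/-- Locally, the Euclidean distance is bounded by a multiple of the Riemannian one. -/
theorem exists_edist_le_mul (x : Eucl m) : ∃ C : ℝ≥0, ∃ δ : ℝ, 0 < δ ∧
    ∀ y ∈ Metric.ball x δ, ∀ z, edist y z < ENNReal.ofReal δ → edist y z ≤ C * g.riemDist y z := by
  -- The ball of radius `2` contains the unit balls about all points of the unit ball.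
  obtain ⟨a, ha, hb⟩ := g.exists_lower_bound (isCompact_closedBall x 2)
  refine ⟨a⁻¹.toNNReal, 1, one_pos, fun y hy z hyz => ?_⟩
  rw [edist_dist, ENNReal.ofReal_lt_ofReal_iff one_pos] at hyz
  by_contra! hlt
  have h0 : 0 < dist y z := by
    have := (zero_le (a := _)).trans_lt hlt
    rwa [edist_dist, ENNReal.ofReal_pos] at this
  have h1 : g.riemDist y z < ENNReal.ofReal (a * dist y z) := by
    rw [ENNReal.ofReal_mul ha.le, ← edist_dist]
    rw [ENNReal.ofNNReal_toNNReal, ENNReal.ofReal_inv_of_pos ha, mul_comm, ← div_eq_mul_inv,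
      ENNReal.div_lt_iff (Or.inl (by simpa using ha)) (Or.inl ENNReal.ofReal_ne_top)] at hlt
    rwa [mul_comm]
  -- A radius slightly below `dist y z` still satisfies the strict inequality, and then `dist y z ≤
  -- δ'` is absurd.
  obtain ⟨δ', hδ'0, hδ', hlt'⟩ : ∃ δ' : ℝ, 0 < δ' ∧ δ' < dist y z ∧
      g.riemDist y z < ENNReal.ofReal (a * δ') := by
    have hc : Continuous fun δ' : ℝ => ENNReal.ofReal (a * δ') :=
      ENNReal.continuous_ofReal.comp (by fun_prop)
    have h2 : ∀ᶠ δ' in 𝓝[<] (dist y z), g.riemDist y z < ENNReal.ofReal (a * δ') :=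
      (hc.tendsto _).mono_left nhdsWithin_le_nhds |>.eventually (lt_mem_nhds h1)
    have h3 : ∀ᶠ δ' in 𝓝[<] (dist y z), 0 < δ' :=
      nhdsWithin_le_nhds (lt_mem_nhds h0)
    obtain ⟨δ', h4, h5, h6⟩ := (h2.and (h3.and self_mem_nhdsWithin)).exists
    exact ⟨δ', h5, h6, h4⟩
  have := g.dist_le_of_riemDist_lt ha hδ'0 (fun w hw v => hb w ?_ v) hlt'
  · rw [dist_comm] at this
    linarith
  · have h7 := Metric.mem_closedBall.1 hw
    have h8 := Metric.mem_ball.1 hy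
    have := dist_triangle w y x
    exact Metric.mem_closedBall.2 (by linarith)

end CkMetric

/-! ### The slice at a good point -/

section Slice

variable {V : Type*} [NormedAddCommGroup V] [InnerProductSpace ℝ V] [CompleteSpace V]
  [FiniteDimensional ℝ V]

theorem expE_smul_apply_of_apply_eq_zero {ξ : V →L[ℝ] V} {x : V} (h : ξ x = 0) (t : ℝ) :
    expE (t • ξ) x = x := by
  have hd : ∀ t : ℝ, HasDerivAt (fun t : ℝ => expE (t • ξ) x) 0 t := fun t => by
    have := hasDerivAt_expE_smul_apply ξ t x
    rwa [h, map_zero] at this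
  have := is_const_of_deriv_eq_zero (fun t => (hd t).differentiableAt) (fun t => (hd t).deriv) t 0
  rwa [zero_smul, expE_zero] at this

theorem expE_apply_of_apply_eq_zero {ξ : V →L[ℝ] V} {x : V} (h : ξ x = 0) : expE ξ x = x := by
  have := expE_smul_apply_of_apply_eq_zero h 1
  rwa [one_smul] at this

/-- The first-order condition at a maximum along a one-parameter group. Maximizing over compact
subgroups and applying this condition is how points are moved into normal position below. -/
theorem inner_apply_eq_zero_of_isMax {ξ : V →L[ℝ] V} {v w : V}
    (h : ∀ t : ℝ, inner ℝ (expE (t • ξ) v) w ≤ inner ℝ v w) : inner ℝ (ξ v) w = 0 := by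
  have hd : HasDerivAt (fun t : ℝ => inner ℝ (expE (t • ξ) v) w) (inner ℝ (ξ v) w) 0 := by
    have := (hasDerivAt_expE_smul_apply_zero ξ v).inner ℝ (hasDerivAt_const (0 : ℝ) w)
    simpa using this
  refine IsLocalMax.hasDerivAt_eq_zero (Eventually.of_forall fun t => ?_) hd
  simpa [expE_zero] using h t

theorem continuous_unitary_apply (v : V) :
    Continuous fun A : unitary (V →L[ℝ] V) => (A : V →L[ℝ] V) v :=
  continuous_subtype_val.clm_apply continuous_const

theorem inner_unitary_left (A : unitary (V →L[ℝ] V)) (v w : V) :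
    inner ℝ (A.1 v) w = inner ℝ v (A⁻¹.1 w) := by
  rw [← inner_unitary_apply A v, unitary_apply_inv_apply]

theorem inner_unitary_right (A : unitary (V →L[ℝ] V)) (v w : V) :
    inner ℝ v (A.1 w) = inner ℝ (A⁻¹.1 v) w := by
  rw [real_inner_comm, inner_unitary_left, real_inner_comm]

namespace IsAbelianLieAlgebra

variable {G : Subgroup (unitary (V →L[ℝ] V))} {𝔱 : Submodule ℝ (V →L[ℝ] V)}

theorem comm_apply (h : IsAbelianLieAlgebra G 𝔱) {ξ η : V →L[ℝ] V} (hξ : ξ ∈ 𝔱) (hη : η ∈ 𝔱)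
    (v : V) : ξ (η v) = η (ξ v) :=
  congrArg (fun F : V →L[ℝ] V => F v) (h.comm ξ hξ η hη)

/-- Conjugation `A⁻¹ ξ A` of an element of the Lie algebra. -/
theorem exists_conj (h : IsAbelianLieAlgebra G 𝔱) {A : unitary (V →L[ℝ] V)} (hA : A ∈ G)
    {ξ : V →L[ℝ] V} (hξ : ξ ∈ 𝔱) : ∃ η ∈ 𝔱, ∀ v, A.1 (η v) = ξ (A.1 v) := by
  refine ⟨_, h.conj_mem (G.inv_mem hA) hξ, fun v => ?_⟩
  change A.1 (A⁻¹.1 (ξ (A⁻¹⁻¹.1 v))) = _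
  rw [inv_inv, unitary_apply_inv_apply]

theorem exists_conj' (h : IsAbelianLieAlgebra G 𝔱) {A : unitary (V →L[ℝ] V)} (hA : A ∈ G)
    {ξ : V →L[ℝ] V} (hξ : ξ ∈ 𝔱) : ∃ η ∈ 𝔱, ∀ v, A.1 (ξ v) = η (A.1 v) := by
  refine ⟨_, h.conj_mem hA hξ, fun v => ?_⟩
  change _ = A.1 (ξ (A⁻¹.1 (A.1 v)))
  rw [unitary_inv_apply_apply]

theorem apply_mem_orbitTangent (h : IsAbelianLieAlgebra G 𝔱) {A : unitary (V →L[ℝ] V)}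
    (hA : A ∈ G) {x v : V} (hv : v ∈ orbitTangent 𝔱 x) : A.1 v ∈ orbitTangent 𝔱 (A.1 x) := by
  obtain ⟨ξ, hξ, rfl⟩ := mem_orbitTangent.1 hv
  obtain ⟨η, hη, he⟩ := h.exists_conj' hA hξ
  exact mem_orbitTangent.2 ⟨η, hη, (he x).symm⟩

theorem apply_mem_orbitTangent_orthogonal (h : IsAbelianLieAlgebra G 𝔱)
    {A : unitary (V →L[ℝ] V)} (hA : A ∈ G) {x v : V} (hAx : A.1 x = x)
    (hv : v ∈ (orbitTangent 𝔱 x)ᗮ) : A.1 v ∈ (orbitTangent 𝔱 x)ᗮ := by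
  rw [Submodule.mem_orthogonal] at hv ⊢
  intro w hw
  have h1 := h.apply_mem_orbitTangent (G.inv_mem hA) hw
  have h2 : A⁻¹.1 x = x := by
    conv_lhs => rw [← hAx]
    exact unitary_inv_apply_apply A x
  rw [h2] at h1
  rw [inner_unitary_right]
  exact hv _ h1

/-- Compactness: outside a neighbourhood of the pairs with `C y = z`, the distance of `A y` and `z`
is bounded below. So an approximate incidence `A y ≈ z ∈ K` is a small Lie algebra motion away from
an exact one, `C y ∈ K`. -/
theorem exists_mul_of_near (h : IsAbelianLieAlgebra G 𝔱)
    (hG : IsCompact (G : Set (unitary (V →L[ℝ] V)))) (y : V) {K : Set V} (hK : IsCompact K)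
    {η : ℝ} (hη : 0 < η) : ∃ ρ : ℝ, 0 < ρ ∧ ∀ A ∈ G, ∀ z ∈ K, ‖A.1 y - z‖ < ρ →
      ∃ ξ ∈ 𝔱, ∃ C ∈ G, ‖ξ‖ < η ∧ (A : V →L[ℝ] V) = expE ξ * C.1 ∧ C.1 y ∈ K ∧
        ‖C.1 y - z‖ < η := by
  have hnear := h.near_one η hη
  rw [eventually_nhdsWithin_iff, eventually_nhds_iff] at hnear
  obtain ⟨O, hO, hOo, h1O⟩ := hnear
  let Z : Set (unitary (V →L[ℝ] V) × V) := {p | p.1 ∈ G ∧ p.2 ∈ K ∧ p.1.1 y = p.2}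
  let U : Set (unitary (V →L[ℝ] V) × V) :=
    ⋃ q ∈ Z, {p | p.1 * q.1⁻¹ ∈ O ∧ ‖q.2 - p.2‖ < η}
  have hU : IsOpen U := by
    refine isOpen_biUnion fun q _ => IsOpen.inter ?_ ?_
    · exact hOo.preimage (continuous_fst.mul continuous_const)
    · exact isOpen_lt (continuous_const.sub continuous_snd).norm continuous_const
  have hf : Continuous fun p : unitary (V →L[ℝ] V) × V => ‖p.1.1 y - p.2‖ :=
    (((continuous_unitary_apply y).comp continuous_fst).sub continuous_snd).norm
  have hcomp : IsCompact (((G : Set (unitary (V →L[ℝ] V))) ×ˢ K) \ U) := (hG.prod hK).diff hU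
  have hpos : ∃ ρ : ℝ, 0 < ρ ∧
      ∀ p ∈ ((G : Set (unitary (V →L[ℝ] V))) ×ˢ K) \ U, ρ ≤ ‖p.1.1 y - p.2‖ := by
    rcases ((((G : Set (unitary (V →L[ℝ] V))) ×ˢ K) \ U)).eq_empty_or_nonempty with he | hne
    · exact ⟨1, one_pos, by simp [he]⟩
    · obtain ⟨p, hp, hmin⟩ := hcomp.exists_isMinOn hne hf.continuousOn
      refine ⟨_, norm_pos_iff.2 fun h0 => hp.2 ?_, fun q hq => hmin hq⟩
      refine mem_biUnion (x := p) ⟨hp.1.1, hp.1.2, sub_eq_zero.1 h0⟩ ⟨?_, ?_⟩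
      · rwa [mul_inv_cancel]
      · simpa using hη
  obtain ⟨ρ, hρ, hb⟩ := hpos
  refine ⟨ρ, hρ, fun A hA z hz hlt => ?_⟩
  have hmem : (A, z) ∈ U := by
    by_contra hn
    exact absurd (hb (A, z) ⟨⟨hA, hz⟩, hn⟩) (not_le.2 hlt)
  obtain ⟨⟨C, z'⟩, ⟨hC, hz', hCy⟩, hACO, hzz⟩ := mem_iUnion₂.1 hmem
  obtain ⟨ξ, hξ, hn, he⟩ := hO _ hACO (G.mul_mem hA (G.inv_mem hC))
  refine ⟨ξ, hξ, C, hC, hn, ?_, ?_, ?_⟩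
  · rw [← he]
    change A.1 = (A * C⁻¹ * C : unitary (V →L[ℝ] V)).1
    rw [inv_mul_cancel_right]
  · rwa [show C.1 y = z' from hCy]
  · rwa [show C.1 y = z' from hCy]

end IsAbelianLieAlgebra

variable {ι : Type} [Fintype ι]

/-- The hypotheses under which a slice is constructed at `x`: the stabilizer of `x` in the Lie
algebra `𝔱` of the compact group `G` is spanned by rotations of the planes of `(a j, b j)`. -/
structure SliceData (G : Subgroup (unitary (V →L[ℝ] V))) (𝔱 : Submodule ℝ (V →L[ℝ] V)) (x : V)
    (a b : ι → V) : Prop where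
  compact : IsCompact (G : Set (unitary (V →L[ℝ] V)))
  lie : IsAbelianLieAlgebra G 𝔱
  planes : OrthoPlanes a b
  rot_mem : ∀ j, rot (a j) (b j) ∈ 𝔱
  rot_apply_self : ∀ j, rot (a j) (b j) x = 0
  mem_span : ∀ ξ ∈ 𝔱, ξ x = 0 → ξ ∈ Submodule.span ℝ (range fun j => rot (a j) (b j))

/-- The space of the vectors normal to the orbit of `x` and to the `b j`. -/
def sliceSpace (𝔱 : Submodule ℝ (V →L[ℝ] V)) (x : V) (b : ι → V) : Submodule ℝ V :=
  (orbitTangent 𝔱 x ⊔ Submodule.span ℝ (range b))ᗮ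

variable {G : Subgroup (unitary (V →L[ℝ] V))} {𝔱 : Submodule ℝ (V →L[ℝ] V)} {x : V} {a b : ι → V}

theorem mem_sliceSpace {u : V} : u ∈ sliceSpace 𝔱 x b ↔
    u ∈ (orbitTangent 𝔱 x)ᗮ ∧ u ∈ (Submodule.span ℝ (range b))ᗮ := by
  rw [sliceSpace, ← Submodule.inf_orthogonal, Submodule.mem_inf]

theorem mem_span_orthogonal {u : V} {b : ι → V} :
    u ∈ (Submodule.span ℝ (range b))ᗮ ↔ ∀ j, inner ℝ (b j) u = 0 := by
  constructor
  · exact fun h j => (Submodule.mem_orthogonal _ _).1 h _ (Submodule.subset_span ⟨j, rfl⟩)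
  · intro h
    have hle : Submodule.span ℝ (range b) ≤ (Submodule.span ℝ {u})ᗮ := by
      rw [Submodule.span_le]
      rintro _ ⟨j, rfl⟩
      exact Submodule.mem_orthogonal_singleton_iff_inner_left.2 (h j)
    rw [Submodule.mem_orthogonal]
    exact fun v hv => Submodule.mem_orthogonal_singleton_iff_inner_left.1 (hle hv)

theorem mem_orbitTangent_orthogonal {u : V} :
    u ∈ (orbitTangent 𝔱 x)ᗮ ↔ ∀ ξ ∈ 𝔱, inner ℝ (ξ x) u = 0 := by
  rw [Submodule.mem_orthogonal]
  constructor
  · exact fun h ξ hξ => h _ (mem_orbitTangent.2 ⟨ξ, hξ, rfl⟩)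
  · intro h v hv
    obtain ⟨ξ, hξ, rfl⟩ := mem_orbitTangent.1 hv
    exact h ξ hξ

/-- The subgroup of `G` that fixes `x` and preserves the subspace `S`. -/
def sliceStabilizer (G : Subgroup (unitary (V →L[ℝ] V))) (x : V) (S : Submodule ℝ V) :
    Subgroup (unitary (V →L[ℝ] V)) where
  carrier := {A | A ∈ G ∧ A.1 x = x ∧ ∀ u, A.1 u ∈ S ↔ u ∈ S}
  mul_mem' {A B} hA hB := ⟨G.mul_mem hA.1 hB.1, by
    change A.1 (B.1 x) = x
    rw [hB.2.1, hA.2.1], fun u => (hA.2.2 _).trans (hB.2.2 u)⟩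
  one_mem' := ⟨G.one_mem, rfl, fun _ => Iff.rfl⟩
  inv_mem' {A} hA := ⟨G.inv_mem hA.1, by
    conv_lhs => rw [← hA.2.1]
    exact unitary_inv_apply_apply A x, fun u => by
    rw [← hA.2.2, unitary_apply_inv_apply]⟩

theorem mem_sliceStabilizer {S : Submodule ℝ V} {A : unitary (V →L[ℝ] V)} :
    A ∈ sliceStabilizer G x S ↔ A ∈ G ∧ A.1 x = x ∧ ∀ u, A.1 u ∈ S ↔ u ∈ S := Iff.rfl

namespace SliceData

theorem skew (h : SliceData G 𝔱 x a b) {ξ : V →L[ℝ] V} (hξ : ξ ∈ 𝔱) (v w : V) :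
    inner ℝ (ξ v) w = - inner ℝ v (ξ w) := h.lie.skew ξ hξ v w

/-- `b j` is the image of `a j` under a rotation that commutes with `𝔱` and kills `x`, hence kills
the tangent space of the orbit; skewness does the rest. -/
theorem right_mem (h : SliceData G 𝔱 x a b) (j : ι) : b j ∈ (orbitTangent 𝔱 x)ᗮ := by
  refine mem_orbitTangent_orthogonal.2 fun ξ hξ => ?_
  rw [← h.planes.rot_left j, ← neg_neg (inner ℝ _ _), ← h.skew (h.rot_mem j),
    h.lie.comm_apply (h.rot_mem j) hξ, h.rot_apply_self, map_zero, inner_zero_left, neg_zero]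

theorem span_le (h : SliceData G 𝔱 x a b) :
    Submodule.span ℝ (range b) ≤ (orbitTangent 𝔱 x)ᗮ := by
  rw [Submodule.span_le]
  rintro _ ⟨j, rfl⟩
  exact h.right_mem j

theorem left_mem (h : SliceData G 𝔱 x a b) (j : ι) : a j ∈ sliceSpace 𝔱 x b := by
  refine mem_sliceSpace.2 ⟨mem_orbitTangent_orthogonal.2 fun ξ hξ => ?_,
    mem_span_orthogonal.2 fun i => h.planes.ortho' i j⟩
  rw [← neg_neg (a j), ← h.planes.rot_right j, inner_neg_right, ← h.skew (h.rot_mem j),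
    h.lie.comm_apply (h.rot_mem j) hξ, h.rot_apply_self, map_zero, inner_zero_left]

theorem rot_apply_of_mem (_h : SliceData G 𝔱 x a b) {u : V} (hu : u ∈ sliceSpace 𝔱 x b) (j : ι) :
    rot (a j) (b j) u = inner ℝ (a j) u • b j := by
  rw [rot_apply, mem_span_orthogonal.1 (mem_sliceSpace.1 hu).2 j, zero_smul, sub_zero]

/-- The slice representation of the stabilizer is polar. -/
theorem apply_mem_span (h : SliceData G 𝔱 x a b) {u : V} (hu : u ∈ sliceSpace 𝔱 x b)
    {ξ : V →L[ℝ] V} (hξ : ξ ∈ 𝔱) (hx : ξ x = 0) : ξ u ∈ Submodule.span ℝ (range b) := by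
  obtain ⟨c, rfl⟩ := (Submodule.mem_span_range_iff_exists_fun ℝ).1 (h.mem_span ξ hξ hx)
  rw [sum_apply]
  refine Submodule.sum_mem _ fun j _ => ?_
  rw [FunLike.coe_smul, Pi.smul_apply, h.rot_apply_of_mem hu]
  exact Submodule.smul_mem _ _ (Submodule.smul_mem _ _ (Submodule.subset_span ⟨j, rfl⟩))

/-- The vector `∑ j, a j` has a component in every plane and serves as a reference direction: each
rotation sends it to `b j`, so a vector that is critical for its inner product with it under all
rotations is orthogonal to every `b j`. -/
theorem sum_left_mem (h : SliceData G 𝔱 x a b) : ∑ j, a j ∈ sliceSpace 𝔱 x b :=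
  Submodule.sum_mem _ fun j _ => h.left_mem j

theorem rot_sum_left (h : SliceData G 𝔱 x a b) (j : ι) : rot (a j) (b j) (∑ i, a i) = b j := by
  rw [map_sum, Finset.sum_eq_single j (fun i _ hi => h.planes.rot_left_of_ne hi.symm) (by simp),
    h.planes.rot_left]

/-- Every orbit meets the slice. -/
theorem exists_sub_mem_sliceSpace (h : SliceData G 𝔱 x a b) (z : V) :
    ∃ A ∈ G, A.1 z - x ∈ sliceSpace 𝔱 x b ∧ ‖A.1 z - x‖ ≤ ‖z - x‖ := by
  -- Maximizing the inner product with `x` selects a point of the orbit nearest to `x`; it makes the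
  -- difference normal to the orbit of `x`.
  obtain ⟨A, hA, hmax⟩ := h.compact.exists_isMaxOn ⟨1, G.one_mem⟩
    (f := fun A : unitary (V →L[ℝ] V) => inner ℝ (A.1 z) x)
    ((continuous_unitary_apply z).inner continuous_const).continuousOn
  have hcomp : IsCompact ((G : Set (unitary (V →L[ℝ] V))) ∩ {B | B.1 x = x}) :=
    h.compact.inter_right (isClosed_eq (continuous_unitary_apply x) continuous_const)
  -- The remaining freedom, the stabilizer of `x`, is used to remove the components along the `b j`
  -- without changing the first maximum.
  obtain ⟨B, ⟨hB, hBx⟩, hmaxB⟩ := hcomp.exists_isMaxOn ⟨1, G.one_mem, rfl⟩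
    (f := fun B : unitary (V →L[ℝ] V) => inner ℝ (B.1 (A.1 z)) (∑ j, a j))
    ((continuous_unitary_apply (A.1 z)).inner continuous_const).continuousOn
  set w : V := B.1 (A.1 z) with hw
  have hwx : inner ℝ w x = inner ℝ (A.1 z) x := by
    conv_lhs => rw [hw, ← show B.1 x = x from hBx]
    exact inner_unitary_apply B _ _
  have hwmax : ∀ C ∈ G, inner ℝ (C.1 w) x ≤ inner ℝ w x := by
    intro C hC
    rw [hwx]
    exact hmax (G.mul_mem (G.mul_mem hC hB) hA)
  have hwt : ∀ ξ ∈ 𝔱, inner ℝ (ξ w) x = 0 := by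
    intro ξ hξ
    refine inner_apply_eq_zero_of_isMax fun t => ?_
    obtain ⟨C, hC, hCe⟩ := h.lie.exp_mem (t • ξ) (𝔱.smul_mem t hξ)
    rw [← hCe]
    exact hwmax C hC
  refine ⟨B * A, G.mul_mem hB hA, ?_, ?_⟩
  · change w - x ∈ _
    refine mem_sliceSpace.2 ⟨mem_orbitTangent_orthogonal.2 fun ξ hξ => ?_,
      mem_span_orthogonal.2 fun j => ?_⟩
    · rw [inner_sub_right, inner_apply_self_of_skew (h.lie.skew ξ hξ), sub_zero, h.skew hξ,
        real_inner_comm, hwt ξ hξ, neg_zero]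
    · have h1 : inner ℝ (rot (a j) (b j) w) (∑ i, a i) = 0 := by
        refine inner_apply_eq_zero_of_isMax fun t => ?_
        obtain ⟨C, hC, hCe⟩ := h.lie.exp_mem (t • rot (a j) (b j)) (𝔱.smul_mem t (h.rot_mem j))
        have hCx : C.1 x = x := by
          rw [hCe]
          exact expE_smul_apply_of_apply_eq_zero (h.rot_apply_self j) t
        rw [← hCe]
        refine hmaxB (a := C * B) ⟨G.mul_mem hC hB, ?_⟩
        change C.1 (B.1 x) = x
        rw [show B.1 x = x from hBx, hCx]
      rw [h.skew (h.rot_mem j), h.rot_sum_left, neg_eq_zero, real_inner_comm] at h1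
      have h2 : inner ℝ (b j) x = 0 := by
        rw [← h.rot_sum_left j, h.skew (h.rot_mem j), h.rot_apply_self, inner_zero_right, neg_zero]
      rw [inner_sub_right, h1, h2, sub_zero]
  · change ‖w - x‖ ≤ _
    have h1 : ‖w‖ = ‖z‖ := by rw [hw, norm_unitary_apply, norm_unitary_apply]
    have h2 : inner ℝ z x ≤ inner ℝ w x := by
      rw [hwx]
      exact hmax G.one_mem
    rw [← abs_of_nonneg (norm_nonneg (w - x)), ← abs_of_nonneg (norm_nonneg (z - x)), ← sq_le_sq,
      norm_sub_sq_real, norm_sub_sq_real, h1]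
    linarith

/-- The group is compact, and it is discrete: an element `exp ξ` near `1` that fixes `x` has `ξ x =
0`; since it preserves the slice while `ξ (a j)` is orthogonal to it, also `ξ (a j) = 0`; so all
coefficients of `ξ` in the rotations vanish. -/
theorem finite_sliceStabilizer (h : SliceData G 𝔱 x a b) :
    Finite (sliceStabilizer G x (sliceSpace 𝔱 x b)) := by
  set S := sliceSpace 𝔱 x b with hS
  set H := sliceStabilizer G x S with hH
  obtain ⟨η, hη, hest⟩ := exists_norm_exp_apply_sub_le (V := V) (ε := 1 / 2) (by norm_num)
  have hnear : ∀ᶠ A : unitary (V →L[ℝ] V) in 𝓝 1, A ∈ H → A = 1 := by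
    have := h.lie.near_one η hη
    rw [eventually_nhdsWithin_iff] at this
    filter_upwards [this] with A hA hAH
    obtain ⟨ξ, hξ, hn, he⟩ := hA hAH.1
    have hest' := (hest ξ hn).2
    have hξx : ξ x = 0 := by
      have h1 := hest' x
      rw [← he, hAH.2.1, sub_self, zero_sub, norm_neg] at h1
      exact norm_eq_zero.1 (le_antisymm (by linarith) (norm_nonneg _))
    have hξa : ∀ j, ξ (a j) = 0 := by
      intro j
      have h1 := hest' (a j)
      have h2 := h.apply_mem_span (h.left_mem j) hξ hξx
      set w := ξ (a j) with hw
      have h3 : ∀ u ∈ S, inner ℝ u w = 0 := by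
        intro u hu
        rw [real_inner_comm]
        exact (Submodule.mem_orthogonal _ _).1 (mem_sliceSpace.1 hu).2 _ h2
      have h4 : expE ξ (a j) ∈ S := by
        rw [← he]
        exact (hAH.2.2 _).2 (h.left_mem j)
      -- Both `exp ξ (a j)` and `a j` lie in the slice, so the error of the linearization has the
      -- full component `-w`; but it is at most half of `w`.
      have h5 : inner ℝ (expE ξ (a j) - a j - w) w = - ‖w‖ ^ 2 := by
        rw [inner_sub_left, inner_sub_left, h3 _ h4, h3 _ (h.left_mem j),
          real_inner_self_eq_norm_sq]
        ring
      have h6 := abs_real_inner_le_norm (expE ξ (a j) - a j - w) w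
      rw [h5, abs_neg, abs_of_nonneg (by positivity)] at h6
      have h7 := mul_le_mul_of_nonneg_right h1 (norm_nonneg w)
      have h8 : ‖w‖ ^ 2 ≤ 0 := by nlinarith
      exact norm_eq_zero.1 (pow_eq_zero_iff two_ne_zero |>.1 (le_antisymm h8 (sq_nonneg _)))
    obtain ⟨c, hc⟩ := (Submodule.mem_span_range_iff_exists_fun ℝ).1 (h.mem_span ξ hξ hξx)
    have hc0 : ∀ j, c j = 0 := by
      intro j
      have h1 := hξa j
      rw [← hc, sum_apply, Finset.sum_eq_single j
        (fun i _ hi => by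
          rw [FunLike.coe_smul, Pi.smul_apply, h.planes.rot_left_of_ne hi, smul_zero]) (by simp),
        FunLike.coe_smul, Pi.smul_apply, h.planes.rot_left] at h1
      refine (smul_eq_zero.1 h1).resolve_right fun h0 => ?_
      have := h.planes.inner_right j
      rw [h0, inner_zero_left] at this
      exact zero_ne_one this
    have hξ0 : ξ = 0 := by
      rw [← hc]
      exact Finset.sum_eq_zero fun j _ => by rw [hc0 j, zero_smul]
    refine Subtype.ext ?_
    rw [he, hξ0, expE_zero]
    rfl
  have hclosed : IsClosed (H : Set (unitary (V →L[ℝ] V))) := by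
    have h1 : (H : Set (unitary (V →L[ℝ] V))) = (G : Set (unitary (V →L[ℝ] V))) ∩
        ({A | A.1 x = x} ∩ ⋂ u ∈ S, {A | A.1 u ∈ S ∧ A⁻¹.1 u ∈ S}) := by
      ext A
      simp only [mem_inter_iff, mem_iInter, SetLike.mem_coe, mem_ofPred_eq]
      constructor
      · refine fun hA => ⟨hA.1, hA.2.1, fun u hu => ⟨(hA.2.2 u).2 hu, ?_⟩⟩
        exact ((H.inv_mem hA).2.2 u).2 hu
      · refine fun hA => ⟨hA.1, hA.2.1, fun u => ⟨fun hu => ?_, fun hu => (hA.2.2 u hu).1⟩⟩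
        have := (hA.2.2 _ hu).2
        rwa [unitary_inv_apply_apply] at this
    have hSc : IsClosed (S : Set V) := S.closed_of_finiteDimensional
    rw [h1]
    refine h.compact.isClosed.inter
      (IsClosed.inter ?_ (isClosed_biInter fun u _ => IsClosed.inter ?_ ?_))
    · exact isClosed_eq (continuous_unitary_apply x) continuous_const
    · exact hSc.preimage (continuous_unitary_apply u)
    · exact hSc.preimage ((continuous_unitary_apply u).comp continuous_inv)
  have hcomp : CompactSpace H := isCompact_iff_compactSpace.1
    (h.compact.of_isClosed_subset hclosed fun A hA => hA.1)
  have hdisc : DiscreteTopology H := by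
    refine discreteTopology_of_isOpen_singleton_one ?_
    obtain ⟨O, hO, hOo, h1O⟩ := eventually_nhds_iff.1 hnear
    convert hOo.preimage continuous_subtype_val (X := H) using 1
    ext A
    refine ⟨?_, fun hA => Subtype.ext (hO _ hA A.2)⟩
    rintro rfl
    exact h1O
  exact finite_of_compact_of_discrete

end SliceData

end Slice

/-! ### Orbits near the slice and the vertical spaces -/

section Slice

variable {V : Type*} [NormedAddCommGroup V] [InnerProductSpace ℝ V] [CompleteSpace V]
  [FiniteDimensional ℝ V] {ι : Type} [Fintype ι]

/-- Infinitesimal motions that move `x` with a prescribed velocity. -/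
theorem exists_lift (𝔱 : Submodule ℝ (V →L[ℝ] V)) (x : V) :
    ∃ σ : V →L[ℝ] V →L[ℝ] V, (∀ v, σ v ∈ 𝔱) ∧ (∀ v ∈ orbitTangent 𝔱 x, σ v x = v) ∧
      ∀ v ∈ (orbitTangent 𝔱 x)ᗮ, σ v = 0 := by
  obtain ⟨s, hs⟩ : ∃ s : orbitTangent 𝔱 x →ₗ[ℝ] 𝔱, (evalAt 𝔱 x).rangeRestrict ∘ₗ s = LinearMap.id :=
    (evalAt 𝔱 x).rangeRestrict.exists_rightInverse_of_surjective (LinearMap.range_rangeRestrict _)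
  have hs' : ∀ v : orbitTangent 𝔱 x, ((s v : 𝔱) : V →L[ℝ] V) x = v := fun v =>
    congrArg Subtype.val (congrArg (fun F => F v) hs)
  let τ : V →ₗ[ℝ] V →L[ℝ] V :=
    𝔱.subtype ∘ₗ s ∘ₗ ((orbitTangent 𝔱 x).orthogonalProjectionOnto : V →ₗ[ℝ] orbitTangent 𝔱 x)
  have hτ : ∀ v, τ v = s ((orbitTangent 𝔱 x).orthogonalProjectionOnto v) := fun v => rfl
  refine ⟨LinearMap.toContinuousLinearMap τ, fun v => ?_, fun v hv => ?_, fun v hv => ?_⟩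
  · exact (s _).2
  · change τ v x = v
    rw [hτ, hs']
    exact Submodule.starProjection_eq_self_iff.2 hv
  · change τ v = 0
    rw [hτ, Submodule.orthogonalProjectionOnto_apply_of_mem_orthogonal hv, map_zero]
    rfl

theorem unitary_mem_iff_of_le {A : unitary (V →L[ℝ] V)} {N : Submodule ℝ V}
    (h : ∀ v ∈ N, A.1 v ∈ N) (v : V) : A.1 v ∈ N ↔ v ∈ N := by
  refine ⟨fun hv => ?_, h v⟩
  have hinj : Function.Injective ((A.1 : V →ₗ[ℝ] V).restrict h) := by
    intro v w hvw
    have : A.1 v = A.1 w := congrArg Subtype.val hvw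
    refine Subtype.ext ?_
    rw [← unitary_inv_apply_apply A v, this, unitary_inv_apply_apply]
  obtain ⟨w, hw⟩ := LinearMap.injective_iff_surjective.1 hinj ⟨A.1 v, hv⟩
  have h1 : A.1 w = A.1 v := congrArg Subtype.val hw
  have h2 : (w : V) = v := by
    rw [← unitary_inv_apply_apply A (w : V), h1, unitary_inv_apply_apply]
  exact h2 ▸ w.2

theorem unitary_mem_orthogonal_iff {A : unitary (V →L[ℝ] V)} {N : Submodule ℝ V}
    (h : ∀ v, A.1 v ∈ N ↔ v ∈ N) (v : V) : A.1 v ∈ Nᗮ ↔ v ∈ Nᗮ := by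
  simp only [Submodule.mem_orthogonal]
  constructor
  · intro hv w hw
    rw [← inner_unitary_apply A]
    exact hv _ ((h w).2 hw)
  · intro hv w hw
    rw [inner_unitary_right]
    refine hv _ ((h _).1 ?_)
    rwa [unitary_apply_inv_apply]

variable {G : Subgroup (unitary (V →L[ℝ] V))} {𝔱 : Submodule ℝ (V →L[ℝ] V)} {x : V} {a b : ι → V}

/-- Near `x`, small elements of the torus that move a point of the slice within the normal space
fix `x`. -/
theorem IsAbelianLieAlgebra.exists_apply_eq_zero (h : IsAbelianLieAlgebra G 𝔱) (x : V) :
    ∃ δ > 0, ∃ η > 0, ∀ ξ ∈ 𝔱, ‖ξ‖ < η → ∀ w ∈ (orbitTangent 𝔱 x)ᗮ, ∀ w' ∈ (orbitTangent 𝔱 x)ᗮ,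
      ‖w‖ < δ → expE ξ (x + w) = x + w' → ξ x = 0 := by
  obtain ⟨σ, hσ𝔱, hσx, -⟩ := exists_lift 𝔱 x
  obtain ⟨η, hη, hest⟩ := exists_norm_exp_apply_sub_le (V := V) (ε := 1 / 4) (by norm_num)
  refine ⟨1 / (4 * (‖σ‖ + 1)), by positivity, η / ((‖σ‖ + 1) * (‖x‖ + 1)), by positivity, ?_⟩
  intro ξ hξ hn w hw w' hw' hwδ he
  -- `ξ` is split into `ζ = σ p`, which carries the whole motion of `x` and is controlled by `p`,
  -- and `ξ - ζ`, which fixes `x` and hence preserves the normal space.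
  set p := ξ x with hp
  have hpt : p ∈ orbitTangent 𝔱 x := mem_orbitTangent.2 ⟨ξ, hξ, rfl⟩
  set ζ := σ p with hζ
  have hζ𝔱 : ζ ∈ 𝔱 := hσ𝔱 p
  have hζx : ζ x = p := hσx p hpt
  have h0𝔱 : ξ - ζ ∈ 𝔱 := 𝔱.sub_mem hξ hζ𝔱
  have h0x : (ξ - ζ) x = 0 := by rw [sub_apply, hζx, sub_self]
  obtain ⟨A, hA, hAe⟩ := h.exp_mem _ h0𝔱
  have hAx : A.1 x = x := by
    rw [hAe]
    exact expE_apply_of_apply_eq_zero h0x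
  set u := A.1 w with hu
  have hut : u ∈ (orbitTangent 𝔱 x)ᗮ := h.apply_mem_orbitTangent_orthogonal hA hAx hw
  have hun : ‖u‖ = ‖w‖ := norm_unitary_apply A w
  have hmul : expE ξ = expE ζ * expE (ξ - ζ) := by
    rw [← expE_add (h.comm _ hζ𝔱 _ h0𝔱), add_sub_cancel]
  have he' : expE ζ (x + u) = x + w' := by
    have h1 : A.1 (x + w) = x + u := by rw [map_add, hAx]
    rw [← he, hmul, ← hAe, ← h1]
    rfl
  have hζn : ‖ζ‖ < η := by
    have h1 : ‖ζ‖ ≤ ‖σ‖ * (‖ξ‖ * ‖x‖) := (σ.le_opNorm p).trans (by gcongr; exact ξ.le_opNorm x)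
    rw [lt_div_iff₀ (by positivity)] at hn
    refine lt_of_le_of_lt ?_ hn
    have := norm_nonneg σ
    have := norm_nonneg ξ
    have := norm_nonneg x
    have h2 : ‖σ‖ * (‖ξ‖ * ‖x‖) = ‖ξ‖ * (‖σ‖ * ‖x‖) := by ring
    refine h1.trans (h2.le.trans ?_)
    gcongr <;> linarith
  have h1 := (hest ζ hζn).2 (x + u)
  have hζu : ‖ζ u‖ ≤ 1 / 4 * ‖p‖ := by
    have h2 : ‖ζ u‖ ≤ ‖σ‖ * ‖p‖ * ‖u‖ := (ζ.le_opNorm u).trans (by gcongr; exact σ.le_opNorm p)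
    rw [lt_div_iff₀ (by positivity), ← hun] at hwδ
    have h3 : ‖σ‖ * ‖p‖ * ‖u‖ = (‖u‖ * ‖σ‖) * ‖p‖ := by ring
    rw [h3] at h2
    refine h2.trans ?_
    gcongr
    have := norm_nonneg u
    nlinarith
  rw [map_add ζ, hζx] at h1
  set r := expE ζ (x + u) - (x + u) - (p + ζ u) with hr
  have hrn : ‖r‖ ≤ 5 / 16 * ‖p‖ := by
    refine h1.trans ?_
    have := norm_add_le p (ζ u)
    linarith
  -- The displacement is normal to the orbit but equals `p` up to an error of norm at most `(5/16 +
  -- 1/4) ‖p‖`, while `p` is tangent; pairing with `p` forces `p = 0`.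
  have hpp : ‖p‖ ^ 2 = - inner ℝ p (r + ζ u) := by
    have h2 : r + ζ u = w' - u - p := by
      rw [hr, he']
      abel
    rw [h2, inner_sub_right, inner_sub_right, (Submodule.mem_orthogonal _ _).1 hut _ hpt,
      (Submodule.mem_orthogonal _ _).1 hw' _ hpt, real_inner_self_eq_norm_sq]
    ring
  have h3 := abs_real_inner_le_norm p (r + ζ u)
  have h4 := neg_le_abs (inner ℝ p (r + ζ u))
  have h5 := norm_add_le r (ζ u)
  have h6 : ‖p‖ * ‖r + ζ u‖ ≤ ‖p‖ * (9 / 16 * ‖p‖) := by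
    gcongr
    linarith
  have h7 : ‖p‖ ^ 2 ≤ 0 := by nlinarith
  exact norm_eq_zero.1 (pow_eq_zero_iff two_ne_zero |>.1 (le_antisymm h7 (sq_nonneg _)))

/-- Near `x`, elements of the group that move a point of the normal space within the normal space
fix `x`. -/
theorem IsAbelianLieAlgebra.exists_apply_self_eq (h : IsAbelianLieAlgebra G 𝔱)
    (hG : IsCompact (G : Set (unitary (V →L[ℝ] V)))) (x : V) :
    ∃ δ > 0, ∀ A ∈ G, ∀ w ∈ (orbitTangent 𝔱 x)ᗮ, ∀ w' ∈ (orbitTangent 𝔱 x)ᗮ,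
      ‖w‖ < δ → ‖w'‖ < δ → A.1 (x + w) = x + w' → A.1 x = x := by
  obtain ⟨δ, hδ, η, hη, hzero⟩ := h.exists_apply_eq_zero x
  obtain ⟨ρ, hρ, hnear⟩ := h.exists_mul_of_near hG x (K := {x}) isCompact_singleton hη
  refine ⟨min δ (ρ / 2), by positivity, fun A hA w hw w' hw' hwn hwn' he => ?_⟩
  have h1 : A.1 x - x = w' - A.1 w := by
    rw [map_add] at he
    rw [sub_eq_sub_iff_add_eq_add, he, add_comm]
  have h2 : ‖A.1 x - x‖ < ρ := by
    rw [h1]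
    have := norm_sub_le w' (A.1 w)
    rw [norm_unitary_apply] at this
    have h3 := hwn.trans_le (min_le_right _ _)
    have h4 := hwn'.trans_le (min_le_right _ _)
    linarith
  -- With the compact set `{x}`, `C` fixes `x` exactly and therefore preserves the normal space;
  -- only `exp ξ` remains to be treated.
  obtain ⟨ξ, hξ, C, hC, hξn, hAe, hCx, -⟩ := hnear A hA x (mem_singleton x) h2
  have hCx' : C.1 x = x := hCx
  have h5 : expE ξ (x + C.1 w) = x + w' := by
    rw [← he, hAe]
    change _ = expE ξ (C.1 (x + w))
    rw [map_add C.1, hCx']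
  have h6 := hzero ξ hξ hξn _ (h.apply_mem_orbitTangent_orthogonal hC hCx' hw) _ hw'
    (by rw [norm_unitary_apply]; exact hwn.trans_le (min_le_left _ _)) h5
  rw [hAe]
  change expE ξ (C.1 x) = x
  rw [hCx', expE_apply_of_apply_eq_zero h6]

/-- The vertical space at `x + u`: the tangent space of the orbit and the span of the `b j`. -/
def vertical (𝔱 : Submodule ℝ (V →L[ℝ] V)) (x : V) (b : ι → V) (u : V) :
    Submodule ℝ V :=
  orbitTangent 𝔱 (x + u) ⊔ Submodule.span ℝ (range b)

namespace SliceData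

/-- `b j` is a rotation applied to `∑ j, a j`. Conjugating that rotation by `A` again gives an
element of `𝔱` that kills `x`, and such elements map the slice into the span of the `b j`. -/
theorem apply_mem_span_of_fix (h : SliceData G 𝔱 x a b) {A : unitary (V →L[ℝ] V)} (hA : A ∈ G)
    (hAx : A.1 x = x) (hAa : A.1 (∑ j, a j) ∈ sliceSpace 𝔱 x b) (v : V) (hv : v ∈ Submodule.span ℝ (range b)) :
    A.1 v ∈ Submodule.span ℝ (range b) := by
  have hle : Submodule.span ℝ (range b) ≤
      (Submodule.span ℝ (range b)).comap (A.1 : V →ₗ[ℝ] V) := by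
    rw [Submodule.span_le]
    rintro _ ⟨j, rfl⟩
    obtain ⟨η, hη, he⟩ := h.lie.exists_conj' hA (h.rot_mem j)
    change A.1 (b j) ∈ Submodule.span ℝ (range b)
    rw [← h.rot_sum_left j, he]
    refine h.apply_mem_span hAa hη ?_
    have := he x
    rw [h.rot_apply_self, map_zero, hAx] at this
    exact this.symm
  exact hle hv

/-- Elements of the stabilizer of `x` act on the slice like elements of the finite group. -/
theorem exists_mem_sliceStabilizer (h : SliceData G 𝔱 x a b) {A : unitary (V →L[ℝ] V)}
    (hA : A ∈ G) (hAx : A.1 x = x) {u u' : V} (hu : u ∈ sliceSpace 𝔱 x b)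
    (hu' : u' ∈ sliceSpace 𝔱 x b) (hAu : A.1 u = u') :
    ∃ C ∈ sliceStabilizer G x (sliceSpace 𝔱 x b), C.1 u = u' := by
  have hcomp : IsCompact ((G : Set (unitary (V →L[ℝ] V))) ∩ ({B | B.1 x = x} ∩ {B | B.1 u' = u'})) :=
    h.compact.inter_right ((isClosed_eq (continuous_unitary_apply x) continuous_const).inter
      (isClosed_eq (continuous_unitary_apply u') continuous_const))
  -- `A` is corrected by an element fixing both `x` and `u'`, so the prescribed value at `u` is
  -- kept, and chosen to bring the image of `∑ j, a j` back into the slice.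
  obtain ⟨B, ⟨hB, hBx, hBu⟩, hmax⟩ := hcomp.exists_isMaxOn ⟨1, G.one_mem, rfl, rfl⟩
    (f := fun B : unitary (V →L[ℝ] V) => inner ℝ (B.1 (A.1 (∑ j, a j))) (∑ j, a j))
    ((continuous_unitary_apply _).inner continuous_const).continuousOn
  have hBx' : B.1 x = x := hBx
  have hBu' : B.1 u' = u' := hBu
  set C := B * A with hCdef
  have hCapp : ∀ v, C.1 v = B.1 (A.1 v) := fun v => rfl
  have hC : C ∈ G := G.mul_mem hB hA
  have hCx : C.1 x = x := by rw [hCapp, hAx, hBx']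
  have hCu : C.1 u = u' := by rw [hCapp, hAu, hBu']
  set c := ∑ j, a j with hc
  have hcS : c ∈ sliceSpace 𝔱 x b := h.sum_left_mem
  have hCc : C.1 c ∈ sliceSpace 𝔱 x b := by
    refine mem_sliceSpace.2 ⟨h.lie.apply_mem_orbitTangent_orthogonal hC hCx (mem_sliceSpace.1 hcS).1,
      mem_span_orthogonal.2 fun j => ?_⟩
    -- If `u'` has no component in plane `j`, the rotation of that plane fixes `u'` and is an
    -- admissible variation at the maximum. Otherwise the orthogonality follows from polarity at
    -- `u`, transported by `C`, after dividing by that component.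
    by_cases hj : inner ℝ (a j) u' = 0
    · have h1 : inner ℝ (rot (a j) (b j) (C.1 c)) c = 0 := by
        refine inner_apply_eq_zero_of_isMax fun t => ?_
        obtain ⟨R, hR, hRe⟩ := h.lie.exp_mem (t • rot (a j) (b j)) (𝔱.smul_mem t (h.rot_mem j))
        have hRx : R.1 x = x := by
          rw [hRe]
          exact expE_smul_apply_of_apply_eq_zero (h.rot_apply_self j) t
        have hRu : R.1 u' = u' := by
          rw [hRe]
          refine expE_smul_apply_of_apply_eq_zero ?_ t
          rw [h.rot_apply_of_mem hu', hj, zero_smul]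
        rw [← hRe]
        refine hmax (a := R * B) ⟨G.mul_mem hR hB, ?_, ?_⟩
        · change R.1 (B.1 x) = x
          rw [hBx', hRx]
        · change R.1 (B.1 u') = u'
          rw [hBu', hRu]
      rw [h.skew (h.rot_mem j), h.rot_sum_left, neg_eq_zero, real_inner_comm] at h1
      exact h1
    · obtain ⟨η, hη, he⟩ := h.lie.exists_conj hC (h.rot_mem j)
      have hηx : η x = 0 := by
        have h1 := he x
        rw [hCx, h.rot_apply_self] at h1
        rw [← unitary_inv_apply_apply C (η x), h1, map_zero]
      have h1 : inner ℝ (η u) c = 0 :=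
        (Submodule.mem_orthogonal _ _).1 (mem_sliceSpace.1 hcS).2 _ (h.apply_mem_span hu hη hηx)
      rw [← inner_unitary_apply C, he, hCu, h.rot_apply_of_mem hu', inner_smul_left] at h1
      exact (mul_eq_zero.1 h1).resolve_left hj
  have hspan := unitary_mem_iff_of_le (h.apply_mem_span_of_fix hC hCx hCc)
  have htan : ∀ v, C.1 v ∈ orbitTangent 𝔱 x ↔ v ∈ orbitTangent 𝔱 x := by
    refine unitary_mem_iff_of_le fun v hv => ?_
    have := h.lie.apply_mem_orbitTangent hC hv
    rwa [hCx] at this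
  refine ⟨C, mem_sliceStabilizer.2 ⟨hC, hCx, fun v => ?_⟩, hCu⟩
  rw [mem_sliceSpace, mem_sliceSpace, unitary_mem_orthogonal_iff hspan,
    unitary_mem_orthogonal_iff htan]

theorem orthogonal_sliceSpace (_h : SliceData G 𝔱 x a b) :
    (sliceSpace 𝔱 x b)ᗮ = orbitTangent 𝔱 x ⊔ Submodule.span ℝ (range b) := by
  rw [sliceSpace, Submodule.orthogonal_orthogonal]

theorem map_span_of_mem_sliceStabilizer (h : SliceData G 𝔱 x a b) {A : unitary (V →L[ℝ] V)}
    (hA : A ∈ sliceStabilizer G x (sliceSpace 𝔱 x b)) (v : V) (hv : v ∈ Submodule.span ℝ (range b)) :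
    A.1 v ∈ Submodule.span ℝ (range b) :=
  h.apply_mem_span_of_fix hA.1 hA.2.1 ((hA.2.2 _).2 h.sum_left_mem) v hv

theorem apply_mem_vertical (h : SliceData G 𝔱 x a b) {A : unitary (V →L[ℝ] V)}
    (hA : A ∈ sliceStabilizer G x (sliceSpace 𝔱 x b)) {u v : V} (hv : v ∈ vertical 𝔱 x b u) :
    A.1 v ∈ vertical 𝔱 x b (A.1 u) := by
  obtain ⟨w, hw, e, he, rfl⟩ := Submodule.mem_sup.1 hv
  rw [map_add]
  refine Submodule.add_mem_sup ?_ (h.map_span_of_mem_sliceStabilizer hA e he)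
  have := h.lie.apply_mem_orbitTangent hA.1 hw
  rwa [map_add, hA.2.1] at this

/-- Writing `p = ξ x`, the element `ξ - σ p` kills `x` and so moves `u` within the span of the `b
j`; hence `ξ (x + u)` is `p + σ p u` up to that span. Near `x` this gives the vertical spaces
constant dimension and a smooth parametrization by the fixed space `Sᗮ`, although the orbits may
drop dimension. -/
theorem exists_mem_vertical_iff (h : SliceData G 𝔱 x a b) :
    ∃ σ : V →L[ℝ] V →L[ℝ] V, (∀ u ∈ sliceSpace 𝔱 x b, ∀ w, w ∈ vertical 𝔱 x b u ↔
      ∃ v ∈ (sliceSpace 𝔱 x b)ᗮ, v + σ v u = w) := by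
  obtain ⟨σ, hσ𝔱, hσx, hσ0⟩ := exists_lift 𝔱 x
  have hσb : ∀ e ∈ Submodule.span ℝ (range b), σ e = 0 := fun e he => hσ0 e (h.span_le he)
  refine ⟨σ, fun u hu w => ⟨fun hw => ?_, ?_⟩⟩
  · obtain ⟨w, hw', e, he, rfl⟩ := Submodule.mem_sup.1 hw
    obtain ⟨ξ, hξ, rfl⟩ := mem_orbitTangent.1 hw'
    have hp : ξ x ∈ orbitTangent 𝔱 x := mem_orbitTangent.2 ⟨ξ, hξ, rfl⟩
    have h0 : (ξ - σ (ξ x)) u ∈ Submodule.span ℝ (range b) := by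
      refine h.apply_mem_span hu (𝔱.sub_mem hξ (hσ𝔱 _)) ?_
      rw [sub_apply, hσx _ hp, sub_self]
    refine ⟨ξ x + ((ξ - σ (ξ x)) u + e), ?_, ?_⟩
    · rw [h.orthogonal_sliceSpace]
      exact Submodule.add_mem_sup hp (Submodule.add_mem _ h0 he)
    · rw [map_add, hσb _ (Submodule.add_mem _ h0 he), add_zero, sub_apply, map_add]
      abel
  · rintro ⟨v, hv, rfl⟩
    rw [h.orthogonal_sliceSpace] at hv
    obtain ⟨p, hp, e, he, rfl⟩ := Submodule.mem_sup.1 hv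
    rw [map_add, hσb e he, add_zero, add_right_comm]
    refine Submodule.add_mem_sup (mem_orbitTangent.2 ⟨σ p, hσ𝔱 p, ?_⟩) he
    rw [map_add, hσx p hp]

end SliceData

end Slice

/-! ### The metric on the slice -/

section Horizontal

variable {E V X : Type} [NormedAddCommGroup E] [InnerProductSpace ℝ E] [FiniteDimensional ℝ E]
  [NormedAddCommGroup V] [InnerProductSpace ℝ V] [FiniteDimensional ℝ V]
  [NormedAddCommGroup X] [NormedSpace ℝ X]

theorem contDiffOn_bilinearComp {F : Type} [NormedAddCommGroup F] [NormedSpace ℝ F]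
    [FiniteDimensional ℝ F] {a : X → V →L[ℝ] V →L[ℝ] ℝ} {f : X → E →L[ℝ] V} {g : X → F →L[ℝ] V}
    {s : Set X} (ha : ContDiffOn ℝ ∞ a s) (hf : ContDiffOn ℝ ∞ f s) (hg : ContDiffOn ℝ ∞ g s) :
    ContDiffOn ℝ ∞ (fun x => (a x).bilinearComp (f x) (g x)) s := by
  refine contDiffOn_clm_apply.2 fun v => contDiffOn_clm_apply.2 fun w => ?_
  exact (ha.clm_apply (hf.clm_apply contDiffOn_const)).clm_apply (hg.clm_apply contDiffOn_const)

/-- The pull-back of the form `a` by `P`, made definite on the kernel of `P` by `R`. -/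
def gramMap (P R : V →L[ℝ] V) (a : V →L[ℝ] V →L[ℝ] ℝ) : V →L[ℝ] V →L[ℝ] ℝ :=
  a.bilinearComp P P +
    (isBoundedBilinearMap_inner (𝕜 := ℝ) (E := V)).toContinuousLinearMap.bilinearComp R R

theorem gramMap_apply (P R : V →L[ℝ] V) (a : V →L[ℝ] V →L[ℝ] ℝ) (v w : V) :
    gramMap P R a v w = a (P v) (P w) + inner ℝ (R v) (R w) := rfl

/-- The component of `i v` that is `a`-orthogonal to the range of `P`. -/
def horizontalMap (i : E →L[ℝ] V) (P R : V →L[ℝ] V) (a : V →L[ℝ] V →L[ℝ] ℝ) : E →L[ℝ] V :=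
  i - P ∘L (gramMap P R a).inverse ∘L a.bilinearComp i P

theorem isInvertible_gramMap {P R : V →L[ℝ] V} {a : V →L[ℝ] V →L[ℝ] ℝ}
    (ha : ∀ v, v ≠ 0 → 0 < a v v) (h : ∀ v, P v = 0 → R v = 0 → v = 0) :
    (gramMap P R a).IsInvertible := by
  have hdim : Module.finrank ℝ V = Module.finrank ℝ (V →L[ℝ] ℝ) := by
    rw [← (LinearMap.toContinuousLinearMap : (V →ₗ[ℝ] ℝ) ≃ₗ[ℝ] (V →L[ℝ] ℝ)).finrank_eq]
    exact (Subspace.dual_finrank_eq (K := ℝ) (V := V)).symm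
  have hinj : Function.Injective (gramMap P R a : V →ₗ[ℝ] (V →L[ℝ] ℝ)) := by
    refine (injective_iff_map_eq_zero _).2 fun v hv => ?_
    have h1 : gramMap P R a v v = 0 := by
      change (gramMap P R a : V →ₗ[ℝ] (V →L[ℝ] ℝ)) v v = 0
      rw [hv]
      rfl
    rw [gramMap_apply, real_inner_self_eq_norm_sq] at h1
    have h2 : P v = 0 := by
      by_contra h0
      have := ha _ h0
      nlinarith [sq_nonneg ‖R v‖]
    rw [h2, map_zero, zero_add] at h1
    exact h v h2 (norm_eq_zero.1 (pow_eq_zero_iff two_ne_zero |>.1 h1))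
  exact ⟨(LinearMap.linearEquivOfInjective _ hinj hdim).toContinuousLinearEquiv, rfl⟩

/-- Testing the Gram equation on `R w` gives `R w = 0`, so the added term disappears and the normal
equation of the orthogonal projection to the range of `P` remains. -/
theorem horizontalMap_spec {i : E →L[ℝ] V} {P R : V →L[ℝ] V} {a : V →L[ℝ] V →L[ℝ] ℝ}
    (hinv : (gramMap P R a).IsInvertible) (hPR : ∀ v, P (R v) = 0) (hRR : ∀ v, R (R v) = R v)
    (v : E) : (∃ w, horizontalMap i P R a v = i v - P w) ∧
      ∀ w, a (horizontalMap i P R a v) (P w) = 0 := by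
  set w := (gramMap P R a).inverse (a.bilinearComp i P v) with hw
  have hHv : horizontalMap i P R a v = i v - P w := rfl
  have hZ : gramMap P R a w = a.bilinearComp i P v := by
    obtain ⟨e, he⟩ := hinv
    rw [hw, ← he, ContinuousLinearMap.inverse_equiv]
    exact e.apply_symm_apply _
  have hZ' : ∀ w', a (P w) (P w') + inner ℝ (R w) (R w') = a (i v) (P w') := fun w' =>
    congrArg (fun F : V →L[ℝ] ℝ => F w') hZ
  have hR : R w = 0 := by
    have := hZ' (R w)
    rw [hPR, map_zero, map_zero, zero_add, hRR, real_inner_self_eq_norm_sq] at this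
    exact norm_eq_zero.1 (pow_eq_zero_iff two_ne_zero |>.1 this)
  refine ⟨⟨w, hHv⟩, fun w' => ?_⟩
  rw [hHv, map_sub, sub_apply, ← hZ' w', hR, inner_zero_left, add_zero, sub_self]

theorem isOpen_isInvertible_gramMap (R : V →L[ℝ] V) {P : X → V →L[ℝ] V} (hP : ContDiff ℝ ∞ P) :
    IsOpen {p : (V →L[ℝ] V →L[ℝ] ℝ) × X | (gramMap (P p.2) R p.1).IsInvertible} := by
  have hZ : ContDiff ℝ ∞ fun p : (V →L[ℝ] V →L[ℝ] ℝ) × X => gramMap (P p.2) R p.1 := by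
    refine contDiffOn_univ.1 ?_
    have hP' : ContDiffOn ℝ ∞ (fun p : (V →L[ℝ] V →L[ℝ] ℝ) × X => P p.2) univ :=
      (hP.comp contDiff_snd).contDiffOn
    exact (contDiffOn_bilinearComp contDiff_fst.contDiffOn hP' hP').add contDiffOn_const
  exact (ContinuousLinearEquiv.isOpen (𝕜 := ℝ) (E := V) (F := V →L[ℝ] ℝ)).preimage hZ.continuous

theorem contDiffOn_horizontalForm (i : E →L[ℝ] V) (R : V →L[ℝ] V) {P : X → V →L[ℝ] V}
    (hP : ContDiff ℝ ∞ P) :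
    ContDiffOn ℝ ∞ (fun p : (V →L[ℝ] V →L[ℝ] ℝ) × X =>
      p.1.bilinearComp (horizontalMap i (P p.2) R p.1) (horizontalMap i (P p.2) R p.1))
      {p | (gramMap (P p.2) R p.1).IsInvertible} := by
  set Ω := {p : (V →L[ℝ] V →L[ℝ] ℝ) × X | (gramMap (P p.2) R p.1).IsInvertible} with hΩ
  have hP' : ContDiffOn ℝ ∞ (fun p : (V →L[ℝ] V →L[ℝ] ℝ) × X => P p.2) Ω :=
    (hP.comp contDiff_snd).contDiffOn
  have hZ : ContDiffOn ℝ ∞ (fun p : (V →L[ℝ] V →L[ℝ] ℝ) × X => gramMap (P p.2) R p.1) Ω :=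
    (contDiffOn_bilinearComp contDiff_fst.contDiffOn hP' hP').add contDiffOn_const
  have hinv : ContDiffOn ℝ ∞
      (fun p : (V →L[ℝ] V →L[ℝ] ℝ) × X => (gramMap (P p.2) R p.1).inverse) Ω := by
    intro p hp
    obtain ⟨e, he⟩ := hp
    have := contDiffAt_map_inverse (n := ∞) e
    rw [he] at this
    exact this.comp_contDiffWithinAt p (hZ p ⟨e, he⟩)
  have hH : ContDiffOn ℝ ∞
      (fun p : (V →L[ℝ] V →L[ℝ] ℝ) × X => horizontalMap i (P p.2) R p.1) Ω :=
    contDiffOn_const.sub (hP'.clm_comp (hinv.clm_comp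
      (contDiffOn_bilinearComp contDiff_fst.contDiffOn contDiffOn_const hP')))
  exact contDiffOn_bilinearComp contDiff_fst.contDiffOn hH hH

/-- The form is a smooth function of the value of the metric and of the point, with no derivatives
of the metric involved, so no regularity is lost. -/
theorem isCkHolder_horizontalForm {k : ℕ∞} {α : ℝ≥0} (hα : α ≤ 1) (i : E →L[ℝ] V) (R : V →L[ℝ] V)
    {P : X → V →L[ℝ] V} (hP : ContDiff ℝ ∞ P) {q : E → V →L[ℝ] V →L[ℝ] ℝ} {θ : E → X}
    (hq : IsCkHolder k α q) (hθ : IsCkHolder k α θ)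
    (hinv : ∀ u, (gramMap (P (θ u)) R (q u)).IsInvertible) :
    IsCkHolder k α fun u => (q u).bilinearComp (horizontalMap i (P (θ u)) R (q u))
      (horizontalMap i (P (θ u)) R (q u)) :=
  IsCkHolder.comp (f := fun u => (q u, θ u)) hα (isOpen_isInvertible_gramMap R hP)
    (contDiffOn_horizontalForm i R hP) hinv (hq.prodMk hθ)

end Horizontal

/-! ### Extending the local slice metric to the whole space -/

section Cutoff

variable {E : Type} [NormedAddCommGroup E] [InnerProductSpace ℝ E]

/-- A smooth radial retraction of `E` into a ball that is the identity near the origin. -/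
def cutoff (δ : ℝ) (u : E) : E := Real.smoothTransition (2 - ‖u‖ ^ 2 / δ ^ 2) • u

theorem contDiff_cutoff (δ : ℝ) : ContDiff ℝ ∞ (cutoff δ : E → E) := by
  refine ContDiff.smul (Real.smoothTransition.contDiff.comp ?_) contDiff_id
  exact contDiff_const.sub ((contDiff_norm_sq ℝ).div_const _)

theorem cutoff_of_norm_le {δ : ℝ} (hδ : 0 < δ) {u : E} (hu : ‖u‖ ≤ δ) : cutoff δ u = u := by
  rw [cutoff, Real.smoothTransition.one_of_one_le, one_smul]
  have : ‖u‖ ^ 2 / δ ^ 2 ≤ 1 := by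
    rw [div_le_one (by positivity)]
    gcongr
  linarith

theorem norm_cutoff_le {δ : ℝ} (hδ : 0 < δ) (u : E) : ‖cutoff δ u‖ ≤ 2 * δ := by
  rcases le_total ‖u‖ (2 * δ) with h | h
  · rw [cutoff, norm_smul, Real.norm_of_nonneg (Real.smoothTransition.nonneg _)]
    refine le_trans ?_ h
    exact mul_le_of_le_one_left (norm_nonneg u) (Real.smoothTransition.le_one _)
  · rw [cutoff, Real.smoothTransition.zero_of_nonpos, zero_smul, norm_zero]
    · positivity
    · have : 2 ≤ ‖u‖ ^ 2 / δ ^ 2 := by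
        rw [le_div_iff₀ (by positivity)]
        nlinarith
      linarith

theorem cutoff_unitary [CompleteSpace E] (δ : ℝ) (B : unitary (E →L[ℝ] E)) (u : E) :
    cutoff δ (B.1 u) = B.1 (cutoff δ u) := by
  rw [cutoff, cutoff, norm_unitary_apply, map_smul]

end Cutoff

/-! ### The quotient metric on the slice -/

section SliceForm

variable {E V : Type} [NormedAddCommGroup E] [InnerProductSpace ℝ E] [FiniteDimensional ℝ E]
  [CompleteSpace E]
  [NormedAddCommGroup V] [InnerProductSpace ℝ V] [FiniteDimensional ℝ V] [CompleteSpace V]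
  {ι : Type} [Fintype ι]
  {G : Subgroup (unitary (V →L[ℝ] V))} {𝔱 : Submodule ℝ (V →L[ℝ] V)} {x : V} {a b : ι → V}

/-- The vertical space is a graph over `Sᗮ` tilted by at most `1/2`, so it stays uniformly
transverse to `S`. -/
theorem norm_add_norm_le_of_vertical {S : Submodule ℝ V} {σ : V →L[ℝ] V →L[ℝ] V} {u v n : V}
    (hσ : ‖σ‖ * ‖u‖ ≤ 1 / 2) (hv : v ∈ S) (hn : n ∈ Sᗮ) :
    ‖v‖ + ‖n + σ n u‖ ≤ 6 * ‖v + (n + σ n u)‖ := by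
  have h1 : ‖σ n u‖ ≤ 1 / 2 * ‖n‖ := by
    refine ((σ n).le_opNorm u).trans ?_
    have h2 : ‖σ n‖ * ‖u‖ ≤ ‖σ‖ * ‖n‖ * ‖u‖ := by
      gcongr
      exact σ.le_opNorm n
    nlinarith [norm_nonneg n]
  have h3 : ‖v + n‖ ^ 2 = ‖v‖ ^ 2 + ‖n‖ ^ 2 := by
    rw [sq, sq, sq]
    exact norm_add_sq_eq_norm_sq_add_norm_sq_real ((Submodule.mem_orthogonal _ _).1 hn v hv)
  have h4 : ‖v‖ ≤ ‖v + n‖ := abs_le_of_sq_le_sq' (by nlinarith [norm_nonneg n]) (norm_nonneg _) |>.2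
  have h5 : ‖n‖ ≤ ‖v + n‖ := abs_le_of_sq_le_sq' (by nlinarith [norm_nonneg v]) (norm_nonneg _) |>.2
  have h6 : ‖v + n‖ ≤ ‖v + (n + σ n u)‖ + ‖σ n u‖ := by
    have := norm_sub_le (v + (n + σ n u)) (σ n u)
    rwa [← add_assoc, add_sub_cancel_right, add_assoc] at this
  have h7 := norm_add_le n (σ n u)
  have h8 := norm_nonneg (v + (n + σ n u))
  linarith

/-- Infinitesimal invariance of a form at a fixed point of the one-parameter group. -/
theorem apply_add_apply_eq_zero {q : V →L[ℝ] V →L[ℝ] ℝ} {ξ : V →L[ℝ] V}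
    (h : ∀ t : ℝ, ∀ v w, q (expE (t • ξ) v) (expE (t • ξ) w) = q v w) (v w : V) :
    q (ξ v) w + q v (ξ w) = 0 := by
  have h1 : HasDerivAt (fun t : ℝ => q (expE (t • ξ) v)) (q (ξ v)) 0 :=
    q.hasFDerivAt.comp_hasDerivAt (0 : ℝ) (hasDerivAt_expE_smul_apply_zero ξ v)
  have h2 := h1.clm_apply (hasDerivAt_expE_smul_apply_zero ξ w)
  have h3 : (fun t : ℝ => q (expE (t • ξ) v) (expE (t • ξ) w)) = fun _ => q v w :=
    funext fun t => h t v w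
  rw [h3, zero_smul, expE_zero] at h2
  exact h2.unique (hasDerivAt_const _ _)

/-- The quotient form: at a point of the slice, the vector of a coset of the vertical space that is
orthogonal to the vertical space is tangent to the slice up to the orbit direction. -/
theorem SliceData.exists_eq_add_of_orthogonal (hS : SliceData G 𝔱 x a b)
    {q : V →L[ℝ] V →L[ℝ] ℝ} (hsymm : ∀ v w, q v w = q w v) (hpos : ∀ v, v ≠ 0 → 0 < q v v) {u : V}
    (hu : u ∈ sliceSpace 𝔱 x b)
    (hinv : ∀ A ∈ G, A.1 (x + u) = x + u → ∀ v w, q (A.1 v) (A.1 w) = q v w)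
    {v w : V} (hv : v ∈ sliceSpace 𝔱 x b) (hw : w ∈ vertical 𝔱 x b u)
    (horth : ∀ w' ∈ vertical 𝔱 x b u, q (v + w) w' = 0) :
    ∃ ξ ∈ 𝔱, w = ξ (x + u) := by
  obtain ⟨p, hp, e, he, rfl⟩ := Submodule.mem_sup.1 hw
  obtain ⟨c, rfl⟩ := (Submodule.mem_span_range_iff_exists_fun ℝ).1 he
  classical
  have hrot : ∀ j, rot (a j) (b j) (x + u) = inner ℝ (a j) u • b j := fun j => by
    rw [map_add, hS.rot_apply_self, zero_add, hS.rot_apply_of_mem hu]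
  -- For `j ∈ J` the vector `b j` is a multiple of the velocity of the rotation at `x + u`, hence
  -- tangent to the orbit. Only the part `w₂` over the complement of `J` has to be shown to vanish.
  set J : Finset ι := Finset.univ.filter fun j => inner ℝ (a j) u ≠ 0 with hJ
  set w₁ := p + ∑ j ∈ J, c j • b j with hw₁
  set w₂ := ∑ j ∈ Jᶜ, c j • b j with hw₂
  have hw₁𝔱 : w₁ ∈ orbitTangent 𝔱 (x + u) := by
    refine Submodule.add_mem _ hp (Submodule.sum_mem _ fun j hj => Submodule.smul_mem _ _ ?_)
    have hj' : inner ℝ (a j) u ≠ 0 := (Finset.mem_filter.1 hj).2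
    rw [← inv_smul_smul₀ hj' (b j), ← hrot j]
    exact Submodule.smul_mem _ _ (mem_orbitTangent.2 ⟨_, hS.rot_mem j, rfl⟩)
  have hsum : p + ∑ j, c j • b j = w₁ + w₂ := by
    rw [hw₁, hw₂, add_assoc, Finset.sum_add_sum_compl]
  obtain ⟨ξ, hξ, hξw⟩ := mem_orbitTangent.1 hw₁𝔱
  -- the vectors `b j` that are not tangent to the orbit are orthogonal to their complement
  have hb : ∀ j ∈ Jᶜ, ∀ z, inner ℝ (b j) z = 0 → q (b j) z = 0 := by
    intro j hj
    have hj0 : inner ℝ (a j) u = 0 := by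
      by_contra h0
      exact Finset.mem_compl.1 hj (Finset.mem_filter.2 ⟨Finset.mem_univ _, h0⟩)
    have hfix : rot (a j) (b j) (x + u) = 0 := by rw [hrot, hj0, zero_smul]
    have hinf : ∀ v w, q (rot (a j) (b j) v) w + q v (rot (a j) (b j) w) = 0 := by
      refine apply_add_apply_eq_zero fun t => ?_
      obtain ⟨A, hA, hAe⟩ := hS.lie.exp_mem _ (𝔱.smul_mem t (hS.rot_mem j))
      rw [← hAe]
      refine hinv A hA ?_
      rw [hAe]
      exact expE_smul_apply_of_apply_eq_zero hfix t
    -- Infinitesimal invariance under the rotation of plane `j`, which fixes `x + u`, tested first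
    -- on `a j` twice and then on `a j` and `z`.
    have hab : q (b j) (a j) = 0 := by
      have := hinf (a j) (a j)
      rw [hS.planes.rot_left, hsymm (a j)] at this
      linarith
    intro z hz
    have := hinf (a j) z
    rw [hS.planes.rot_left, rot_apply, hz, zero_smul, sub_zero, map_smul, hsymm (a j), hab,
      smul_zero, add_zero] at this
    exact this
  have hbz : ∀ j ∈ Jᶜ, inner ℝ (b j) (v + w₁) = 0 := by
    intro j hj
    have hj0 : inner ℝ (a j) u = 0 := by
      by_contra h0
      exact Finset.mem_compl.1 hj (Finset.mem_filter.2 ⟨Finset.mem_univ _, h0⟩)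
    rw [inner_add_right, mem_span_orthogonal.1 (mem_sliceSpace.1 hv).2 j, zero_add, ← hξw,
      ← hS.planes.rot_left j, hS.skew (hS.rot_mem j), hS.lie.comm_apply (hS.rot_mem j) hξ, hrot,
      hj0, zero_smul, map_zero, inner_zero_right, neg_zero]
  have hz2 : q (v + w₁) w₂ = 0 := by
    rw [hw₂, map_sum]
    refine Finset.sum_eq_zero fun j hj => ?_
    rw [map_smul, hsymm, hb j hj _ (hbz j hj), smul_zero]
  have hw₂v : w₂ ∈ vertical 𝔱 x b u := by
    refine Submodule.mem_sup_right (Submodule.sum_mem _ fun j _ => ?_)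
    exact Submodule.smul_mem _ _ (Submodule.subset_span ⟨j, rfl⟩)
  have h0 : q w₂ w₂ = 0 := by
    have := horth w₂ hw₂v
    rwa [hsum, ← add_assoc, map_add, add_apply, hz2, zero_add] at this
  have hw₂0 : w₂ = 0 := by
    by_contra hne
    exact (hpos _ hne).ne' h0
  exact ⟨ξ, hξ, by rw [hsum, hw₂0, add_zero, hξw]⟩

/-- The quotient metric of the horizontal spaces over the slice. -/
theorem SliceData.exists_sliceForm (hS : SliceData G 𝔱 x a b) {k : ℕ∞} {α : ℝ≥0} (hα : α ≤ 1)
    (i : E →ₗᵢ[ℝ] V) (hi : ∀ v, v ∈ sliceSpace 𝔱 x b ↔ ∃ u, i u = v)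
    {g : V → V →L[ℝ] V →L[ℝ] ℝ} (hsymm : ∀ y v w, g y v w = g y w v)
    (hpos : ∀ y v, v ≠ 0 → 0 < g y v v) (hreg : IsCkHolder k α g)
    (hinv : ∀ A ∈ G, ∀ y v w, g (A.1 y) (A.1 v) (A.1 w) = g y v w) :
    ∃ δ₀ > 0, (∀ u : E, ‖u‖ ≤ δ₀ → ∀ v : E, ∀ w ∈ vertical 𝔱 x b (i u),
        ‖v‖ + ‖w‖ ≤ 6 * ‖i v + w‖) ∧
      ∀ δ, 0 < δ → δ ≤ δ₀ → ∃ h : E → E →L[ℝ] E →L[ℝ] ℝ,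
        (∀ u v w, h u v w = h u w v) ∧ (∀ u v, v ≠ 0 → 0 < h u v v) ∧ IsCkHolder k α h ∧
        (∀ A ∈ sliceStabilizer G x (sliceSpace 𝔱 x b), ∀ B : unitary (E →L[ℝ] E),
          (∀ u, A.1 (i u) = i (B.1 u)) →
          ∀ u v w, h (B.1 u) (B.1 v) (B.1 w) = h u v w) ∧
        (∀ u, ‖u‖ ≤ δ → ∀ v, ∀ w ∈ vertical 𝔱 x b (i u),
          h u v v ≤ g (x + i u) (i v + w) (i v + w)) ∧
        (∀ u, ‖u‖ ≤ δ → ∀ v, ∃ ξ ∈ 𝔱,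
          g (x + i u) (i v + ξ (x + i u)) (i v + ξ (x + i u)) ≤ h u v v) := by
  set S := sliceSpace 𝔱 x b with hSdef
  obtain ⟨σ, hσ⟩ := hS.exists_mem_vertical_iff
  have hiS : ∀ u, i u ∈ S := fun u => (hi _).2 ⟨u, rfl⟩
  set Q : V →L[ℝ] V := Sᗮ.starProjection with hQ
  have hQmem : ∀ v, Q v ∈ Sᗮ := fun v => Submodule.starProjection_apply_mem _ _
  have hQself : ∀ v ∈ Sᗮ, Q v = v := fun v hv => Submodule.starProjection_eq_self_iff.2 hv
  set R : V →L[ℝ] V := 1 - Q with hR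
  have hRapp : ∀ v, R v = v - Q v := fun v => rfl
  set P : E → V →L[ℝ] V := fun u => (1 + σ.flip (i u)) ∘L Q with hP
  have hPapp : ∀ u v, P u v = Q v + σ (Q v) (i u) := fun u v => rfl
  have hPR : ∀ u v, P u (R v) = 0 := by
    intro u v
    have : Q (R v) = 0 := by rw [hRapp, map_sub, hQself _ (hQmem v), sub_self]
    rw [hPapp, this, map_zero, zero_add]
    rfl
  have hRR : ∀ v, R (R v) = R v := by
    intro v
    rw [hRapp (R v), hRapp v, map_sub, hQself _ (hQmem v), sub_self, sub_zero]
  have hPc : ContDiff ℝ ∞ P := by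
    have h1 : ContDiff ℝ ∞ fun u : E => σ.flip (i u) :=
      σ.flip.contDiff.comp i.toContinuousLinearMap.contDiff
    exact (contDiff_const.add h1).clm_comp contDiff_const
  have hvert : ∀ u w, w ∈ vertical 𝔱 x b (i u) ↔ ∃ v, P u v = w := by
    intro u w
    rw [hσ _ (hiS u)]
    constructor
    · rintro ⟨v, hv, rfl⟩
      exact ⟨v, by rw [hPapp, hQself v hv]⟩
    · rintro ⟨v, rfl⟩
      exact ⟨Q v, hQmem v, rfl⟩
  -- The cutoff of radius `δ ≤ δ₀` takes values of norm up to `2 * δ₀`, and there `‖σ‖ * ‖u‖ ≤ 1/2`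
  -- is needed.
  set δ₀ : ℝ := 1 / (4 * (‖σ‖ + 1)) with hδ₀
  have hσδ : ∀ u : E, ‖u‖ ≤ 2 * δ₀ → ‖σ‖ * ‖i u‖ ≤ 1 / 2 := by
    intro u hu
    rw [i.norm_map]
    have h1 : ‖σ‖ * ‖u‖ ≤ (‖σ‖ + 1) * (2 * δ₀) := by
      gcongr
      linarith
    refine h1.trans (le_of_eq ?_)
    rw [hδ₀]
    have : ‖σ‖ + 1 ≠ 0 := by positivity
    field_simp
    norm_num
  have htrans : ∀ u : E, ‖u‖ ≤ 2 * δ₀ → ∀ v : E, ∀ w ∈ vertical 𝔱 x b (i u),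
      ‖v‖ + ‖w‖ ≤ 6 * ‖i v + w‖ := by
    intro u hu v w hw
    obtain ⟨n, hn, rfl⟩ := (hσ _ (hiS u) w).1 hw
    rw [← i.norm_map v]
    exact norm_add_norm_le_of_vertical (hσδ u hu) (hiS v) hn
  have hδ₀pos : 0 < δ₀ := by positivity
  refine ⟨δ₀, hδ₀pos, fun u hu => htrans u (by linarith), fun δ hδ hδδ₀ => ?_⟩
  have hθ : ∀ u : E, ‖cutoff δ u‖ ≤ 2 * δ₀ := fun u => (norm_cutoff_le hδ u).trans (by linarith)
  set y : E → V := fun u => x + i (cutoff δ u) with hy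
  have hyc : ContDiff ℝ ∞ y :=
    contDiff_const.add (i.toContinuousLinearMap.contDiff.comp (contDiff_cutoff δ))
  have hZ : ∀ u : E, ‖u‖ ≤ 2 * δ₀ → ∀ y, (gramMap (P u) R (g y)).IsInvertible := by
    intro u hu y
    refine isInvertible_gramMap (hpos y) fun v hPv hRv => ?_
    have h1 := htrans u hu 0 _ ((hvert u _).2 ⟨v, rfl⟩)
    have h2 := norm_add_norm_le_of_vertical (hσδ u hu) (S.zero_mem) (hQmem v)
    have h3 : ‖σ (Q v) (i u)‖ ≤ 1 / 2 * ‖Q v‖ := by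
      refine ((σ _).le_opNorm _).trans ?_
      have h4 : ‖σ (Q v)‖ * ‖i u‖ ≤ ‖σ‖ * ‖Q v‖ * ‖i u‖ := by
        gcongr
        exact σ.le_opNorm _
      have := hσδ u hu
      nlinarith [norm_nonneg (Q v)]
    have h5 : Q v = - σ (Q v) (i u) := eq_neg_of_add_eq_zero_left hPv
    have h6 : ‖Q v‖ = 0 := by
      have : ‖Q v‖ = ‖σ (Q v) (i u)‖ := by
        conv_lhs => rw [h5, norm_neg]
      have := norm_nonneg (Q v)
      linarith
    rw [hRapp, norm_eq_zero.1 h6, sub_zero] at hRv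
    exact hRv
  set H : E → E →L[ℝ] V := fun u =>
    horizontalMap i.toContinuousLinearMap (P (cutoff δ u)) R (g (y u)) with hH
  have hspec : ∀ u v, (∃ w ∈ vertical 𝔱 x b (i (cutoff δ u)), H u v = i v + w) ∧
      ∀ w ∈ vertical 𝔱 x b (i (cutoff δ u)), g (y u) (H u v) w = 0 := by
    intro u v
    obtain ⟨⟨w, hw⟩, h2⟩ := horizontalMap_spec (i := i.toContinuousLinearMap)
      (hZ _ (hθ u) (y u)) (hPR (cutoff δ u)) hRR v
    refine ⟨⟨-P (cutoff δ u) w, Submodule.neg_mem _ ((hvert _ _).2 ⟨w, rfl⟩), ?_⟩, ?_⟩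
    · rw [← sub_eq_add_neg]
      exact hw
    · intro w hw
      obtain ⟨w', rfl⟩ := (hvert _ _).1 hw
      exact h2 w'
  -- The horizontal lift is characterized by its class and its orthogonality; the invariance of `h`
  -- follows because the group carries one lift to another.
  have huniq : ∀ u v, ∀ w ∈ vertical 𝔱 x b (i (cutoff δ u)),
      (∀ w' ∈ vertical 𝔱 x b (i (cutoff δ u)), g (y u) (i v + w) w' = 0) → H u v = i v + w := by
    intro u v w hw h0
    obtain ⟨⟨w₁, hw₁, he⟩, h1⟩ := hspec u v
    have hd : w₁ - w ∈ vertical 𝔱 x b (i (cutoff δ u)) := Submodule.sub_mem _ hw₁ hw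
    have h2 : g (y u) (w₁ - w) (w₁ - w) = 0 := by
      have h3 := h1 _ hd
      have h4 := h0 _ hd
      have h5 : w₁ - w = (i v + w₁) - (i v + w) := by abel
      have h6 : ∀ p, g (y u) (w₁ - w) p = g (y u) (H u v) p - g (y u) (i v + w) p := fun p => by
        rw [he, h5, map_sub, sub_apply]
      rw [h6, h3, h4, sub_zero]
    have h3 : w₁ - w = 0 := by
      by_contra hne
      exact (hpos _ _ hne).ne' h2
    rw [he, sub_eq_zero.1 h3]
  refine ⟨fun u => (g (y u)).bilinearComp (H u) (H u), fun u v w => hsymm _ _ _, ?_, ?_, ?_, ?_, ?_⟩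
  · intro u v hv
    change 0 < g (y u) (H u v) (H u v)
    refine hpos _ _ fun h0 => hv ?_
    obtain ⟨⟨w, hw, he⟩, -⟩ := hspec u v
    have := htrans _ (hθ u) v w hw
    rw [← he, h0, norm_zero, mul_zero] at this
    have h1 := norm_nonneg w
    have h2 := norm_nonneg v
    exact norm_eq_zero.1 (by linarith)
  · exact isCkHolder_horizontalForm hα i.toContinuousLinearMap R hPc
      (hreg.comp_contDiff hα hyc) (isCkHolder_of_contDiff hα (contDiff_cutoff δ) k)
      fun u => hZ _ (hθ u) (y u)
  · intro A hA B hAB u v w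
    have hyB : y (B.1 u) = A.1 (y u) := by
      rw [hy]
      change x + i (cutoff δ (B.1 u)) = A.1 (x + i (cutoff δ u))
      rw [cutoff_unitary, ← hAB, map_add, hA.2.1]
    have hHB : ∀ v, H (B.1 u) (B.1 v) = A.1 (H u v) := by
      intro v
      obtain ⟨⟨w, hw, he⟩, h1⟩ := hspec u v
      have hc : i (cutoff δ (B.1 u)) = A.1 (i (cutoff δ u)) := by rw [cutoff_unitary, hAB]
      rw [he, map_add, hAB]
      refine huniq _ _ _ ?_ ?_
      · rw [hc]
        exact hS.apply_mem_vertical hA hw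
      · intro w' hw'
        rw [hc] at hw'
        have h2 := hS.apply_mem_vertical (Subgroup.inv_mem _ hA) hw'
        rw [unitary_inv_apply_apply] at h2
        have h3 := h1 _ h2
        rw [he, ← hinv A hA.1, ← hyB, unitary_apply_inv_apply, map_add, hAB] at h3
        exact h3
    change g (y (B.1 u)) (H (B.1 u) (B.1 v)) (H (B.1 u) (B.1 w)) = g (y u) (H u v) (H u w)
    rw [hHB, hHB, hyB, hinv A hA.1]
  · intro u hu v w hw
    have hc : cutoff δ u = u := cutoff_of_norm_le hδ hu
    have hyu : y u = x + i u := by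
      change x + i (cutoff δ u) = _
      rw [hc]
    obtain ⟨⟨w₁, hw₁, he⟩, h1⟩ := hspec u v
    rw [hc] at hw₁ h1
    -- Pythagoras: the horizontal lift is the shortest vector in its class modulo the vertical
    -- space.
    have hd := Submodule.sub_mem _ hw hw₁
    have h2 : i v + w = H u v + (w - w₁) := by
      rw [he]
      abel
    change g (y u) (H u v) (H u v) ≤ _
    rw [← hyu, h2]
    have h3 := h1 _ hd
    have h4 : 0 ≤ g (y u) (w - w₁) (w - w₁) := by
      by_cases h0 : w - w₁ = 0
      · rw [h0, map_zero]
      · exact (hpos _ _ h0).le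
    rw [map_add, map_add, add_apply, add_apply, h3, hsymm _ (w - w₁) (H u v), h3]
    linarith
  · intro u hu v
    have hc : cutoff δ u = u := cutoff_of_norm_le hδ hu
    have hyu : y u = x + i u := by
      change x + i (cutoff δ u) = _
      rw [hc]
    obtain ⟨⟨w₁, hw₁, he⟩, h1⟩ := hspec u v
    rw [hc] at hw₁ h1
    rw [he] at h1
    -- The minimum is attained by a correction along the orbit alone, so the enlargement by the `b
    -- j` does not make the form smaller than the quotient metric.
    obtain ⟨ξ, hξ, hw⟩ := hS.exists_eq_add_of_orthogonal (hsymm (y u)) (hpos (y u)) (hiS u)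
      (fun A hA hfix v w => by
        have := hinv A hA (y u) v w
        rw [hyu] at this ⊢
        rwa [hfix] at this) (hiS v) hw₁ h1
    refine ⟨ξ, hξ, le_of_eq ?_⟩
    rw [← hw, ← he, ← hyu]
    rfl

end SliceForm

/-! ### The finite group of the slice and the first-order projection to it -/

section SliceGroup

variable {E V : Type} [NormedAddCommGroup E] [InnerProductSpace ℝ E] [FiniteDimensional ℝ E]
  [CompleteSpace E]
  [NormedAddCommGroup V] [InnerProductSpace ℝ V] [FiniteDimensional ℝ V] [CompleteSpace V]
  {ι : Type} [Fintype ι]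
  {G : Subgroup (unitary (V →L[ℝ] V))} {𝔱 : Submodule ℝ (V →L[ℝ] V)} {x : V} {a b : ι → V}

theorem exists_unitary_restrict (i : E →ₗᵢ[ℝ] V) {A : unitary (V →L[ℝ] V)}
    (hA : ∀ u, ∃ u', A.1 (i u) = i u') : ∃ B : unitary (E →L[ℝ] E), ∀ u, A.1 (i u) = i (B.1 u) := by
  choose f hf using hA
  have hadd : ∀ u v, f (u + v) = f u + f v := fun u v => i.injective <| by
    rw [← hf, map_add, map_add, map_add, hf, hf]
  have hsmul : ∀ (c : ℝ) u, f (c • u) = c • f u := fun c u => i.injective <| by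
    rw [← hf, map_smul, map_smul, map_smul, hf]
  let L : E →ₗᵢ[ℝ] E :=
    { toFun := f
      map_add' := hadd
      map_smul' := hsmul
      norm_map' := fun u => by
        change ‖f u‖ = _
        rw [← i.norm_map, ← hf, norm_unitary_apply, i.norm_map] }
  exact ⟨Unitary.linearIsometryEquiv.symm (L.toLinearIsometryEquiv rfl), fun u => hf u⟩

/-- The group of the isometries of `E` that are induced by elements of `H` via `i`. -/
def inducedGroup (i : E →ₗᵢ[ℝ] V) (H : Subgroup (unitary (V →L[ℝ] V))) :
    Subgroup (unitary (E →L[ℝ] E)) where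
  carrier := {B | ∃ A ∈ H, ∀ u, A.1 (i u) = i (B.1 u)}
  mul_mem' := by
    rintro B B' ⟨A, hA, h⟩ ⟨A', hA', h'⟩
    refine ⟨A * A', H.mul_mem hA hA', fun u => ?_⟩
    change A.1 (A'.1 (i u)) = i (B.1 (B'.1 u))
    rw [h', h]
  one_mem' := ⟨1, H.one_mem, fun _ => rfl⟩
  inv_mem' := by
    rintro B ⟨A, hA, h⟩
    refine ⟨A⁻¹, H.inv_mem hA, fun u => ?_⟩
    conv_lhs => rw [← unitary_apply_inv_apply B u, ← h]
    exact unitary_inv_apply_apply A _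

theorem finite_inducedGroup (i : E →ₗᵢ[ℝ] V) (H : Subgroup (unitary (V →L[ℝ] V))) [Finite H] :
    Finite (inducedGroup i H) := by
  have h : ∀ B : inducedGroup i H, ∃ A : H, ∀ u, A.1.1 (i u) = i (B.1.1 u) := by
    rintro ⟨B, A, hA, h⟩
    exact ⟨⟨A, hA⟩, h⟩
  choose f hf using h
  refine Finite.of_injective f fun B B' hBB => ?_
  refine Subtype.ext (Subtype.ext (ContinuousLinearMap.ext fun u => i.injective ?_))
  rw [← hf, ← hf, hBB]

theorem exists_mem_inducedGroup {i : E →ₗᵢ[ℝ] V} {S : Submodule ℝ V}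
    (hi : ∀ v, v ∈ S ↔ ∃ u, i u = v) {A : unitary (V →L[ℝ] V)} (hA : A ∈ sliceStabilizer G x S) :
    ∃ B ∈ inducedGroup i (sliceStabilizer G x S), ∀ u, A.1 (i u) = i (B.1 u) := by
  obtain ⟨B, hB⟩ := exists_unitary_restrict i (A := A) fun u => by
    obtain ⟨u', hu'⟩ := (hi _).1 ((hA.2.2 (i u)).2 ((hi _).2 ⟨u, rfl⟩))
    exact ⟨u', hu'.symm⟩
  exact ⟨B, ⟨A, hA, hB⟩, hB⟩

theorem SliceData.exists_inducedGroup_apply_eq (hS : SliceData G 𝔱 x a b) {i : E →ₗᵢ[ℝ] V}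
    (hi : ∀ v, v ∈ sliceSpace 𝔱 x b ↔ ∃ u, i u = v) {A : unitary (V →L[ℝ] V)} (hA : A ∈ G)
    (hAx : A.1 x = x) {u u' : E} (h : A.1 (x + i u) = x + i u') :
    ∃ C ∈ sliceStabilizer G x (sliceSpace 𝔱 x b),
      ∃ B ∈ inducedGroup i (sliceStabilizer G x (sliceSpace 𝔱 x b)),
        (∀ v, C.1 (i v) = i (B.1 v)) ∧ B.1 u = u' := by
  rw [map_add, hAx, add_right_inj] at h
  obtain ⟨C, hC, hCu⟩ := hS.exists_mem_sliceStabilizer hA hAx ((hi _).2 ⟨u, rfl⟩)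
    ((hi _).2 ⟨u', rfl⟩) h
  obtain ⟨B, hB, hCB⟩ := exists_mem_inducedGroup hi hC
  exact ⟨C, hC, B, hB, hCB, i.injective (by rw [← hCB, hCu])⟩

/-- The differential of the projection of a neighbourhood of a point of the slice to the slice. -/
theorem SliceData.eventually_exists_near (hS : SliceData G 𝔱 x a b) {i : E →ₗᵢ[ℝ] V}
    (hi : ∀ v, v ∈ sliceSpace 𝔱 x b ↔ ∃ u, i u = v) {δ : ℝ}
    (hfix : ∀ A ∈ G, ∀ u u' : E, ‖u‖ ≤ δ → ‖u'‖ ≤ δ → A.1 (x + i u) = x + i u' → A.1 x = x)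
    {u₀ : E} (hu₀ : ‖u₀‖ ≤ δ)
    (htrans : ∀ v : E, ∀ w ∈ vertical 𝔱 x b (i u₀), ‖v‖ + ‖w‖ ≤ 6 * ‖i v + w‖) {ε : ℝ}
    (hε : 0 < ε) :
    ∀ᶠ z in 𝓝 (x + i u₀), ∀ A ∈ G, ∀ u' : E, ‖u'‖ ≤ δ → A.1 z = x + i u' →
      ∃ B ∈ inducedGroup i (sliceStabilizer G x (sliceSpace 𝔱 x b)), ∃ C ∈ G,
        ∃ w ∈ vertical 𝔱 x b (i u₀), C.1 (x + i u₀) = x + i u₀ ∧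
        ‖(i (B.1 u' - u₀) + w) - C.1 (z - (x + i u₀))‖ ≤ ε * ‖z - (x + i u₀)‖ ∧
        ‖B.1 u' - u₀‖ ≤ 12 * ‖z - (x + i u₀)‖ := by
  set y := x + i u₀ with hy
  -- The linearization error is `2 * ε₁ * (‖v‖ + ‖w‖)`, with `‖v‖ + ‖w‖ ≤ 6 * ‖i v + w‖` by
  -- transversality. The bound `1/24` yields `‖i v + w‖ ≤ 2 * ‖z - y‖`; then the total error is `24
  -- * ε₁ * ‖z - y‖`.
  set ε₁ : ℝ := min (1 / 24) (ε / 24) with hε₁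
  have hε₁pos : 0 < ε₁ := by positivity
  have hε₁a : ε₁ ≤ 1 / 24 := min_le_left _ _
  have hε₁b : 24 * ε₁ ≤ ε := by
    have := min_le_right (1 / 24) (ε / 24)
    linarith
  obtain ⟨η, hη, hest⟩ := exists_norm_exp_apply_sub_le (V := V) hε₁pos
  have hK : IsCompact ((fun u : E => x + i u) '' Metric.closedBall 0 δ) :=
    (isCompact_closedBall _ _).image (continuous_const.add i.continuous)
  obtain ⟨ρ, hρ, hnear⟩ := hS.lie.exists_mul_of_near hS.compact y hK (lt_min hη hε₁pos)
  filter_upwards [Metric.ball_mem_nhds y hρ] with z hz A hA u' hu' hAz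
  rw [Metric.mem_ball, dist_eq_norm] at hz
  obtain ⟨ξ, hξ, C, hC, hξn, hAe, ⟨u₁, hu₁, hu₁y⟩, -⟩ := hnear A hA (x + i u')
    ⟨u', by simpa using hu', rfl⟩ (by
      rw [← hAz, ← map_sub, norm_unitary_apply, norm_sub_rev]
      exact hz)
  rw [mem_closedBall_zero_iff] at hu₁
  -- `C` carries one point of the slice exactly to another, so it fixes `x` and acts on `u₀` like an
  -- element `D` of the finite group; then `D⁻¹ * C` fixes `y`.
  have hCx : C.1 x = x := hfix C hC u₀ u₁ hu₀ hu₁ hu₁y.symm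
  obtain ⟨D, hD, B, hB, hDB, hBu⟩ := hS.exists_inducedGroup_apply_eq hi hC hCx hu₁y.symm
  have hDx : D.1 x = x := hD.2.1
  have hDσ : ∀ u, D.1 (x + i u) = x + i (B.1 u) := fun u => by rw [map_add, hDx, hDB]
  have hDσ' : ∀ u, D⁻¹.1 (x + i u) = x + i (B⁻¹.1 u) := fun u => by
    conv_lhs => rw [← unitary_apply_inv_apply B u, ← hDσ]
    exact unitary_inv_apply_apply D _
  obtain ⟨ζ, hζ, hDζ⟩ := hS.lie.exists_conj' (G.inv_mem hD.1) hξ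
  set v := B⁻¹.1 u' - u₀ with hv
  have hCy : (D⁻¹ * C).1 y = y := by
    change D⁻¹.1 (C.1 y) = y
    rw [← hu₁y]
    change D⁻¹.1 (x + i u₁) = y
    rw [hDσ', ← hBu, unitary_inv_apply_apply]
  have hζn : ∀ p, ‖ζ p‖ ≤ ε₁ * ‖p‖ := by
    intro p
    have h1 := hDζ (D.1 p)
    rw [unitary_inv_apply_apply] at h1
    rw [← h1, norm_unitary_apply, ← norm_unitary_apply D p]
    refine (ξ.le_opNorm _).trans ?_
    gcongr
    exact hξn.le.trans (min_le_right _ _)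
  -- the displacement of the orbit
  have hkey : ‖(D⁻¹ * C).1 z - (y + i v) + ζ (y + i v)‖ ≤ ε₁ * ‖ζ (y + i v)‖ := by
    have hyv : y + i v = D⁻¹.1 (x + i u') := by
      rw [hDσ', hy, hv, map_sub]
      abel
    have h1 : C.1 z = expE (-ξ) (x + i u') := by
      have h2 : expE (-ξ) * expE ξ = 1 := by
        rw [← expE_add ((Commute.refl ξ).neg_left), neg_add_cancel, expE_zero]
      rw [← hAz, hAe]
      change _ = (expE (-ξ) * expE ξ) (C.1 z)
      rw [h2]
      rfl
    have h3 := (hest (-ξ) (by rw [norm_neg]; exact hξn.trans_le (min_le_left _ _))).2 (x + i u')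
    have h4 : ∀ p, (-ξ) p = - ξ p := fun p => rfl
    rw [h4, norm_neg, sub_neg_eq_add, ← h1, ← norm_unitary_apply D⁻¹, map_add, map_sub, hDζ,
      ← norm_unitary_apply D⁻¹ (ξ _), hDζ, ← hyv] at h3
    exact h3
  have hw : - ζ y ∈ vertical 𝔱 x b (i u₀) :=
    Submodule.neg_mem _ (Submodule.mem_sup_left (mem_orbitTangent.2 ⟨ζ, hζ, rfl⟩))
  set w := - ζ y with hwdef
  have hCz : (D⁻¹ * C).1 (z - y) = (D⁻¹ * C).1 z - y := by rw [map_sub, hCy]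
  have hdiff : ‖(i v + w) - (D⁻¹ * C).1 (z - y)‖ ≤ 2 * ε₁ * (‖v‖ + ‖w‖) := by
    have h1 : (i v + w) - (D⁻¹ * C).1 (z - y) =
        ζ (i v) - ((D⁻¹ * C).1 z - (y + i v) + ζ (y + i v)) := by
      rw [hCz, hwdef, show ζ (y + i v) = ζ y + ζ (i v) from map_add _ _ _]
      abel
    have h2 : ‖ζ (i v)‖ ≤ ε₁ * ‖v‖ := by
      rw [← i.norm_map v]
      exact hζn _
    have h3 : ‖ζ (y + i v)‖ ≤ ‖w‖ + ε₁ * ‖v‖ := by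
      rw [map_add, hwdef, norm_neg]
      exact (norm_add_le _ _).trans (by linarith)
    rw [h1]
    refine (norm_sub_le _ _).trans ?_
    have h4 := mul_le_mul_of_nonneg_left h3 hε₁pos.le
    have h5 : ε₁ * (ε₁ * ‖v‖) ≤ 1 * (ε₁ * ‖v‖) := by
      gcongr
      linarith
    have h6 := mul_nonneg hε₁pos.le (norm_nonneg w)
    linarith
  have hn : ‖(D⁻¹ * C).1 (z - y)‖ = ‖z - y‖ := norm_unitary_apply _ _
  have htr := htrans v w hw
  have hbound : ‖i v + w‖ ≤ 2 * ‖z - y‖ := by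
    have h1 := norm_sub_norm_le (i v + w) ((D⁻¹ * C).1 (z - y))
    rw [hn] at h1
    have h2 : 2 * ε₁ * (‖v‖ + ‖w‖) ≤ 2 * (1 / 24) * (6 * ‖i v + w‖) := by gcongr
    linarith
  refine ⟨B⁻¹, Subgroup.inv_mem _ hB, D⁻¹ * C, G.mul_mem (G.inv_mem hD.1) hC, w, hw, hCy, ?_, ?_⟩
  · refine hdiff.trans ?_
    have h2 : 2 * ε₁ * (‖v‖ + ‖w‖) ≤ 2 * ε₁ * (6 * (2 * ‖z - y‖)) := by
      gcongr
      exact htr.trans (by gcongr)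
    refine h2.trans ?_
    have h3 := mul_le_mul_of_nonneg_right hε₁b (norm_nonneg (z - y))
    linarith
  · have := norm_nonneg w
    change ‖v‖ ≤ _
    linarith

end SliceGroup

/-! ### From infinitesimal comparison to a local isometry of orbit spaces -/

section Chart

variable {k : ℕ∞} {α : ℝ≥0} {m n : ℕ}

namespace CkMetric

theorem continuousOn_speed (g : CkMetric k α m) {c : ℝ → Eucl m} (hc : ContDiffOn ℝ 1 c (Icc 0 1)) :
    ContinuousOn (fun t => √(g (c t) (derivWithin c (Icc 0 1) t) (derivWithin c (Icc 0 1) t)))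
      (Icc 0 1) := by
  have h1 : ContinuousOn (fun t => g (c t)) (Icc 0 1) :=
    g.continuous.comp_continuousOn hc.continuousOn
  have h2 : ContinuousOn (derivWithin c (Icc 0 1)) (Icc 0 1) :=
    hc.continuousOn_derivWithin (uniqueDiffOn_Icc zero_lt_one) le_rfl
  exact ((h1.clm_apply h2).clm_apply h2).sqrt

theorem sqrt_apply_le_of_norm_sub_le (g : CkMetric k α m) (y : Eucl m) (v w : Eucl m) {r : ℝ}
    (h : ‖v - w‖ ≤ r) : √(g y v v) ≤ √(g y w w) + √‖g y‖ * r := by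
  have h1 : v = w + (v - w) := by abel
  have h2 := sqrt_form_add_le (b := g y) (g.symm y) (g.nonneg y) w (v - w)
  rw [← h1] at h2
  refine h2.trans (add_le_add le_rfl ((sqrt_form_le (b := g y) (v - w)).trans ?_))
  gcongr

end CkMetric

/-- Local data that make `u ↦ G (s u)` a chart of `(ℝ^m, g)/G` with values in `(ℝ^n, h)/Γ`. -/
structure SliceChart (g : CkMetric k α m) (G : Subgroup (Orth m)) (h : CkMetric k α n)
    (Γ : Subgroup (Orth n)) (s : Eucl n → Eucl m) (δ : ℝ) : Prop where
  pos : 0 < δ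
  exists_slice : ∀ z, ∃ A ∈ G, ∃ u, A.1 z = s u ∧ ‖u‖ ≤ ‖z - s 0‖
  lift : ∀ B ∈ Γ, ∀ u, ∃ A ∈ G, A.1 (s u) = s (B.1 u)
  unique : ∀ A ∈ G, ∀ u u', ‖u‖ < δ → ‖u'‖ < δ → A.1 (s u) = s u' → ∃ B ∈ Γ, B.1 u = u'
  lift_speed : ∀ (c : ℝ → Eucl n) (I : Set ℝ) (t : ℝ) (v : Eucl n), HasDerivWithinAt c v I t →
    ‖c t‖ < δ → ∀ ε : ℝ, 0 < ε → ∀ᶠ r in 𝓝[I] t, ∃ A ∈ G,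
      g.riemDist (s (c t)) (A.1 (s (c r))) ≤ ENNReal.ofReal ((√(h (c t) v v) + ε) * |r - t|)
  proj_speed : ∀ u₀, ‖u₀‖ < δ → ∀ ε : ℝ, 0 < ε → ∀ᶠ z in 𝓝 (s u₀), ∀ A ∈ G, ∀ u', ‖u'‖ < δ →
    A.1 z = s u' → ∃ B ∈ Γ, h.riemDist u₀ (B.1 u') ≤
      ENNReal.ofReal (√(g (s u₀) (z - s u₀) (z - s u₀)) + ε * ‖z - s u₀‖)

namespace SliceChart

variable {g : CkMetric k α m} {G : Subgroup (Orth m)} {h : CkMetric k α n}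
  {Γ : Subgroup (Orth n)} {s : Eucl n → Eucl m} {δ : ℝ}
 {hG : IsCompact (G : Set (Orth m))} {hg : g.IsInvariant G}
  {hΓ : IsCompact (Γ : Set (Orth n))} {hh : h.IsInvariant Γ}

local notation "πX" => (OrbitSpace.proj : Eucl m → OrbitSpace g G hG hg)
local notation "πY" => (OrbitSpace.proj : Eucl n → OrbitSpace h Γ hΓ hh)

theorem proj_eq_of_proj_eq (hs : SliceChart g G h Γ s δ) {u u' : Eucl n} (he : πY u = πY u') : πX (s u) = πX (s u') := by
  obtain ⟨B, hB, rfl⟩ := OrbitSpace.proj_eq_iff.1 he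
  exact OrbitSpace.proj_eq_iff.2 (hs.lift B hB u)

theorem proj_eq_of_proj_slice_eq (hs : SliceChart g G h Γ s δ) {u u' : Eucl n} (hu : ‖u‖ < δ) (hu' : ‖u'‖ < δ)
    (he : πX (s u) = πX (s u')) : πY u = πY u' := by
  obtain ⟨A, hA, hAu⟩ := OrbitSpace.proj_eq_iff.1 he
  exact OrbitSpace.proj_eq_iff.2 (hs.unique A hA u u' hu hu' hAu)

theorem edist_slice_le (hs : SliceChart g G h Γ s δ) {c : ℝ → Eucl n} (hc : ContDiffOn ℝ 1 c (Icc 0 1))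
    (hcδ : ∀ t ∈ Icc (0 : ℝ) 1, ‖c t‖ < δ) :
    edist (πX (s (c 0))) (πX (s (c 1))) ≤ ∫⁻ t in Icc (0 : ℝ) 1, ENNReal.ofReal
      (√(h (c t) (derivWithin c (Icc 0 1) t) (derivWithin c (Icc 0 1) t))) := by
  refine edist_le_lintegral_of_speed_le (γ := fun t => πX (s (c t))) (h.continuousOn_speed hc)
    (fun _ _ => Real.sqrt_nonneg _) fun t ht ε hε => ?_
  filter_upwards [hs.lift_speed c (Icc 0 1) t _
    (hc.differentiableOn one_ne_zero t ht).hasDerivWithinAt (hcδ t ht) ε hε] with r hr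
  obtain ⟨A, hA, hle⟩ := hr
  have he : πX (s (c r)) = πX (A.1 (s (c r))) := OrbitSpace.proj_eq_iff.2 ⟨A, hA, rfl⟩
  rw [he]
  refine le_of_forall_gt fun q hq => ?_
  exact (OrbitSpace.edist_proj_lt_iff _ _ _).2 ⟨_, rfl, hle.trans_lt hq⟩

/-- The representatives `U t` in the slice are arbitrary and need not depend continuously on `t`;
the first-order estimate holds for all of them simultaneously. -/
theorem edist_proj_le (hs : SliceChart g G h Γ s δ) {c : ℝ → Eucl m} (hc : ContDiffOn ℝ 1 c (Icc 0 1)) {U : ℝ → Eucl n}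
    (hU : ∀ t ∈ Icc (0 : ℝ) 1, ‖U t‖ < δ ∧ πX (c t) = πX (s (U t))) :
    edist (πY (U 0)) (πY (U 1)) ≤ ∫⁻ t in Icc (0 : ℝ) 1, ENNReal.ofReal
      (√(g (c t) (derivWithin c (Icc 0 1) t) (derivWithin c (Icc 0 1) t))) := by
  refine edist_le_lintegral_of_speed_le (γ := fun t => πY (U t)) (g.continuousOn_speed hc)
    (fun _ _ => Real.sqrt_nonneg _) fun t ht ε hε => ?_
  obtain ⟨hUt, hct⟩ := hU t ht
  obtain ⟨A, hA, hAc⟩ := OrbitSpace.proj_eq_iff.1 hct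
  set v := derivWithin c (Icc 0 1) t with hv
  have hd : HasDerivWithinAt c v (Icc 0 1) t :=
    (hc.differentiableOn one_ne_zero t ht).hasDerivWithinAt
  have hk : HasDerivWithinAt (fun r => A.1 (c r)) (A.1 v) (Icc 0 1) t :=
    A.1.hasFDerivAt.comp_hasDerivWithinAt t hd
  -- The supremum over all slice representatives of the orbit of `z` makes the bound independent of
  -- the choice of `U`.
  set D : Eucl m → ℝ≥0∞ := fun z => ⨆ (u' : Eucl n) (_ : ‖u'‖ < δ) (_ : πX z = πX (s u')),
    edist (πY (U t)) (πY u') with hD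
  have hDbound : ∀ ε : ℝ, 0 < ε → ∀ᶠ z in 𝓝 (A.1 (c t)), D z ≤
      ENNReal.ofReal (√(g (s (U t)) (z - A.1 (c t)) (z - A.1 (c t))) + ε * ‖z - A.1 (c t)‖) := by
    intro ε hε
    rw [hAc]
    filter_upwards [hs.proj_speed (U t) hUt ε hε] with z hz
    refine iSup_le fun u' => iSup_le fun hu' => iSup_le fun hzu => ?_
    obtain ⟨C, hC, hCz⟩ := OrbitSpace.proj_eq_iff.1 hzu
    obtain ⟨B, hB, hle⟩ := hz C hC u' hu' hCz
    have he : πY u' = πY (B.1 u') := OrbitSpace.proj_eq_iff.2 ⟨B, hB, rfl⟩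
    rw [he]
    refine le_of_forall_gt fun q hq => ?_
    exact (OrbitSpace.edist_proj_lt_iff _ _ _).2 ⟨_, rfl, hle.trans_lt hq⟩
  have hmain := eventually_le_of_hasDerivWithinAt (b := g (s (U t))) (g.symm _) (g.nonneg _) hk
    hDbound hε
  have hspeed : g (s (U t)) (A.1 v) (A.1 v) = g (c t) v v := by rw [← hAc, hg A hA]
  rw [hspeed] at hmain
  filter_upwards [hmain, self_mem_nhdsWithin] with r hr hrI
  refine le_trans ?_ hr
  obtain ⟨hUr, hcr⟩ := hU r hrI
  have he : πX (A.1 (c r)) = πX (s (U r)) := by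
    rw [← hcr]
    exact (OrbitSpace.proj_eq_iff.2 ⟨A, hA, rfl⟩).symm
  exact le_iSup_of_le (U r) (le_iSup_of_le hUr (le_iSup_of_le he le_rfl))

/-- `u ↦ G (s u)` induces a local isometry of the orbit spaces. -/
theorem exists_isometry (hs : SliceChart g G h Γ s δ) : ∃ ε : ℝ≥0∞, 0 < ε ∧
    ∃ φ : Metric.eball (πX (s 0)) ε → OrbitSpace h Γ hΓ hh, Isometry φ ∧ IsOpen (range φ) := by
  obtain ⟨c₁, hc₁, hc₁δ⟩ := g.exists_riemDist_lt_subset (s 0) (Metric.ball_mem_nhds (s 0) hs.pos)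
  obtain ⟨c₂, hc₂, hc₂δ⟩ := h.exists_riemDist_lt_subset 0 (Metric.ball_mem_nhds 0 hs.pos)
  -- Points of the `ε`-ball are at distance less than `2 ε`, and almost minimal curves between them,
  -- started within `ε` of the base point, stay within `3 ε`, where slice representatives exist.
  obtain ⟨ε, hε, hε1, hε₁, hε₂⟩ : ∃ ε : ℝ≥0∞, 0 < ε ∧ ε ≠ ⊤ ∧ ε + (ε + ε) ≤ c₁ ∧
      ε + (ε + ε) ≤ c₂ := by
    have hc : min (min c₁ c₂) 1 ≠ ⊤ := (min_lt_of_right_lt ENNReal.one_lt_top).ne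
    refine ⟨min (min c₁ c₂) 1 / 3, ?_, ?_, ?_, ?_⟩
    · exact ENNReal.div_pos (by simp [hc₁.ne', hc₂.ne']) (by simp)
    · exact ENNReal.div_ne_top hc (by simp)
    · rw [← add_assoc, ENNReal.add_thirds]
      exact (min_le_left _ _).trans (min_le_left _ _)
    · rw [← add_assoc, ENNReal.add_thirds]
      exact (min_le_left _ _).trans (min_le_right _ _)
  have hε₁' : ε ≤ c₁ := le_self_add.trans hε₁
  have hε₂' : ε ≤ c₂ := le_self_add.trans hε₂
  -- points near the base point have representatives in the slice
  have hrep : ∀ z, g.riemDist (s 0) z < c₁ → ∃ u, ‖u‖ < δ ∧ πX z = πX (s u) := by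
    intro z hz
    obtain ⟨A, hA, u, hAz, hu⟩ := hs.exists_slice z
    refine ⟨u, hu.trans_lt ?_, OrbitSpace.proj_eq_iff.2 ⟨A, hA, hAz⟩⟩
    rw [← dist_eq_norm]
    exact hc₁δ z hz
  have hrep₂ : ∀ u, h.riemDist 0 u < c₂ → ‖u‖ < δ := by
    intro u hu
    have := hc₂δ u hu
    rwa [mem_ball_zero_iff] at this
  -- the projection to the slice does not increase the lengths of short curves
  have hA : ∀ u u', ‖u‖ < δ → ‖u'‖ < δ → edist (πX (s 0)) (πX (s u)) < ε →
      ∀ r ≤ ε + ε, edist (πX (s u)) (πX (s u')) < r → edist (πY u) (πY u') < r := by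
    intro u u' hu hu' hu0 r hr hlt
    obtain ⟨z, hz, hz0⟩ := (OrbitSpace.edist_proj_lt_iff _ _ _).1 hu0
    rw [← hz] at hlt
    obtain ⟨z', hz', hzz⟩ := (OrbitSpace.edist_proj_lt_iff _ _ _).1 hlt
    obtain ⟨c, h0, h1, hc, hl⟩ := (g.riemDist_lt_iff z z' r).1 hzz
    have hcr : ∀ t ∈ Icc (0 : ℝ) 1, ∃ w, ‖w‖ < δ ∧ πX (c t) = πX (s w) := by
      intro t ht
      refine hrep _ ?_
      refine (g.riemDist_triangle (s 0) z (c t)).trans_lt (lt_of_lt_of_le ?_ hε₁)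
      refine ENNReal.add_lt_add hz0 (lt_of_lt_of_le ?_ hr)
      rw [← h0]
      exact (g.riemDist_curve_le hc ht).trans_lt hl
    choose! U hUδ hUc using hcr
    have hle := hs.edist_proj_le (hΓ := hΓ) (hh := hh) hc (U := U) fun t ht => ⟨hUδ t ht, hUc t ht⟩
    have i0 : (0 : ℝ) ∈ Icc (0 : ℝ) 1 := ⟨le_rfl, zero_le_one⟩
    have i1 : (1 : ℝ) ∈ Icc (0 : ℝ) 1 := ⟨zero_le_one, le_rfl⟩
    have e0 : πY (U 0) = πY u := hs.proj_eq_of_proj_slice_eq (hUδ 0 i0) hu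
      (by rw [← hUc 0 i0, h0, hz])
    have e1 : πY (U 1) = πY u' := hs.proj_eq_of_proj_slice_eq (hUδ 1 i1) hu'
      (by rw [← hUc 1 i1, h1, hz'])
    rw [e0, e1] at hle
    exact hle.trans_lt hl
  -- Conversely, short curves in the slice stay in the domain of `s` where their images in the orbit
  -- space are no longer than they are.
  have hB : ∀ u u', edist (πY 0) (πY u) < ε → ∀ r ≤ ε + ε, edist (πY u) (πY u') < r →
      edist (πX (s u)) (πX (s u')) < r := by
    intro u u' hu0 r hr hlt
    obtain ⟨z, hz, hz0⟩ := (OrbitSpace.edist_proj_lt_iff _ _ _).1 hu0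
    rw [← hz] at hlt
    obtain ⟨z', hz', hzz⟩ := (OrbitSpace.edist_proj_lt_iff _ _ _).1 hlt
    obtain ⟨c, h0, h1, hc, hl⟩ := (h.riemDist_lt_iff z z' r).1 hzz
    have hle := hs.edist_slice_le (hG := hG) (hg := hg) hc fun t ht => by
      refine hrep₂ _ ?_
      refine (h.riemDist_triangle 0 z (c t)).trans_lt (lt_of_lt_of_le ?_ hε₂)
      refine ENNReal.add_lt_add hz0 (lt_of_lt_of_le ?_ hr)
      rw [← h0]
      exact (h.riemDist_curve_le hc ht).trans_lt hl
    rw [h0, h1, hs.proj_eq_of_proj_eq (hG := hG) (hg := hg) hz,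
      hs.proj_eq_of_proj_eq (hG := hG) (hg := hg) hz'] at hle
    exact hle.trans_lt hl
  have hzero : ‖(0 : Eucl n)‖ < δ := by rw [norm_zero]; exact hs.pos
  have hself : edist (πX (s 0)) (πX (s 0)) < ε := by rw [edist_self]; exact hε
  have hself' : edist (πY 0) (πY 0) < ε := by rw [edist_self]; exact hε
  have hφ : ∀ p : Metric.eball (πX (s 0)) ε, ∃ u, ‖u‖ < δ ∧ (p : OrbitSpace g G hG hg) = πX (s u) := by
    rintro ⟨p, hp⟩
    rw [Metric.mem_eball'] at hp
    obtain ⟨z, rfl, hz⟩ := (OrbitSpace.edist_proj_lt_iff _ _ _).1 hp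
    exact hrep z (hz.trans_le hε₁')
  choose u hu hpu using hφ
  have hp0 : ∀ p : Metric.eball (πX (s 0)) ε, edist (πX (s 0)) (πX (s (u p))) < ε := by
    intro p
    rw [← hpu]
    exact Metric.mem_eball'.1 p.2
  have hq0 : ∀ p, edist (πY 0) (πY (u p)) < ε := fun p =>
    hA 0 (u p) hzero (hu p) hself ε le_self_add (hp0 p)
  have hiso : Isometry fun p => πY (u p) := by
    intro p q
    have hpq : edist p q = edist (πX (s (u p))) (πX (s (u q))) := by
      rw [← hpu, ← hpu]
      rfl
    rw [hpq]
    refine le_antisymm ?_ ?_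
    · have hlt : edist (πX (s (u p))) (πX (s (u q))) < ε + ε := by
        refine (edist_triangle _ (πX (s 0)) _).trans_lt (ENNReal.add_lt_add ?_ (hp0 q))
        rw [edist_comm]
        exact hp0 p
      refine le_of_forall_gt fun r hr => ?_
      exact (hA _ _ (hu p) (hu q) (hp0 p) (min r (ε + ε)) (min_le_right _ _)
        (lt_min hr hlt)).trans_le (min_le_left _ _)
    · have hlt : edist (πY (u p)) (πY (u q)) < ε + ε := by
        refine (edist_triangle _ (πY 0) _).trans_lt (ENNReal.add_lt_add ?_ (hq0 q))
        rw [edist_comm]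
        exact hq0 p
      refine le_of_forall_gt fun r hr => ?_
      exact (hB _ _ (hq0 p) (min r (ε + ε)) (min_le_right _ _)
        (lt_min hr hlt)).trans_le (min_le_left _ _)
  refine ⟨ε, hε, fun p => πY (u p), hiso, ?_⟩
  -- The image is the whole ball of radius `ε`, since both comparisons preserve the distance bound
  -- from the base point.
  have hr : range (fun p => πY (u p)) = Metric.eball (πY 0) ε := by
    ext q
    constructor
    · rintro ⟨p, rfl⟩
      exact Metric.mem_eball'.2 (hq0 p)
    · intro hq
      obtain ⟨w, rfl, hw0⟩ := (OrbitSpace.edist_proj_lt_iff _ _ _).1 (Metric.mem_eball'.1 hq)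
      have hlt : edist (πX (s 0)) (πX (s w)) < ε := hB 0 w hself' ε le_self_add (Metric.mem_eball'.1 hq)
      exact ⟨⟨πX (s w), Metric.mem_eball'.2 hlt⟩,
        hs.proj_eq_of_proj_slice_eq (hu _) (hrep₂ _ (hw0.trans_le hε₂')) (hpu _).symm⟩
  rw [hr]
  exact Metric.isOpen_eball

end SliceChart

/-- A point with a chart is an orbifold point. -/
theorem isOrbifoldPoint_of_isometry {X : Type*} [EMetricSpace X] {p : X} {ε : ℝ≥0∞} (hε : 0 < ε)
    {Γ : Subgroup (Orth n)} [Finite Γ] {h : CkMetric k α n} (hΓ : h.IsInvariant Γ)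
    {φ : Metric.eball p ε → OrbitSpace h Γ (isCompact_of_finite Γ) hΓ} (hφ : Isometry φ)
    (hopen : IsOpen (range φ)) : IsOrbifoldPoint k α p := by
  -- The radius `1` is arbitrary: any ball of the subspace is open in it, and the one isometry
  -- restricts to it with open image.
  refine ⟨ε, hε, n, fun y => ⟨1, one_pos, Γ, inferInstance, h, hΓ, fun q => φ q.1, ?_, ?_⟩⟩
  · exact hφ.comp isometry_subtype_coe
  · have hemb : IsOpenEmbedding φ := ⟨hφ.isEmbedding, hopen⟩
    have hr : range (fun q : Metric.eball y 1 => φ q.1) = φ '' Metric.eball y 1 := by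
      ext q
      constructor
      · rintro ⟨⟨r, hr⟩, rfl⟩
        exact ⟨r, hr, rfl⟩
      · rintro ⟨r, hr, rfl⟩
        exact ⟨⟨r, hr⟩, rfl⟩
    rw [hr]
    exact hemb.isOpenMap _ Metric.isOpen_eball

end Chart

/-- Moving a curve along its orbits by `exp ((r - t) ξ)` adds `ξ (c t)` to its velocity at time `t`.
In this way the velocity of a slice curve is made horizontal without changing its orbits. -/
theorem hasDerivWithinAt_expE_apply {V : Type*} [NormedAddCommGroup V] [InnerProductSpace ℝ V]
    [CompleteSpace V] (ξ : V →L[ℝ] V) {c : ℝ → V} {w : V} {I : Set ℝ} {t : ℝ}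
    (hc : HasDerivWithinAt c w I t) :
    HasDerivWithinAt (fun r : ℝ => expE ((r - t) • ξ) (c r)) (w + ξ (c t)) I t := by
  have h1 : HasDerivAt (fun r : ℝ => expE (r • ξ)) ξ (t - t) := by
    have := hasDerivAt_expE_smul ξ (t - t)
    rwa [sub_self, zero_smul, expE_zero, one_mul, ← sub_self t] at this
  have h2 : HasDerivAt (fun r : ℝ => expE ((r - t) • ξ)) ξ t := h1.comp_sub_const t t
  have h3 := h2.hasDerivWithinAt (s := I) |>.clm_apply hc
  rwa [sub_self, zero_smul, expE_zero, add_comm] at h3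

/-! ### The slice provides a chart -/

section Chart

variable {k : ℕ∞} {α : ℝ≥0} {m : ℕ}

set_option maxHeartbeats 2000000 in
/-- The chart of the orbit space given by the slice. -/
theorem SliceData.exists_sliceChart (hα : α ≤ 1) (g : CkMetric k α m) {G : Subgroup (Orth m)}
    (hg : g.IsInvariant G) {𝔱 : Submodule ℝ (Eucl m →L[ℝ] Eucl m)} {x : Eucl m} {ι : Type}
    [Fintype ι] {a b : ι → Eucl m} (hS : SliceData G 𝔱 x a b) {n : ℕ}
    (hn : n = Module.finrank ℝ (sliceSpace 𝔱 x b)) :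
    ∃ (Γ : Subgroup (Orth n)) (_ : Finite Γ) (h : CkMetric k α n) (_ : h.IsInvariant Γ)
      (s : Eucl n → Eucl m) (δ : ℝ), s 0 = x ∧ SliceChart g G h Γ s δ := by
  subst hn
  set S := sliceSpace 𝔱 x b with hSdef
  set i : Eucl (Module.finrank ℝ S) →ₗᵢ[ℝ] Eucl m :=
    S.subtypeₗᵢ.comp (stdOrthonormalBasis ℝ S).repr.symm.toLinearIsometry with hi_def
  have hi : ∀ v, v ∈ sliceSpace 𝔱 x b ↔ ∃ u, i u = v := by
    intro v
    constructor
    · intro hv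
      refine ⟨(stdOrthonormalBasis ℝ S).repr ⟨v, hv⟩, ?_⟩
      change (((stdOrthonormalBasis ℝ S).repr.symm ((stdOrthonormalBasis ℝ S).repr ⟨v, hv⟩) : S) :
        Eucl m) = v
      rw [LinearIsometryEquiv.symm_apply_apply]
    · rintro ⟨u, rfl⟩
      exact ((stdOrthonormalBasis ℝ S).repr.symm u).2
  obtain ⟨δ₀, hδ₀, htrans, hform⟩ := hS.exists_sliceForm hα i hi g.symm g.pos g.regular hg
  obtain ⟨δ₁, hδ₁, hfix₁⟩ := hS.lie.exists_apply_self_eq hS.compact x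
  -- Halving `δ₁` turns the strict bounds required there into bounds that hold on the closed ball.
  set δ := min δ₀ (δ₁ / 2) with hδ
  have hδpos : 0 < δ := by positivity
  have hfix : ∀ A ∈ G, ∀ u u' : Eucl (Module.finrank ℝ S), ‖u‖ ≤ δ → ‖u'‖ ≤ δ →
      A.1 (x + i u) = x + i u' → A.1 x = x := by
    intro A hA u u' hu hu' he
    have hlt : δ < δ₁ := (min_le_right _ _).trans_lt (by linarith)
    refine hfix₁ A hA (i u) (mem_sliceSpace.1 ((hi _).2 ⟨u, rfl⟩)).1 (i u')
      (mem_sliceSpace.1 ((hi _).2 ⟨u', rfl⟩)).1 ?_ ?_ he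
    · exact lt_of_eq_of_lt (i.norm_map u) (hu.trans_lt hlt)
    · exact lt_of_eq_of_lt (i.norm_map u') (hu'.trans_lt hlt)
  obtain ⟨h, hsymm, hpos, hreg, hinv, hle, hlift⟩ := hform δ hδpos (min_le_left _ _)
  have hfin : Finite (sliceStabilizer G x (sliceSpace 𝔱 x b)) := hS.finite_sliceStabilizer
  set Γ := inducedGroup i (sliceStabilizer G x (sliceSpace 𝔱 x b)) with hΓ
  have hΓfin : Finite Γ := finite_inducedGroup i _
  have hΓinv : (⟨h, hsymm, hpos, hreg⟩ : CkMetric k α (Module.finrank ℝ S)).IsInvariant Γ := by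
    rintro B ⟨A, hA, hAB⟩ u v w
    exact hinv A hA B hAB u v w
  have hs0 : x + i 0 = x := by rw [map_zero, add_zero]
  refine ⟨Γ, hΓfin, ⟨h, hsymm, hpos, hreg⟩, hΓinv, fun u => x + i u, δ, hs0, ?_⟩
  set hm : CkMetric k α (Module.finrank ℝ S) := ⟨h, hsymm, hpos, hreg⟩ with hhm
  refine ⟨hδpos, ?_, ?_, ?_, ?_, ?_⟩
  · intro z
    obtain ⟨A, hA, hmem, hn⟩ := hS.exists_sub_mem_sliceSpace z
    obtain ⟨u, hu⟩ := (hi _).1 hmem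
    refine ⟨A, hA, u, ?_, ?_⟩
    · rw [hu]
      abel
    · rw [← i.norm_map, hu, hs0]
      exact hn
  · rintro B ⟨A, hA, hAB⟩ u
    refine ⟨A, hA.1, ?_⟩
    have h1 : A.1 x = x := hA.2.1
    rw [map_add, hAB, h1]
  · intro A hA u u' hu hu' he
    obtain ⟨_, _, B, hB, _, hBu⟩ :=
      hS.exists_inducedGroup_apply_eq hi hA (hfix A hA u u' hu.le hu'.le he) he
    exact ⟨B, hB, hBu⟩
  · intro c I t v hc hct ε hε
    obtain ⟨ξ, hξ, hξle⟩ := hlift (c t) hct.le v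
    set y := x + i (c t) with hy
    have hsc : HasDerivWithinAt (fun r => x + i (c r)) (i v) I t :=
      (i.toContinuousLinearMap.hasFDerivAt.comp_hasDerivWithinAt t hc).const_add x
    have hk := hasDerivWithinAt_expE_apply ξ hsc
    have hkt : expE ((t - t) • ξ) (x + i (c t)) = y := by
      have : expE ((t - t) • ξ) = 1 := by
        have h0 : (t - t) • ξ = 0 := by
          rw [sub_self]
          exact zero_smul ℝ ξ
        rw [h0]
        exact expE_zero
      rw [this]
      rfl
    have hD : ∀ ε : ℝ, 0 < ε → ∀ᶠ z in 𝓝 (expE ((t - t) • ξ) (x + i (c t))), g.riemDist y z ≤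
        ENNReal.ofReal (√(g y (z - expE ((t - t) • ξ) (x + i (c t)))
          (z - expE ((t - t) • ξ) (x + i (c t)))) +
            ε * ‖z - expE ((t - t) • ξ) (x + i (c t))‖) := by
      intro ε hε
      rw [hkt]
      exact g.eventually_riemDist_le y hε
    have hmain := eventually_le_of_hasDerivWithinAt (b := g y) (g.symm y) (g.nonneg y) hk hD hε
    filter_upwards [hmain] with r hr
    obtain ⟨A, hA, hAe⟩ := hS.lie.exp_mem _ (𝔱.smul_mem (r - t) hξ)
    refine ⟨A, hA, ?_⟩
    rw [hAe]
    refine hr.trans (ENNReal.ofReal_le_ofReal ?_)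
    gcongr
  · intro u₀ hu₀ ε hε
    set y := x + i u₀ with hy
    set M := √‖g y‖ with hM
    have hM0 : 0 ≤ M := Real.sqrt_nonneg _
    -- Since `‖v‖ ≤ 12 * ‖z - y‖`, the error `ε / 24` costs `ε / 2`; the other half pays for the
    -- deviation of `i v + w` from `C (z - y)`, measured with `M`.
    have h1 := hm.eventually_riemDist_le u₀ (ε := ε / 24) (by positivity)
    obtain ⟨ρ, hρ, hball⟩ := Metric.eventually_nhds_iff_ball.1 h1
    have h2 := hS.eventually_exists_near hi hfix hu₀.le
      (htrans u₀ (hu₀.le.trans (min_le_left _ _))) (ε := ε / (2 * (M + 1))) (by positivity)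
    filter_upwards [h2, Metric.ball_mem_nhds y (ε := ρ / 12) (by positivity)] with z hz hzρ A hA u'
      hu' hAz
    obtain ⟨B, hB, C, hC, w, hw, hCy, hclose, hnorm⟩ := hz A hA u' hu'.le hAz
    refine ⟨B, hB, ?_⟩
    rw [Metric.mem_ball, dist_eq_norm] at hzρ
    refine (hball (B.1 u') ?_).trans (ENNReal.ofReal_le_ofReal ?_)
    · rw [Metric.mem_ball, dist_eq_norm]
      linarith
    · set v := B.1 u' - u₀ with hv
      -- Here `w` is any vertical vector, so only the minimality of the slice form in its class is
      -- used.
      have h3 : √(hm u₀ v v) ≤ √(g y (i v + w) (i v + w)) :=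
        Real.sqrt_le_sqrt (hle u₀ hu₀.le v w hw)
      have h4 := g.sqrt_apply_le_of_norm_sub_le y _ _ hclose
      have h5 : g y (C.1 (z - y)) (C.1 (z - y)) = g y (z - y) (z - y) := by
        have := hg C hC y (z - y) (z - y)
        rwa [hCy] at this
      rw [h5] at h4
      have h6 : M * (ε / (2 * (M + 1)) * ‖z - y‖) ≤ ε / 2 * ‖z - y‖ := by
        rw [← mul_assoc]
        gcongr
        rw [← mul_div_assoc, div_le_div_iff₀ (by positivity) (by positivity)]
        nlinarith
      have h7 : ε / 24 * ‖v‖ ≤ ε / 24 * (12 * ‖z - y‖) := by gcongr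
      linarith

end Chart

/-! ### Dimension estimates -/

section FixedSpace

variable {V : Type*} [NormedAddCommGroup V] [InnerProductSpace ℝ V] [CompleteSpace V]
  [FiniteDimensional ℝ V] {G : Subgroup (unitary (V →L[ℝ] V))} {𝔱 : Submodule ℝ (V →L[ℝ] V)}

/-- The orbits through the fixed space of the stabilizer of `x` meet the normal space at `x`. -/
theorem IsAbelianLieAlgebra.exists_mem_fixedSpace_inf (h : IsAbelianLieAlgebra G 𝔱)
    (hG : IsCompact (G : Set (unitary (V →L[ℝ] V)))) {x y : V} (hy : y ∈ fixedSpace 𝔱 x) :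
    ∃ A ∈ G, A.1 y ∈ (fixedSpace 𝔱 x ⊓ (orbitTangent 𝔱 x)ᗮ : Submodule ℝ V) := by
  -- The maximum is taken over the centralizer of `𝔱` in `G` only: a general element of `G` merely
  -- normalizes `𝔱` and could leave the fixed space. The centralizer still contains the exponentials
  -- of `𝔱` needed for the first-order condition.
  have hcl : IsClosed {A : unitary (V →L[ℝ] V) | ∀ ξ ∈ 𝔱, ∀ v, A.1 (ξ v) = ξ (A.1 v)} := by
    simp only [ofPred_forall]
    refine isClosed_iInter fun ξ => isClosed_iInter fun _ => isClosed_iInter fun v => ?_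
    exact isClosed_eq (continuous_unitary_apply _) (ξ.continuous.comp (continuous_unitary_apply v))
  obtain ⟨A, ⟨hA, hAc⟩, hmax⟩ := (hG.inter_right hcl).exists_isMaxOn ⟨1, G.one_mem, fun _ _ _ => rfl⟩
    (f := fun A : unitary (V →L[ℝ] V) => inner ℝ (A.1 y) x)
    ((continuous_unitary_apply y).inner continuous_const).continuousOn
  have hAc' : ∀ ξ ∈ 𝔱, ∀ v, A.1 (ξ v) = ξ (A.1 v) := hAc
  refine ⟨A, hA, fun ξ hξ hξx => ?_, mem_orbitTangent_orthogonal.2 fun ξ hξ => ?_⟩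
  · rw [← hAc' ξ hξ, hy ξ hξ hξx, map_zero]
  · rw [h.skew ξ hξ, real_inner_comm, neg_eq_zero]
    refine inner_apply_eq_zero_of_isMax fun t => ?_
    obtain ⟨C, hC, hCe⟩ := h.exp_mem _ (𝔱.smul_mem t hξ)
    rw [← hCe]
    refine hmax (a := C * A) ⟨G.mul_mem hC hA, fun η hη v => ?_⟩
    change C.1 (A.1 (η v)) = η (C.1 (A.1 v))
    rw [hAc' η hη, hCe]
    have hcomm : Commute (expE (t • ξ)) η := by
      have hc : Commute (t • ξ) η := (show Commute ξ η from h.comm ξ hξ η hη).smul_left t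
      let : NormedAlgebra ℚ (V →L[ℝ] V) := NormedAlgebra.restrictScalars ℚ ℝ (V →L[ℝ] V)
      exact Commute.exp_left hc
    exact congrArg (fun F : V →L[ℝ] V => F (A.1 v)) hcomm

end FixedSpace

/-! ### Hausdorff dimension in orbit spaces -/

namespace OrbitSpace

variable {k : ℕ∞} {α : ℝ≥0} {m : ℕ} {g : CkMetric k α m} {T : Subgroup (Orth m)}
  {hT : IsCompact (T : Set (Orth m))} {hg : g.IsInvariant T}

theorem edist_proj_le (x y : Eucl m) :
    edist (proj x : OrbitSpace g T hT hg) (proj y) ≤ g.riemDist x y :=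
  le_of_forall_gt fun _ hr => (edist_proj_lt_iff _ _ _).2 ⟨y, rfl, hr⟩

theorem exists_lipschitzOnWith_proj (x : Eucl m) : ∃ C : ℝ≥0, ∃ U ∈ 𝓝 x,
    LipschitzOnWith C (proj : Eucl m → OrbitSpace g T hT hg) U := by
  obtain ⟨C, U, hU, h⟩ := g.exists_riemDist_le_mul x
  exact ⟨C, U, hU, fun y hy z hz => (edist_proj_le y z).trans (h y hy z hz)⟩

theorem continuous_proj : Continuous (proj : Eucl m → OrbitSpace g T hT hg) := by
  refine continuous_iff_continuousAt.2 fun x => ?_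
  obtain ⟨C, U, hU, h⟩ := exists_lipschitzOnWith_proj (g := g) (hT := hT) (hg := hg) x
  exact h.continuousOn.continuousAt hU

theorem dimH_proj_image_submodule_le (N : Submodule ℝ (Eucl m)) :
    dimH ((proj : Eucl m → OrbitSpace g T hT hg) '' N) ≤ Module.finrank ℝ N := by
  refine (dimH_image_le_of_locally_lipschitzOn fun x _ => ?_).trans ?_
  · obtain ⟨C, U, hU, h⟩ := exists_lipschitzOnWith_proj (g := g) (hT := hT) (hg := hg) x
    exact ⟨C, U, mem_nhdsWithin_of_mem_nhds hU, h⟩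
  · have h1 : (N : Set (Eucl m)) = ((↑) : N → Eucl m) '' univ := by
      rw [image_univ, Subtype.range_coe]
    rw [h1, isometry_subtype_coe.dimH_image]
    exact (Real.dimH_univ_eq_finrank N).le

/-- Where the stabilizer is trivial, the projection is locally bi-Lipschitz. -/
theorem exists_edist_le_mul_edist_proj [Finite T] {u : Eucl m}
    (hu : ∀ B ∈ T, (B : Eucl m →L[ℝ] Eucl m) u = u → B = 1) : ∃ C : ℝ≥0, ∃ U ∈ 𝓝 u,
      ∀ y ∈ U, ∀ z ∈ U, edist y z ≤ C * edist (proj y : OrbitSpace g T hT hg) (proj z) := by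
  -- Every nontrivial element moves `u` by at least `2 ρ`, so a ball of radius `ρ` about `u`
  -- contains at most one point of each orbit.
  obtain ⟨ρ, hρ, hsep⟩ : ∃ ρ : ℝ, 0 < ρ ∧ ∀ B ∈ T, B ≠ 1 →
      2 * ρ ≤ dist ((B : Eucl m →L[ℝ] Eucl m) u) u := by
    have hfin : {r : ℝ | ∃ B ∈ T, B ≠ 1 ∧ dist (B.1 u) u = r}.Finite := by
      have : (T : Set (Orth m)).Finite := toFinite _
      refine (this.image fun B => dist (B.1 u) u).subset ?_
      rintro r ⟨B, hB, -, rfl⟩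
      exact ⟨B, hB, rfl⟩
    rcases ({r : ℝ | ∃ B ∈ T, B ≠ 1 ∧ dist (B.1 u) u = r}).eq_empty_or_nonempty with he | hne
    · refine ⟨1, one_pos, fun B hB h1 => ?_⟩
      have : dist (B.1 u) u ∈ {r : ℝ | ∃ B ∈ T, B ≠ 1 ∧ dist (B.1 u) u = r} := ⟨B, hB, h1, rfl⟩
      rw [he] at this
      exact this.elim
    · obtain ⟨r, ⟨B, hB, hB1, rfl⟩, hmin⟩ := exists_min_image _ id hfin hne
      have hpos : 0 < dist (B.1 u) u := dist_pos.2 fun h => hB1 (hu B hB h)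
      refine ⟨dist (B.1 u) u / 2, by positivity, fun B' hB' h1 => ?_⟩
      rw [mul_div_cancel₀ _ two_ne_zero]
      exact hmin _ ⟨B', hB', h1, rfl⟩
  obtain ⟨C, δ, hδ, hC⟩ := g.exists_edist_le_mul u
  obtain ⟨c, hc, hcs⟩ := g.exists_riemDist_lt_subset u
    (Metric.ball_mem_nhds u (show 0 < min ρ (δ / 2) by positivity))
  obtain ⟨C', U', hU', hC'⟩ := g.exists_riemDist_le_mul u
  obtain ⟨c', hc', hcc, hctop⟩ : ∃ c' : ℝ≥0∞, 0 < c' ∧ c' + c' ≤ c ∧ c' ≠ ⊤ := by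
    refine ⟨min c 1 / 2, ENNReal.div_pos (by simp [hc.ne']) (by simp), ?_,
      ENNReal.div_ne_top (min_lt_of_right_lt ENNReal.one_lt_top).ne (by simp)⟩
    rw [ENNReal.add_halves]
    exact min_le_left _ _
  have hnear : ∀ᶠ y in 𝓝 u, y ∈ U' ∧ (C' + 1 : ℝ≥0∞) * edist u y < c' ∧ dist y u < min ρ (δ / 2) := by
    have h1 : Tendsto (fun y => (C' + 1 : ℝ≥0∞) * edist u y) (𝓝 u) (𝓝 0) := by
      have h2 : Continuous fun y => (C' + 1 : ℝ≥0∞) * edist u y :=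
        (ENNReal.continuous_const_mul (by simp)).comp (continuous_const.edist continuous_id)
      have h3 := h2.tendsto u
      simp only [edist_self, mul_zero] at h3
      exact h3
    filter_upwards [hU', h1.eventually_lt_const hc',
      Metric.ball_mem_nhds u (show 0 < min ρ (δ / 2) by positivity)] with y h1 h2 h3
    exact ⟨h1, h2, h3⟩
  refine ⟨max C 2, _, hnear, ?_⟩
  rintro y ⟨hyU, hyc, hyd⟩ z ⟨hzU, hzc, hzd⟩
  have hCle : (C : ℝ≥0∞) ≤ (max C 2 : ℝ≥0) := by exact_mod_cast le_max_left C 2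
  have h2le : (2 : ℝ≥0∞) ≤ (max C 2 : ℝ≥0) := by exact_mod_cast le_max_right C 2
  have hle : ∀ w, (C' + 1 : ℝ≥0∞) * edist u w < c' → edist u w ≤ c' := fun w hw =>
    (le_mul_of_one_le_left zero_le le_add_self).trans hw.le
  -- If the orbits are close, a nearby point of the orbit of `z` is `z` itself, and the distances
  -- can be compared upstairs. If they are at distance at least `c'`, the trivial bound `edist y z ≤
  -- 2 c'` suffices.
  rcases lt_or_ge (edist (proj y : OrbitSpace g T hT hg) (proj z)) c' with hlt | hge
  · have hyz : edist y z < ENNReal.ofReal δ := by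
      rw [edist_dist]
      refine (ENNReal.ofReal_lt_ofReal_iff hδ).2 ?_
      have h1 := dist_triangle_right y z u
      have h2 := hyd.trans_le (min_le_right _ _)
      have h3 := hzd.trans_le (min_le_right _ _)
      linarith
    have huy : g.riemDist u y ≤ c' := by
      refine (hC' u (mem_of_mem_nhds hU') y hyU).trans (le_trans ?_ hyc.le)
      gcongr
      exact le_self_add
    have hriem : g.riemDist y z ≤ edist (proj y : OrbitSpace g T hT hg) (proj z) := by
      refine le_of_forall_gt fun q hq => ?_
      obtain ⟨w, hw, hyw⟩ := (edist_proj_lt_iff _ _ _).1 (lt_min hq hlt)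
      have hwu : dist w u < min ρ (δ / 2) := by
        refine hcs w (lt_of_lt_of_le ((g.riemDist_triangle u y w).trans_lt ?_) hcc)
        exact ENNReal.add_lt_add_of_le_of_lt (ne_top_of_le_ne_top hctop huy) huy
          (hyw.trans_le (min_le_right _ _))
      obtain ⟨A, hA, hAw⟩ := proj_eq_iff.1 hw
      have hA1 : A = 1 := by
        by_contra hne
        have h1 := hsep A hA hne
        have h2 : dist (A.1 u) (A.1 w) = dist u w := by
          rw [dist_eq_norm, dist_eq_norm, ← map_sub]
          exact norm_unitary_apply A _
        have h3 := dist_triangle (A.1 u) (A.1 w) u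
        have h4 : dist (A.1 w) u < min ρ (δ / 2) := by
          rw [hAw]
          exact hzd
        have h5 := hwu.trans_le (min_le_left _ _)
        have h6 := h4.trans_le (min_le_left _ _)
        rw [dist_comm] at h5
        linarith
      have hwz : w = z := by
        rw [← hAw, hA1]
        rfl
      rw [← hwz]
      exact hyw.trans_le (min_le_left _ _)
    have hyδ : y ∈ Metric.ball u δ := by
      have := hyd.trans_le (min_le_right _ _)
      rw [Metric.mem_ball]
      linarith
    calc edist y z ≤ C * g.riemDist y z := hC y hyδ z hyz
      _ ≤ _ := by gcongr
  · calc edist y z ≤ edist y u + edist u z := edist_triangle _ _ _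
      _ ≤ c' + c' := by
        rw [edist_comm y u]
        exact add_le_add (hle y hyc) (hle z hzc)
      _ = 2 * c' := (two_mul _).symm
      _ ≤ _ := by gcongr

/-- Each nontrivial element fixes only a proper subspace, and the complements of finitely many
proper subspaces have dense intersection. -/
theorem exists_mem_trivial_stabilizer (T : Subgroup (Orth m)) [Finite T] {O : Set (Eucl m)}
    (hO : IsOpen O) (hne : O.Nonempty) :
    ∃ u ∈ O, ∀ B ∈ T, (B : Eucl m →L[ℝ] Eucl m) u = u → B = 1 := by
  have hd : Dense (⋂ B : {B : T // B ≠ 1}, {u : Eucl m | B.1.1.1 u ≠ u}) := by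
    refine dense_iInter_of_isOpen (fun B => ?_) fun B => ?_
    · exact isOpen_ne_fun B.1.1.1.continuous continuous_id
    · have h1 : {u : Eucl m | B.1.1.1 u ≠ u} =
          ((LinearMap.eqLocus (B.1.1.1 : Eucl m →ₗ[ℝ] Eucl m) LinearMap.id :
            Submodule ℝ (Eucl m)) : Set (Eucl m))ᶜ := rfl
      rw [h1, ← interior_eq_empty_iff_dense_compl]
      by_contra h0
      have htop := Submodule.eq_top_of_nonempty_interior' _ (nonempty_iff_ne_empty.2 h0)
      refine B.2 (Subtype.ext (Subtype.ext (ContinuousLinearMap.ext fun u => ?_)))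
      have : u ∈ LinearMap.eqLocus (B.1.1.1 : Eucl m →ₗ[ℝ] Eucl m) LinearMap.id := by
        rw [htop]
        trivial
      exact this
  obtain ⟨u, huO, hu⟩ := hd.exists_mem_open hO hne
  refine ⟨u, hu, fun B hB hBu => ?_⟩
  by_contra hne
  exact mem_iInter.1 huO ⟨⟨B, hB⟩, fun h => hne (congrArg Subtype.val h)⟩ hBu

/-- Nonempty open subsets of a quotient by a finite group have full dimension. -/
theorem le_dimH_of_isOpen [Finite T] {O : Set (OrbitSpace g T hT hg)} (hO : IsOpen O)
    (hne : O.Nonempty) : (m : ℝ≥0∞) ≤ dimH O := by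
  obtain ⟨u, huO, hu⟩ := exists_mem_trivial_stabilizer T (hO.preimage continuous_proj)
    (hne.preimage proj_surjective)
  obtain ⟨C, U, hU, hC⟩ := exists_edist_le_mul_edist_proj (g := g) (hT := hT) (hg := hg) hu
  set W := U ∩ (proj : Eucl m → OrbitSpace g T hT hg) ⁻¹' O with hW
  have hWn : W ∈ 𝓝 u := inter_mem hU ((hO.preimage continuous_proj).mem_nhds huO)
  have hanti : AntilipschitzWith C fun y : W => (proj (y : Eucl m) : OrbitSpace g T hT hg) :=
    fun y z => hC y y.2.1 z z.2.1
  calc (m : ℝ≥0∞) = dimH W := by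
        rw [Real.dimH_of_mem_nhds hWn, finrank_euclideanSpace_fin]
    _ = dimH (univ : Set W) := by
        rw [← isometry_subtype_coe.dimH_image (univ : Set W), image_univ, Subtype.range_coe]
    _ ≤ dimH ((fun y : W => (proj (y : Eucl m) : OrbitSpace g T hT hg)) '' univ) :=
        hanti.le_dimH_image _
    _ ≤ dimH O := dimH_mono (by
        rintro _ ⟨y, -, rfl⟩
        exact y.2.2)

end OrbitSpace

/-! ### Good orbits, bad orbits and the dimension of the orbit space -/

section Main

variable {k : ℕ∞} {α : ℝ≥0} {m : ℕ} {g : CkMetric k α m} {T : Subgroup (Orth m)}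
  {hT : IsCompact (T : Set (Orth m))} {hg : g.IsInvariant T} {𝔱 : Submodule ℝ (Eucl m →L[ℝ] Eucl m)}

theorem IsGoodPoint.exists_sliceData (h𝔱 : IsAbelianLieAlgebra T 𝔱)
    (hT : IsCompact (T : Set (Orth m))) {x : Eucl m} (hx : IsGoodPoint 𝔱 x) :
    ∃ (ι : Type) (_ : Fintype ι) (a b : ι → Eucl m), SliceData T 𝔱 x a b := by
  obtain ⟨ι, hι, a, b, hab, hmem, hx0, hspan⟩ := hx
  exact ⟨ι, hι, a, b, hT, h𝔱, hab, hmem, hx0, hspan⟩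

theorem isOrbifoldPoint_of_isGoodPoint (hα : α ≤ 1) (h𝔱 : IsAbelianLieAlgebra T 𝔱) {x : Eucl m}
    (hx : IsGoodPoint 𝔱 x) : IsOrbifoldPoint k α (OrbitSpace.proj x : OrbitSpace g T hT hg) := by
  obtain ⟨ι, _, a, b, hS⟩ := hx.exists_sliceData h𝔱 hT
  obtain ⟨Γ, _, h, hΓ, s, δ, hs0, hs⟩ := hS.exists_sliceChart hα g hg rfl
  rw [← hs0]
  obtain ⟨ε, hε, φ, hφ, hopen⟩ :=
    hs.exists_isometry (hG := hT) (hg := hg) (hΓ := isCompact_of_finite Γ) (hh := hΓ)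
  exact isOrbifoldPoint_of_isometry hε hΓ hφ hopen

/-- A point with trivial stabilizer algebra is good with no planes at all. Its slice is the normal
space of the orbit, of dimension at least `m - dim 𝔱`, and an open subset of a quotient of this
space by a finite group embeds isometrically in the orbit space. -/
theorem le_dimH_univ (hα : α ≤ 1) (h𝔱 : IsAbelianLieAlgebra T 𝔱) :
    (m : ℝ≥0∞) ≤ dimH (univ : Set (OrbitSpace g T hT hg)) + Module.finrank ℝ 𝔱 := by
  obtain ⟨x, hx⟩ := exists_trivial_stabilizer h𝔱.comm h𝔱.skew
  have hS : SliceData T 𝔱 x (fun j : Empty => j.elim) (fun j : Empty => j.elim) := by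
    refine ⟨hT, h𝔱, ⟨?_, ?_, fun j => j.elim⟩, fun j => j.elim, fun j => j.elim, fun ξ hξ h0 => ?_⟩
    · exact ⟨fun j => j.elim, fun j => j.elim⟩
    · exact ⟨fun j => j.elim, fun j => j.elim⟩
    · rw [hx ξ hξ h0]
      exact Submodule.zero_mem _
  obtain ⟨n, hn⟩ : ∃ n, n = Module.finrank ℝ
    (sliceSpace 𝔱 x (fun j : Empty => (j.elim : Eucl m))) := ⟨_, rfl⟩
  have hmn : m ≤ n + Module.finrank ℝ 𝔱 := by
    have h1 := Submodule.finrank_add_finrank_orthogonal (orbitTangent 𝔱 x)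
    have h2 : Module.finrank ℝ (orbitTangent 𝔱 x) ≤ Module.finrank ℝ 𝔱 :=
      LinearMap.finrank_range_le (evalAt 𝔱 x)
    have h3 : sliceSpace 𝔱 x (fun j : Empty => (j.elim : Eucl m)) = (orbitTangent 𝔱 x)ᗮ := by
      rw [sliceSpace, range_eq_empty, Submodule.span_empty, sup_bot_eq]
    rw [h3] at hn
    rw [finrank_euclideanSpace_fin] at h1
    omega
  obtain ⟨Γ, _, h, hΓ, s, δ, rfl, hs⟩ := hS.exists_sliceChart hα g hg hn
  obtain ⟨ε, hε, φ, hφ, hopen⟩ :=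
    hs.exists_isometry (hG := hT) (hg := hg) (hΓ := isCompact_of_finite Γ) (hh := hΓ)
  have h1 : (n : ℝ≥0∞) ≤ dimH (range φ) :=
    OrbitSpace.le_dimH_of_isOpen hopen ⟨_, ⟨⟨_, Metric.mem_eball_self hε⟩, rfl⟩⟩
  have h2 : dimH (range φ) ≤ dimH (univ : Set (OrbitSpace g T hT hg)) := by
    rw [← image_univ, hφ.dimH_image, ← isometry_subtype_coe.dimH_image]
    exact dimH_mono (subset_univ _)
  calc (m : ℝ≥0∞) ≤ (n : ℝ≥0∞) + Module.finrank ℝ 𝔱 := by exact_mod_cast hmn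
    _ ≤ _ := by gcongr; exact h1.trans h2

/-- The bad orbits lie in the image of finitely many subspaces. -/
theorem dimH_image_not_isGoodPoint_le (h𝔱 : IsAbelianLieAlgebra T 𝔱) {d : ℕ}
    (hd : ∀ x, ¬ IsGoodPoint 𝔱 x →
      Module.finrank ℝ (fixedSpace 𝔱 x ⊓ (orbitTangent 𝔱 x)ᗮ : Submodule ℝ (Eucl m)) ≤ d) :
    dimH ((OrbitSpace.proj : Eucl m → OrbitSpace g T hT hg) '' {x | ¬ IsGoodPoint 𝔱 x}) ≤ d := by
  -- Bad points of equal type lie in the fixed space of one of them, and their orbits meet the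
  -- normal part of that space.
  obtain ⟨κ, _, J, hJ⟩ := exists_finite_stabilizer_type h𝔱.comm h𝔱.skew
  have hcov : {x | ¬ IsGoodPoint 𝔱 x} ⊆ ⋃ j : κ, {x | ¬ IsGoodPoint 𝔱 x ∧ J x = j} :=
    fun x hx => mem_iUnion.2 ⟨J x, hx, rfl⟩
  refine (dimH_mono (image_mono hcov)).trans ?_
  rw [image_iUnion, dimH_iUnion]
  refine iSup_le fun j => ?_
  rcases ({x | ¬ IsGoodPoint 𝔱 x ∧ J x = j}).eq_empty_or_nonempty with he | ⟨x, hx, rfl⟩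
  · rw [he, image_empty, dimH_empty]
    exact zero_le
  · have hsub : (OrbitSpace.proj : Eucl m → OrbitSpace g T hT hg) ''
        {y | ¬ IsGoodPoint 𝔱 y ∧ J y = J x} ⊆ (OrbitSpace.proj : Eucl m → OrbitSpace g T hT hg) ''
        ((fixedSpace 𝔱 x ⊓ (orbitTangent 𝔱 x)ᗮ : Submodule ℝ (Eucl m)) : Set (Eucl m)) := by
      rintro _ ⟨y, ⟨-, hy⟩, rfl⟩
      obtain ⟨A, hA, hAy⟩ := h𝔱.exists_mem_fixedSpace_inf hT
        (show y ∈ fixedSpace 𝔱 x from fun ξ hξ h0 => hJ x y hy.symm ξ hξ h0)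
      exact ⟨A.1 y, hAy, (OrbitSpace.proj_eq_iff.2 ⟨A, hA, rfl⟩).symm⟩
    refine (dimH_mono hsub).trans ((OrbitSpace.dimH_proj_image_submodule_le _).trans ?_)
    exact_mod_cast hd x hx

theorem IsFiniteExtensionOfTorus.exists_abelianLieAlgebra (h : IsFiniteExtensionOfTorus T) :
    ∃ 𝔱 : Submodule ℝ (Eucl m →L[ℝ] Eucl m), IsAbelianLieAlgebra T 𝔱 := by
  obtain ⟨S, hST, hS, -, hfin⟩ := h
  obtain ⟨r, ⟨e⟩⟩ := id hS
  obtain ⟨𝔱, h𝔱⟩ := exists_abelianLieAlgebra_of_torus e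
  exact ⟨𝔱, h𝔱.of_finiteIndex hST hS.isCompact⟩

end Main

end TorusQuotient

theorem proposition3p1 (k : ℕ∞) (α : ℝ≥0) (_hα : α < 1) (m : ℕ)
    (g : TorusQuotient.CkMetric k α m) (T : Subgroup (TorusQuotient.Orth m))
    (hT : TorusQuotient.IsFiniteExtensionOfTorus T) (hg : g.IsInvariant T) :
    TorusQuotient.hausdorffDim
        {p : TorusQuotient.OrbitSpace g T hT.isCompact hg | ¬ TorusQuotient.IsOrbifoldPoint k α p}
      ≤ min ((m : EReal) - 4)
          (TorusQuotient.hausdorffDim (Set.univ : Set (TorusQuotient.OrbitSpace g T hT.isCompact hg))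
            - 3) := by
  obtain ⟨𝔱, h𝔱⟩ := hT.exists_abelianLieAlgebra
  set B := {p : TorusQuotient.OrbitSpace g T hT.isCompact hg |
    ¬ TorusQuotient.IsOrbifoldPoint k α p} with hB
  have hsub : B ⊆ TorusQuotient.OrbitSpace.proj '' {x | ¬ TorusQuotient.IsGoodPoint 𝔱 x} := by
    intro p hp
    obtain ⟨x, rfl⟩ := TorusQuotient.OrbitSpace.proj_surjective p
    exact ⟨x, fun hx => hp (TorusQuotient.isOrbifoldPoint_of_isGoodPoint _hα.le h𝔱 hx), rfl⟩
  rcases B.eq_empty_or_nonempty with he | hne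
  · rw [he, TorusQuotient.hausdorffDim, if_pos rfl]
    exact bot_le
  obtain ⟨p, hp⟩ := hne
  obtain ⟨x, hx, -⟩ := hsub hp
  have hfin : ∀ x, ¬ TorusQuotient.IsGoodPoint 𝔱 x → _ :=
    fun x hx => TorusQuotient.finrank_slice_of_not_isGoodPoint h𝔱.comm h𝔱.skew hx
  rw [finrank_euclideanSpace_fin] at hfin
  -- A bad point exists, so `m ≥ 4` and `m ≥ 3 + dim 𝔱`; the truncated subtractions of natural
  -- numbers below are therefore genuine.
  have hx' := hfin x hx
  have hcast : ∀ d : ℕ, ((d : ℝ≥0∞) : EReal) = (d : EReal) := fun d =>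
    (EReal.coe_nnreal_eq_coe_real d).trans (by rw [NNReal.coe_natCast]; rfl)
  have hle : ∀ d : ℕ, (∀ x, ¬ TorusQuotient.IsGoodPoint 𝔱 x → Module.finrank ℝ
      (TorusQuotient.fixedSpace 𝔱 x ⊓ (TorusQuotient.orbitTangent 𝔱 x)ᗮ :
        Submodule ℝ (TorusQuotient.Eucl m)) ≤ d) → (dimH B : EReal) ≤ (d : EReal) := by
    intro d hd
    have := (dimH_mono hsub).trans (TorusQuotient.dimH_image_not_isGoodPoint_le h𝔱 hd)
    have h2 := EReal.coe_ennreal_le_coe_ennreal_iff.2 this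
    rwa [hcast] at h2
  have hdim := TorusQuotient.le_dimH_univ (g := g) (hT := hT.isCompact) (hg := hg) _hα.le h𝔱
  rw [TorusQuotient.hausdorffDim, TorusQuotient.hausdorffDim,
    if_neg (nonempty_iff_ne_empty.1 ⟨p, hp⟩), if_neg (nonempty_iff_ne_empty.1 ⟨p, mem_univ p⟩)]
  have hsum : ∀ d c : ℕ, ((d + c : ℕ) : EReal) = (d : EReal) + (c : EReal) := fun d c =>
    Nat.cast_add d c
  refine le_min ?_ ?_
  · refine (hle (m - 4) fun x hx => by have := hfin x hx; omega).trans ?_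
    refine (EReal.le_sub_iff_add_le (Or.inl (EReal.natCast_ne_bot 4)) (Or.inl (EReal.natCast_ne_top 4))).2 (le_of_eq ?_)
    have h4 := hsum (m - 4) 4
    rw [Nat.sub_add_cancel (by omega)] at h4
    exact h4.symm
  · refine (hle (m - 3 - Module.finrank ℝ 𝔱) fun x hx => by have := hfin x hx; omega).trans ?_
    refine (EReal.le_sub_iff_add_le (Or.inl (EReal.natCast_ne_bot 3)) (Or.inl (EReal.natCast_ne_top 3))).2 ?_
    set D := dimH (univ : Set (TorusQuotient.OrbitSpace g T hT.isCompact hg)) with hD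
    set r := Module.finrank ℝ 𝔱 with hr
    -- This is `m - r ≤ D`, obtained by cancelling the finite number `r`; `D` itself need not be
    -- known to be finite.
    have h3 : ((m - 3 - r + 3 : ℕ) : ℝ≥0∞) ≤ D := by
      have h5 : m = (m - 3 - r + 3) + r := by omega
      have h6 : ((m - 3 - r + 3 : ℕ) : ℝ≥0∞) + r ≤ D + r := by
        refine le_trans (le_of_eq ?_) hdim
        exact_mod_cast h5.symm
      exact ENNReal.le_of_add_le_add_right (ENNReal.natCast_ne_top r) h6
    have h4 := EReal.coe_ennreal_le_coe_ennreal_iff.2 h3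
    rw [hcast, hsum] at h4
    exact h4
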